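/- Let $T$ be a tree whose edges are segments of positive length, with $d$ the path distance between points of $T$ (vertices or points of edges), and let $P_1,\dots,P_n$ be uncertain points on $T$. The point $P_i$ has a weight $w_i\ge 0$ and finitely many possible locations $p_{i1},\dots,p_{im_i}$ with probabilities $f_{ij}\ge 0$, $\sum_j f_{ij}=1$. Put $M=\sum_i m_i$ and, for $x\in T$, $\mathsf{Ed}(x,P_i)=w_i\sum_j f_{ij}\,d(x,p_{ij})$. Assume that all locations are vertices of $T$ and that every vertex of $T$ holds at least one location. Let $\lambda\ge 0$; a point $x\in T$ covers $P_i$ if $\mathsf{Ed}(x,P_i)\le\lambda$. For each $i$ let $p_i^*$ be a median of $P_i$, i.e. a vertex that minimizes $\mathsf{Ed}(\cdot,P_i)$ over $T$, and assume that $\mathsf{Ed}(p_i^*,P_i)\le\lambda$. Let $T_m$ be the minimum connected subtree of $T$ containing all medians, rooted at some median $r$, and for a vertex $v$ of $T_m$ let $T_m(v)$ be the subtree of $T_m$ rooted at $v$. Initially all $P_i$ are active; over time they may be deactivated. For a vertex $v$ of $T_m$, the candidate center at $v$ is the point $c$ on the path from $v$ to $r$ that is closest to $r$ among the points of this path covering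 every active $P_i$ whose median lies in $T_m(v)$. On a real RAM (exact arithmetic on reals, integer words of $O(\log (M+1))$ bits, unit cost), given $T$, the uncertain points, $\lambda$, the medians and $r$, one can build a data structure $\mathcal{A}_2$ in $O(M\log M+n\log^2 M+1)$ time such that, for every sequence of candidate-center-queries at vertices of $T_m$ and deactivations of active uncertain points, each query takes $O(1+\log n)$ worst-case time and returns the candidate center at the query vertex $v$ for the currently active points (or reports that no point of the path from $v$ to $r$ covers all active points with medians in $T_m(v)$, if that is the case), and each deactivation of a point $P_i$, which removes it from $\mathcal{A}_2$, takes $O(1+\log n)$ worst-case time. The programs and the implied constants do not depend on the input. -/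

import Mathlib

/-! ## Real RAM: a structured imperative language with a step count -/

namespace RealRAM

/-- A machine state: integer registers, real registers, integer arrays and real arrays.
A program mentions only finitely many registers and arrays (by their numbers). -/
structure State where
  nv : ℕ → ℕ
  rv : ℕ → ℝ
  na : ℕ → ℕ → ℕ
  ra : ℕ → ℕ → ℝ

/-- Integer expressions; `get a e` reads cell `e` of integer array `a`. -/
inductive NExp where
  | var (x : ℕ)
  | lit (k : ℕ)
  | get (a : ℕ) (e : NExp)
  | add (e f : NExp)
  | sub (e f : NExp)
  | mul (e f : NExp)
  | div (e f : NExp)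

/-- Real expressions; the only real constants are `0` and `1`. -/
inductive RExp where
  | var (x : ℕ)
  | zero
  | one
  | get (a : ℕ) (e : NExp)
  | add (e f : RExp)
  | sub (e f : RExp)
  | mul (e f : RExp)
  | div (e f : RExp)

/-- Tests. -/
inductive BExp where
  | nle (e f : NExp)
  | rle (e f : RExp)
  | neg (b : BExp)
  | conj (b c : BExp)

/-- Programs. -/
inductive Cmd where
  | nop
  | setN (x : ℕ) (e : NExp)
  | setR (x : ℕ) (e : RExp)
  | putN (a : ℕ) (i e : NExp)
  | putR (a : ℕ) (i : NExp) (e : RExp)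
  | seq (c d : Cmd)
  | ite (b : BExp) (c d : Cmd)
  | loop (b : BExp) (c : Cmd)

/-- A machine word holds the integers `< W`; an overflow makes the machine get stuck (`none`). -/
def word (W v : ℕ) : Option ℕ := if v < W then some v else none

/-- Value of an integer expression (`sub` is truncated, `div` rounds down, division by `0` is
stuck). -/
def NExp.eval (W : ℕ) (s : State) : NExp → Option ℕ
  | var x => word W (s.nv x)
  | lit k => word W k
  | get a e => (e.eval W s).bind fun i => word W (s.na a i)
  | add e f => (e.eval W s).bind fun x => (f.eval W s).bind fun y => word W (x + y)
  | sub e f => (e.eval W s).bind fun x => (f.eval W s).bind fun y => word W (x - y)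
  | mul e f => (e.eval W s).bind fun x => (f.eval W s).bind fun y => word W (x * y)
  | div e f => (e.eval W s).bind fun x => (f.eval W s).bind fun y =>
      if y = 0 then none else word W (x / y)

/-- Value of a real expression (exact arithmetic, division by `0` is stuck). -/
noncomputable def RExp.eval (W : ℕ) (s : State) : RExp → Option ℝ
  | var x => some (s.rv x)
  | zero => some 0
  | one => some 1
  | get a e => (e.eval W s).bind fun i => some (s.ra a i)
  | add e f => (e.eval W s).bind fun x => (f.eval W s).bind fun y => some (x + y)
  | sub e f => (e.eval W s).bind fun x => (f.eval W s).bind fun y => some (x - y)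
  | mul e f => (e.eval W s).bind fun x => (f.eval W s).bind fun y => some (x * y)
  | div e f => (e.eval W s).bind fun x => (f.eval W s).bind fun y =>
      if y = 0 then none else some (x / y)

/-- Value of a test. -/
noncomputable def BExp.eval (W : ℕ) (s : State) : BExp → Option Bool
  | nle e f => (e.eval W s).bind fun x => (f.eval W s).bind fun y => some (decide (x ≤ y))
  | rle e f => (e.eval W s).bind fun x => (f.eval W s).bind fun y => some (decide (x ≤ y))
  | neg b => (b.eval W s).bind fun x => some (!x)
  | conj b c => (b.eval W s).bind fun x => (c.eval W s).bind fun y => some (x && y)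

/-- Every operator, constant, register access and array access costs one step. -/
def NExp.cost : NExp → ℕ
  | var _ => 1
  | lit _ => 1
  | get _ e => e.cost + 1
  | add e f => e.cost + f.cost + 1
  | sub e f => e.cost + f.cost + 1
  | mul e f => e.cost + f.cost + 1
  | div e f => e.cost + f.cost + 1

/-- Number of steps for evaluating a real expression. -/
def RExp.cost : RExp → ℕ
  | var _ => 1
  | zero => 1
  | one => 1
  | get _ e => e.cost + 1
  | add e f => e.cost + f.cost + 1
  | sub e f => e.cost + f.cost + 1
  | mul e f => e.cost + f.cost + 1
  | div e f => e.cost + f.cost + 1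

/-- Number of steps for evaluating a test. -/
def BExp.cost : BExp → ℕ
  | nle e f => e.cost + f.cost + 1
  | rle e f => e.cost + f.cost + 1
  | neg b => b.cost + 1
  | conj b c => b.cost + c.cost + 1

/-- Write to an integer register. -/
def State.setN (s : State) (x v : ℕ) : State := { s with nv := Function.update s.nv x v }

/-- Write to a real register. -/
def State.setR (s : State) (x : ℕ) (v : ℝ) : State := { s with rv := Function.update s.rv x v }

/-- Write to a cell of an integer array. -/
def State.putN (s : State) (a i v : ℕ) : State :=
  { s with na := Function.update s.na a (Function.update (s.na a) i v) }

/-- Write to a cell of a real array. -/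
def State.putR (s : State) (a i : ℕ) (v : ℝ) : State :=
  { s with ra := Function.update s.ra a (Function.update (s.ra a) i v) }

/-- `Runs W c s s' t`: on the machine with word bound `W`, program `c` started in state `s`
terminates in state `s'` after exactly `t` steps. -/
inductive Runs (W : ℕ) : Cmd → State → State → ℕ → Prop
  | nop (s : State) : Runs W .nop s s 1
  | setN {x : ℕ} {e : NExp} {s : State} {v : ℕ} (h : e.eval W s = some v) :
      Runs W (.setN x e) s (s.setN x v) (e.cost + 1)
  | setR {x : ℕ} {e : RExp} {s : State} {v : ℝ} (h : e.eval W s = some v) :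
      Runs W (.setR x e) s (s.setR x v) (e.cost + 1)
  | putN {a : ℕ} {i e : NExp} {s : State} {j v : ℕ}
      (hi : i.eval W s = some j) (h : e.eval W s = some v) :
      Runs W (.putN a i e) s (s.putN a j v) (i.cost + e.cost + 1)
  | putR {a : ℕ} {i : NExp} {e : RExp} {s : State} {j : ℕ} {v : ℝ}
      (hi : i.eval W s = some j) (h : e.eval W s = some v) :
      Runs W (.putR a i e) s (s.putR a j v) (i.cost + e.cost + 1)
  | seq {c d : Cmd} {s s₁ s₂ : State} {t₁ t₂ : ℕ}
      (h₁ : Runs W c s s₁ t₁) (h₂ : Runs W d s₁ s₂ t₂) :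
      Runs W (.seq c d) s s₂ (t₁ + t₂)
  | iteTrue {b : BExp} {c d : Cmd} {s s₁ : State} {t : ℕ}
      (hb : b.eval W s = some true) (h : Runs W c s s₁ t) :
      Runs W (.ite b c d) s s₁ (b.cost + 1 + t)
  | iteFalse {b : BExp} {c d : Cmd} {s s₁ : State} {t : ℕ}
      (hb : b.eval W s = some false) (h : Runs W d s s₁ t) :
      Runs W (.ite b c d) s s₁ (b.cost + 1 + t)
  | loopTrue {b : BExp} {c : Cmd} {s s₁ s₂ : State} {t₁ t₂ : ℕ}
      (hb : b.eval W s = some true) (h₁ : Runs W c s s₁ t₁)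
      (h₂ : Runs W (.loop b c) s₁ s₂ t₂) :
      Runs W (.loop b c) s s₂ (b.cost + 1 + t₁ + t₂)
  | loopFalse {b : BExp} {c : Cmd} {s : State} (hb : b.eval W s = some false) :
      Runs W (.loop b c) s s (b.cost + 1)

end RealRAM

/-! ## Uncertain points on a tree -/

namespace UncertainTree

/-- A vertex-constrained instance: a tree `T` with `N` vertices and positive edge lengths
(given to the machine as a list of `N - 1` edges), and `n` uncertain points with altogether `M`
locations, all of them at vertices, such that each vertex holds at least one location.
Location `k` belongs to the uncertain point `owner k`, is at the vertex `loc k`, and has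
probability `prob k`.  The uncertain point `i` has weight `weight i`, and `range` is the covering
range. -/
structure Instance (N n M : ℕ) where
  graph : SimpleGraph (Fin N)
  isTree : graph.IsTree
  edge : Fin (N - 1) → Fin N × Fin N
  adj_iff : ∀ u v, graph.Adj u v ↔ ∃ k, s((edge k).1, (edge k).2) = s(u, v)
  len : Sym2 (Fin N) → ℝ
  len_pos : ∀ e ∈ graph.edgeSet, 0 < len e
  loc : Fin M → Fin N
  loc_surjective : Function.Surjective loc
  owner : Fin M → Fin n
  prob : Fin M → ℝ
  prob_nonneg : ∀ k, 0 ≤ prob k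
  prob_sum : ∀ i, ∑ k with owner k = i, prob k = 1
  weight : Fin n → ℝ
  weight_nonneg : ∀ i, 0 ≤ weight i
  range : ℝ
  range_nonneg : 0 ≤ range

namespace Instance

variable {N n M : ℕ} (I : Instance N n M)

/-- The simple path `π(a, b)` between two vertices of the tree. -/
noncomputable def path (a b : Fin N) : I.graph.Walk a b :=
  (I.isTree.existsUnique_path a b).choose

/-- The distance of two vertices: the sum of the edge lengths on the simple path. -/
noncomputable def vdist (a b : Fin N) : ℝ := ((I.path a b).edges.map I.len).sum

theorem vdist_self (a : Fin N) : I.vdist a a = 0 := by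
  have h := ((I.isTree.existsUnique_path a a).choose_spec.2 _ SimpleGraph.Walk.IsPath.nil).symm
  have hp : I.path a a = SimpleGraph.Walk.nil := h
  simp [vdist, hp]

/-- A point of `T`: the point at distance `t` from `u` on the edge `(u, w)`;
the case `u = w` (hence `t = 0`) describes the vertex `u`. -/
structure Point where
  u : Fin N
  w : Fin N
  t : ℝ
  adj : u = w ∨ I.graph.Adj u w
  t_nonneg : 0 ≤ t
  t_le : t ≤ I.vdist u w

/-- A vertex of `T` as a point of `T`. -/
noncomputable def vertexPoint (v : Fin N) : I.Point where
  u := v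
  w := v
  t := 0
  adj := Or.inl rfl
  t_nonneg := le_rfl
  t_le := (I.vdist_self v).ge

/-- The distance from a point of `T` to a vertex: one leaves the edge through one of its
two ends. -/
noncomputable def dist (p : I.Point) (x : Fin N) : ℝ :=
  min (p.t + I.vdist p.u x) (I.vdist p.u p.w - p.t + I.vdist p.w x)

/-- The point `p` of `T` lies on the simple path between the vertices `a` and `b`. -/
def OnPath (p : I.Point) (a b : Fin N) : Prop :=
  (p.u ∈ (I.path a b).support ∧ p.w ∈ (I.path a b).support) ∨
  (p.u ∈ (I.path a b).support ∧ p.t = 0) ∨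
  (p.w ∈ (I.path a b).support ∧ p.t = I.vdist p.u p.w)

/-- The expected distance `Ed(x, P_i)`. -/
noncomputable def expDist (x : I.Point) (i : Fin n) : ℝ :=
  I.weight i * ∑ k with I.owner k = i, I.prob k * I.dist x (I.loc k)

/-- The point `x` covers the uncertain point `P_i`. -/
def Covers (x : I.Point) (i : Fin n) : Prop := I.expDist x i ≤ I.range

/-- The vertex `m` is a median of `P_i`: it minimizes the expected distance over all points
of `T`. -/
def IsMedian (m : Fin N) (i : Fin n) : Prop :=
  ∀ x : I.Point, I.expDist (I.vertexPoint m) i ≤ I.expDist x i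

/-- The vertex set of `T_m`, the minimum connected subtree of `T` that contains all
medians. -/
def medianTree (med : Fin n → Fin N) : Set (Fin N) :=
  ⋂₀ {S | Set.range med ⊆ S ∧ (I.graph.induce S).Connected}

/-- The vertex set of `T_m(v)`, the subtree of `T_m` rooted at `v` when `T_m` has root `r`. -/
def subtree (med : Fin n → Fin N) (r v : Fin N) : Set (Fin N) :=
  {x ∈ I.medianTree med | v ∈ (I.path x r).support}

/-- The point `c` lies on `π(v, r)` and covers every active uncertain point whose median is in
`T_m(v)`, where `D` is the set of the deactivated uncertain points. -/
def IsFeasible (med : Fin n → Fin N) (r : Fin N) (D : Set (Fin n)) (v : Fin N)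
    (c : I.Point) : Prop :=
  I.OnPath c v r ∧ ∀ i ∉ D, med i ∈ I.subtree med r v → I.Covers c i

/-- The candidate center at `v`: the feasible point closest to the root. -/
def IsCandidateCenter (med : Fin n → Fin N) (r : Fin N) (D : Set (Fin n)) (v : Fin N)
    (c : I.Point) : Prop :=
  I.IsFeasible med r D v c ∧ ∀ c' : I.Point, I.IsFeasible med r D v c' → I.dist c r ≤ I.dist c' r

/-! ### Interface between the instances and the machine -/

/-- The contents of an array that holds the given list, followed by zeros. -/
def toArray {α : Type} [Zero α] {m : ℕ} (f : Fin m → α) (k : ℕ) : α :=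
  if h : k < m then f ⟨k, h⟩ else 0

/-- The initial machine state: the input, and zeros elsewhere. The integer registers `0, 1, 2, 3`
hold `N`, `n`, `M` and the root, the real register `0` holds the covering range; the integer
arrays `0, …, 4` hold the first ends and the second ends of the edges, the vertices and the owners
of the locations, and the medians; the real arrays `0, 1, 2` hold the edge lengths, the
probabilities of the locations, and the weights. -/
noncomputable def initState (med : Fin n → Fin N) (r : Fin N) : RealRAM.State where
  nv
    | 0 => N
    | 1 => n
    | 2 => M
    | 3 => r
    | _ => 0
  rv
    | 0 => I.range
    | _ => 0
  na
    | 0 => toArray fun k => ((I.edge k).1 : ℕ)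
    | 1 => toArray fun k => ((I.edge k).2 : ℕ)
    | 2 => toArray fun k => (I.loc k : ℕ)
    | 3 => toArray fun k => (I.owner k : ℕ)
    | 4 => toArray fun i => (med i : ℕ)
    | _ => fun _ => 0
  ra
    | 0 => toArray fun k => I.len s((I.edge k).1, (I.edge k).2)
    | 1 => toArray I.prob
    | 2 => toArray I.weight
    | _ => fun _ => 0

/-- The state `s` holds the correct answer to the candidate-center-query at `v`: either register
`0` holds `1`, and integer registers `1, 2` and real register `0` describe the candidate center
as a point at a given distance from the first end of an edge; or register `0` holds `0`, and no
point of `π(v, r)` covers all active uncertain points with medians in `T_m(v)`. -/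
def IsAnswer (med : Fin n → Fin N) (r : Fin N) (D : Set (Fin n)) (v : Fin N)
    (s : RealRAM.State) : Prop :=
  (s.nv 0 = 1 ∧ ∃ c : I.Point, I.IsCandidateCenter med r D v c ∧
    s.nv 1 = c.u ∧ s.nv 2 = c.w ∧ s.rv 0 = c.t) ∨
  (s.nv 0 = 0 ∧ ¬ ∃ c : I.Point, I.IsFeasible med r D v c)

/-- `I.Reachable W query delete med s₀ D s`: from the state `s₀`, in which all uncertain points
are active, some finite sequence of candidate-center-queries at vertices of `T_m` and deactivations
of active uncertain points, performed by the two given programs (the argument being put into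
integer register `0`), leads to the state `s`, and `D` is the set of the points deactivated. -/
inductive Reachable (W : ℕ) (query delete : RealRAM.Cmd) (med : Fin n → Fin N)
    (s₀ : RealRAM.State) : Set (Fin n) → RealRAM.State → Prop
  | start : Reachable W query delete med s₀ ∅ s₀
  | query {D : Set (Fin n)} {s s' : RealRAM.State} {t : ℕ} {v : Fin N}
      (h : Reachable W query delete med s₀ D s) (hv : v ∈ I.medianTree med)
      (hr : RealRAM.Runs W query (s.setN 0 v) s' t) :
      Reachable W query delete med s₀ D s'
  | delete {D : Set (Fin n)} {s s' : RealRAM.State} {t : ℕ} {i : Fin n}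
      (h : Reachable W query delete med s₀ D s) (hi : i ∉ D)
      (hr : RealRAM.Runs W delete (s.setN 0 i) s' t) :
      Reachable W query delete med s₀ (insert i D) s'

end Instance

end UncertainTree

/-! ## A weakest-precondition calculus for the real RAM -/

namespace RealRAM

/-! Root the tree at `r` and let the depth of a point be its distance from `r`. On the path from the
median of `P_i` to the root, the distance from the point of depth `δ` to a location of depth `e` is
`δ + e - 2 * min δ g`, where `g` is the depth of the lowest common ancestor of the location and the
median (`upDist_eq`). So the expected distance is a function of `δ` alone along this path
(`expDist_eq`). It is convex (`Points.ed_le_of_le`), and affine on each edge because its kinks `g`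
are depths of vertices on the path (`Points.ed_affine`). Since the median covers `P_i`, the covering
points of the path are those whose depth is at least a certain number, the key of `P_i`
(`edAt_le_iff`).

A point of the path from `v` to the root lies above every median in the subtree of `v`. It is
therefore feasible if and only if its depth is at least the keys of all active points with medians
in this subtree (`isFeasible_iff`). Hence the candidate center has the largest of these keys as its
depth, or depth `0` if there are none, and no feasible point exists when that key exceeds the depth
of `v` (`isAnswer_of_best`).

Nested intervals for the subtrees put the uncertain points into an order in which the medians below
`v` occupy a contiguous range (`anc_iff_pos`). A query is thus a range maximum in a segment tree
over the keys (`query_spec`). A deactivation replaces a leaf by a sentinel with key `0`, which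
stands for the root, and repairs the nodes above that leaf (`delete_spec`). Both take logarithmic
time in `n`.

To find the keys, all uncertain points search for their highest covering vertices simultaneously by
binary lifting: one pass over all locations evaluates one expected distance per uncertain point, and
there are logarithmically many passes (`search_spec`). A linear interpolation on the next edge gives
the key (`interpolate_spec`). The lowest common ancestors come from binary lifting as well
(`climb_spec`). The tree is given as an edge list and is rooted by stripping leaves, where sums over
the neighbours replace adjacency lists (`StripInv.step`). As `N ≤ M` and `n ≤ M`, everything fits
into `O(M log M + 1)`.

The programs are verified by specifications `WP` with explicit time bounds. All integers that occur
are bounded by a quadratic polynomial in `M`, so a fixed power of `M + 1` suffices as the word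
bound. -/

/-- Unbounded value of an integer expression. -/
def NExp.val (s : State) : NExp → ℕ
  | var x => s.nv x
  | lit k => k
  | get a e => s.na a (e.val s)
  | add e f => e.val s + f.val s
  | sub e f => e.val s - f.val s
  | mul e f => e.val s * f.val s
  | div e f => e.val s / f.val s

/-- The evaluation of an integer expression does not get stuck. -/
def NExp.ok (W : ℕ) (s : State) : NExp → Prop
  | var x => s.nv x < W
  | lit k => k < W
  | get a e => e.ok W s ∧ s.na a (e.val s) < W
  | add e f => e.ok W s ∧ f.ok W s ∧ e.val s + f.val s < W
  | sub e f => e.ok W s ∧ f.ok W s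
  | mul e f => e.ok W s ∧ f.ok W s ∧ e.val s * f.val s < W
  | div e f => e.ok W s ∧ f.ok W s ∧ f.val s ≠ 0

/-- Value of a real expression, with Mathlib's convention for the division by zero. -/
noncomputable def RExp.val (s : State) : RExp → ℝ
  | var x => s.rv x
  | zero => 0
  | one => 1
  | get a e => s.ra a (e.val s)
  | add e f => e.val s + f.val s
  | sub e f => e.val s - f.val s
  | mul e f => e.val s * f.val s
  | div e f => e.val s / f.val s

/-- The evaluation of a real expression does not get stuck. -/
def RExp.ok (W : ℕ) (s : State) : RExp → Prop
  | var _ => True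
  | zero => True
  | one => True
  | get _ e => e.ok W s
  | add e f => e.ok W s ∧ f.ok W s
  | sub e f => e.ok W s ∧ f.ok W s
  | mul e f => e.ok W s ∧ f.ok W s
  | div e f => e.ok W s ∧ f.ok W s ∧ f.val s ≠ 0

/-- The proposition expressed by a test. -/
def BExp.val (s : State) : BExp → Prop
  | nle e f => e.val s ≤ f.val s
  | rle e f => e.val s ≤ f.val s
  | neg b => ¬ b.val s
  | conj b c => b.val s ∧ c.val s

/-- The evaluation of a test does not get stuck. -/
def BExp.ok (W : ℕ) (s : State) : BExp → Prop
  | nle e f => e.ok W s ∧ f.ok W s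
  | rle e f => e.ok W s ∧ f.ok W s
  | neg b => b.ok W s
  | conj b c => b.ok W s ∧ c.ok W s

/-- The bound on the value is carried through the induction for the sake of `sub` and `div`: their
results do not exceed the first operand, which is why `ok` has no overflow clause for them. -/
theorem NExp.eval_of_ok {W : ℕ} {s : State} {e : NExp} (h : e.ok W s) :
    e.eval W s = some (e.val s) ∧ e.val s < W := by
  induction e with
  | var x => simpa [NExp.ok, NExp.eval, NExp.val, word] using h
  | lit k => simpa [NExp.ok, NExp.eval, NExp.val, word] using h
  | get a e ih =>
    simp only [NExp.ok] at h
    simp [NExp.eval, NExp.val, word, (ih h.1).1, h.2]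
  | add e f ihe ihf =>
    simp only [NExp.ok] at h
    simp [NExp.eval, NExp.val, word, (ihe h.1).1, (ihf h.2.1).1, h.2.2]
  | sub e f ihe ihf =>
    simp only [NExp.ok] at h
    have h1 := ihe h.1
    have h2 : e.val s - f.val s < W := by omega
    simp [NExp.eval, NExp.val, word, h1.1, (ihf h.2).1, h2]
  | mul e f ihe ihf =>
    simp only [NExp.ok] at h
    simp [NExp.eval, NExp.val, word, (ihe h.1).1, (ihf h.2.1).1, h.2.2]
  | div e f ihe ihf =>
    simp only [NExp.ok] at h
    have h1 := ihe h.1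
    have h2 : e.val s / f.val s < W := lt_of_le_of_lt (Nat.div_le_self _ _) h1.2
    simp [NExp.eval, NExp.val, word, h1.1, (ihf h.2.1).1, h2, h.2.2]

theorem RExp.eval_of_ok {W : ℕ} {s : State} {e : RExp} (h : e.ok W s) :
    e.eval W s = some (e.val s) := by
  induction e with
  | var x => rfl
  | zero => rfl
  | one => rfl
  | get a e => simp [RExp.eval, RExp.val, (NExp.eval_of_ok (e := e) h).1]
  | add e f ihe ihf => simp only [RExp.ok] at h; simp [RExp.eval, RExp.val, ihe h.1, ihf h.2]
  | sub e f ihe ihf => simp only [RExp.ok] at h; simp [RExp.eval, RExp.val, ihe h.1, ihf h.2]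
  | mul e f ihe ihf => simp only [RExp.ok] at h; simp [RExp.eval, RExp.val, ihe h.1, ihf h.2]
  | div e f ihe ihf =>
    simp only [RExp.ok] at h
    simp [RExp.eval, RExp.val, ihe h.1, ihf h.2.1, h.2.2]

open Classical in
theorem BExp.eval_of_ok {W : ℕ} {s : State} {b : BExp} (h : b.ok W s) :
    b.eval W s = some (decide (b.val s)) := by
  induction b with
  | nle e f =>
    simp only [BExp.ok] at h
    rw [BExp.eval, (NExp.eval_of_ok h.1).1, (NExp.eval_of_ok h.2).1]
    simp only [Option.bind_some, BExp.val]
    congr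
  | rle e f =>
    simp only [BExp.ok] at h
    rw [BExp.eval, RExp.eval_of_ok h.1, RExp.eval_of_ok h.2]
    simp only [Option.bind_some, BExp.val]
    congr
  | neg b ih => by_cases hb : b.val s <;> simp [BExp.eval, BExp.val, ih h, hb]
  | conj b c ihb ihc =>
    simp only [BExp.ok] at h
    by_cases hb : b.val s <;> by_cases hc : c.val s <;>
      simp [BExp.eval, BExp.val, ihb h.1, ihc h.2, hb, hc]

/-- The program terminates within `T` steps in a state that satisfies `Q`. -/
def WP (W : ℕ) (c : Cmd) (T : ℕ) (s : State) (Q : State → Prop) : Prop :=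
  ∃ s' t, Runs W c s s' t ∧ t ≤ T ∧ Q s'

theorem WP.mono {W : ℕ} {c : Cmd} {T T' : ℕ} {s : State} {Q Q' : State → Prop}
    (h : WP W c T s Q) (hT : T ≤ T') (hQ : ∀ s', Q s' → Q' s') : WP W c T' s Q' := by
  obtain ⟨s', t, hr, ht, hq⟩ := h
  exact ⟨s', t, hr, ht.trans hT, hQ _ hq⟩

theorem WP.seq {W : ℕ} {c d : Cmd} {T₁ T₂ : ℕ} {s : State} {Q : State → Prop}
    (h : WP W c T₁ s fun s' => WP W d T₂ s' Q) : WP W (.seq c d) (T₁ + T₂) s Q := by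
  obtain ⟨s₁, t₁, h₁, ht₁, s₂, t₂, h₂, ht₂, hq⟩ := h
  exact ⟨s₂, t₁ + t₂, .seq h₁ h₂, by omega, hq⟩

/-- The verification condition of a program without loops. -/
def Cmd.vc (W : ℕ) : Cmd → (State → Prop) → State → Prop
  | nop, Q, s => Q s
  | setN x e, Q, s => e.ok W s ∧ Q (s.setN x (e.val s))
  | setR x e, Q, s => e.ok W s ∧ Q (s.setR x (e.val s))
  | putN a i e, Q, s => i.ok W s ∧ e.ok W s ∧ Q (s.putN a (i.val s) (e.val s))
  | putR a i e, Q, s => i.ok W s ∧ e.ok W s ∧ Q (s.putR a (i.val s) (e.val s))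
  | seq c d, Q, s => c.vc W (fun s' => d.vc W Q s') s
  | ite b c d, Q, s => b.ok W s ∧ (b.val s → c.vc W Q s) ∧ (¬ b.val s → d.vc W Q s)
  | loop _ _, _, _ => False

/-- An upper bound for the cost of a program without loops. -/
def Cmd.cost : Cmd → ℕ
  | nop => 1
  | setN _ e => e.cost + 1
  | setR _ e => e.cost + 1
  | putN _ i e => i.cost + e.cost + 1
  | putR _ i e => i.cost + e.cost + 1
  | seq c d => c.cost + d.cost
  | ite b c d => b.cost + 1 + (c.cost + d.cost)
  -- A dummy value: the verification condition of a loop is `False`, so no bound is ever derived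
  -- from it.
  | loop _ _ => 0

theorem WP.of_vc {W : ℕ} {c : Cmd} {s : State} {Q : State → Prop} (h : c.vc W Q s) :
    WP W c c.cost s Q := by
  induction c generalizing s Q with
  | nop => exact ⟨s, 1, .nop s, le_rfl, h⟩
  | setN x e => exact ⟨_, _, .setN (NExp.eval_of_ok h.1).1, le_rfl, h.2⟩
  | setR x e => exact ⟨_, _, .setR (RExp.eval_of_ok h.1), le_rfl, h.2⟩
  | putN a i e =>
    exact ⟨_, _, .putN (NExp.eval_of_ok h.1).1 (NExp.eval_of_ok h.2.1).1, le_rfl, h.2.2⟩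
  | putR a i e =>
    exact ⟨_, _, .putR (NExp.eval_of_ok h.1).1 (RExp.eval_of_ok h.2.1), le_rfl, h.2.2⟩
  | seq c d ihc ihd => exact WP.seq ((ihc h).mono le_rfl fun _ h' => ihd h')
  | ite b c d ihc ihd =>
    obtain ⟨h0, h1, h2⟩ := h
    have hb := BExp.eval_of_ok h0
    by_cases hv : b.val s
    · obtain ⟨s', t, hr, ht, hq⟩ := ihc (h1 hv)
      refine ⟨s', _, .iteTrue (by simpa [hv] using hb) hr, ?_, hq⟩
      simp only [Cmd.cost]; omega
    · obtain ⟨s', t, hr, ht, hq⟩ := ihd (h2 hv)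
      refine ⟨s', _, .iteFalse (by simpa [hv] using hb) hr, ?_, hq⟩
      simp only [Cmd.cost]; omega
  | loop b c => exact h.elim

/-- The general rule for loops; the first argument of `Inv` bounds the number of the remaining
iterations. -/
theorem WP.loop {W : ℕ} {b : BExp} {c : Cmd} {T : ℕ} (Inv : ℕ → State → Prop) {Q : State → Prop}
    (hb : ∀ k s, Inv k s → b.ok W s)
    (hQ : ∀ k s, Inv k s → ¬ b.val s → Q s)
    (hstep : ∀ k s, Inv k s → b.val s → ∃ k', k = k' + 1 ∧ WP W c T s (Inv k'))
    {k : ℕ} {s : State} (h : Inv k s) :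
    WP W (.loop b c) (k * (b.cost + 1 + T) + (b.cost + 1)) s Q := by
  induction k generalizing s with
  | zero =>
    by_cases hv : b.val s
    · obtain ⟨k', hk, -⟩ := hstep _ _ h hv
      omega
    · exact ⟨s, _, .loopFalse (by simpa [hv] using BExp.eval_of_ok (hb _ _ h)), by omega,
        hQ _ _ h hv⟩
  | succ k ih =>
    by_cases hv : b.val s
    · obtain ⟨k', hk, s₁, t₁, hr, ht, hi⟩ := hstep _ _ h hv
      obtain rfl : k = k' := by omega
      obtain ⟨s₂, t₂, hr₂, ht₂, hq⟩ := ih hi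
      refine ⟨s₂, _, .loopTrue (by simpa [hv] using BExp.eval_of_ok (hb _ _ h)) hr hr₂, ?_, hq⟩
      rw [Nat.succ_mul]; omega
    · exact ⟨s, _, .loopFalse (by simpa [hv] using BExp.eval_of_ok (hb _ _ h)),
        Nat.le_add_left _ _, hQ _ _ h hv⟩

/-- `Reachable` speaks of arbitrary runs, `WP` of one run that exists. Determinism identifies their
final states. -/
theorem Runs.deterministic {W : ℕ} {c : Cmd} {s s₁ s₂ : State} {t₁ t₂ : ℕ}
    (h₁ : Runs W c s s₁ t₁) (h₂ : Runs W c s s₂ t₂) : s₁ = s₂ := by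
  induction h₁ generalizing s₂ t₂ with
  | nop s => cases h₂; rfl
  | setN h => cases h₂ with | setN h' => rw [h] at h'; cases h'; rfl
  | setR h => cases h₂ with | setR h' => rw [h] at h'; cases h'; rfl
  | putN hi h =>
    cases h₂ with | putN hi' h' => rw [h] at h'; rw [hi] at hi'; cases h'; cases hi'; rfl
  | putR hi h =>
    cases h₂ with | putR hi' h' => rw [h] at h'; rw [hi] at hi'; cases h'; cases hi'; rfl
  | seq _ _ ih₁ ih₂ =>
    cases h₂ with | seq h₁' h₂' => obtain rfl := ih₁ h₁'; exact ih₂ h₂'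
  | iteTrue hb _ ih =>
    cases h₂ with
    | iteTrue _ h' => exact ih h'
    | iteFalse hb' _ => rw [hb] at hb'; cases hb'
  | iteFalse hb _ ih =>
    cases h₂ with
    | iteFalse _ h' => exact ih h'
    | iteTrue hb' _ => rw [hb] at hb'; cases hb'
  | loopTrue hb _ _ ih₁ ih₂ =>
    cases h₂ with
    | loopTrue _ h₁' h₂' => obtain rfl := ih₁ h₁'; exact ih₂ h₂'
    | loopFalse hb' => rw [hb] at hb'; cases hb'
  | loopFalse hb =>
    cases h₂ with
    | loopTrue hb' _ _ => rw [hb] at hb'; cases hb'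
    | loopFalse _ => rfl

/-! ### Frame conditions and counting loops -/

/-- The program writes to integer register `y`. -/
def Cmd.writesNv (y : ℕ) : Cmd → Bool
  | setN x _ => x == y
  | seq c d => c.writesNv y || d.writesNv y
  | ite _ c d => c.writesNv y || d.writesNv y
  | loop _ c => c.writesNv y
  | _ => false

/-- The program writes to real register `y`. -/
def Cmd.writesRv (y : ℕ) : Cmd → Bool
  | setR x _ => x == y
  | seq c d => c.writesRv y || d.writesRv y
  | ite _ c d => c.writesRv y || d.writesRv y
  | loop _ c => c.writesRv y
  | _ => false

/-- The program writes to integer array `y`. -/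
def Cmd.writesNa (y : ℕ) : Cmd → Bool
  | putN x _ _ => x == y
  | seq c d => c.writesNa y || d.writesNa y
  | ite _ c d => c.writesNa y || d.writesNa y
  | loop _ c => c.writesNa y
  | _ => false

/-- The program writes to real array `y`. -/
def Cmd.writesRa (y : ℕ) : Cmd → Bool
  | putR x _ _ => x == y
  | seq c d => c.writesRa y || d.writesRa y
  | ite _ c d => c.writesRa y || d.writesRa y
  | loop _ c => c.writesRa y
  | _ => false

/-- The states agree on all registers and arrays that `c` does not write to. -/
structure Frame (c : Cmd) (s s' : State) : Prop where
  nv : ∀ y, c.writesNv y = false → s'.nv y = s.nv y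
  rv : ∀ y, c.writesRv y = false → s'.rv y = s.rv y
  na : ∀ y, c.writesNa y = false → s'.na y = s.na y
  ra : ∀ y, c.writesRa y = false → s'.ra y = s.ra y

theorem Frame.refl (c : Cmd) (s : State) : Frame c s s :=
  ⟨fun _ _ => rfl, fun _ _ => rfl, fun _ _ => rfl, fun _ _ => rfl⟩

theorem Frame.trans {c : Cmd} {s₁ s₂ s₃ : State} (h : Frame c s₁ s₂) (h' : Frame c s₂ s₃) :
    Frame c s₁ s₃ :=
  ⟨fun y hy => (h'.nv y hy).trans (h.nv y hy), fun y hy => (h'.rv y hy).trans (h.rv y hy),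
    fun y hy => (h'.na y hy).trans (h.na y hy), fun y hy => (h'.ra y hy).trans (h.ra y hy)⟩

theorem Frame.setN {c : Cmd} {s s' : State} (h : Frame c s s') {x v : ℕ}
    (hx : c.writesNv x = true) : Frame c s (s'.setN x v) := by
  refine ⟨fun y hy => ?_, h.rv, h.na, h.ra⟩
  rw [← h.nv y hy]
  refine Function.update_of_ne ?_ _ _
  rintro rfl
  simp [hx] at hy

/-- Allows specifications to mention only what changes: that a concrete program leaves a register or
an array alone is a computation on its syntax, discharged by `rfl` in the applications. -/
theorem Runs.frame {W : ℕ} {c : Cmd} {s s' : State} {t : ℕ} (h : Runs W c s s' t) :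
    Frame c s s' := by
  induction h with
  | nop s => exact Frame.refl _ _
  | setN h => exact (Frame.refl _ _).setN (by simp [Cmd.writesNv])
  | setR h =>
    refine ⟨fun _ _ => rfl, fun y hy => Function.update_of_ne ?_ _ _, fun _ _ => rfl,
      fun _ _ => rfl⟩
    rintro rfl; simp [Cmd.writesRv] at hy
  | putN hi h =>
    refine ⟨fun _ _ => rfl, fun _ _ => rfl, fun y hy => Function.update_of_ne ?_ _ _,
      fun _ _ => rfl⟩
    rintro rfl; simp [Cmd.writesNa] at hy
  | putR hi h =>
    refine ⟨fun _ _ => rfl, fun _ _ => rfl, fun _ _ => rfl,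
      fun y hy => Function.update_of_ne ?_ _ _⟩
    rintro rfl; simp [Cmd.writesRa] at hy
  | seq _ _ ih₁ ih₂ =>
    constructor <;> intro y hy <;>
      simp only [Cmd.writesNv, Cmd.writesRv, Cmd.writesNa, Cmd.writesRa, Bool.or_eq_false_iff] at hy
    · exact (ih₂.nv y hy.2).trans (ih₁.nv y hy.1)
    · exact (ih₂.rv y hy.2).trans (ih₁.rv y hy.1)
    · exact (ih₂.na y hy.2).trans (ih₁.na y hy.1)
    · exact (ih₂.ra y hy.2).trans (ih₁.ra y hy.1)
  | iteTrue _ _ ih =>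
    constructor <;> intro y hy <;>
      simp only [Cmd.writesNv, Cmd.writesRv, Cmd.writesNa, Cmd.writesRa, Bool.or_eq_false_iff] at hy
    · exact ih.nv y hy.1
    · exact ih.rv y hy.1
    · exact ih.na y hy.1
    · exact ih.ra y hy.1
  | iteFalse _ _ ih =>
    constructor <;> intro y hy <;>
      simp only [Cmd.writesNv, Cmd.writesRv, Cmd.writesNa, Cmd.writesRa, Bool.or_eq_false_iff] at hy
    · exact ih.nv y hy.2
    · exact ih.rv y hy.2
    · exact ih.na y hy.2
    · exact ih.ra y hy.2
  | loopTrue _ _ _ ih₁ ih₂ =>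
    exact ⟨fun y hy => (ih₂.nv y hy).trans (ih₁.nv y hy),
      fun y hy => (ih₂.rv y hy).trans (ih₁.rv y hy), fun y hy => (ih₂.na y hy).trans (ih₁.na y hy),
      fun y hy => (ih₂.ra y hy).trans (ih₁.ra y hy)⟩
  | loopFalse _ => exact Frame.refl _ _

theorem WP.frame {W : ℕ} {c : Cmd} {T : ℕ} {s : State} {Q : State → Prop} (h : WP W c T s Q) :
    WP W c T s fun s' => Q s' ∧ Frame c s s' := by
  obtain ⟨s', t, hr, ht, hq⟩ := h
  exact ⟨s', t, hr, ht, hq, hr.frame⟩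

/-- `for x = 0, …, n - 1 do c`, where `n` is the content of register `y`. -/
def Cmd.forUp (x y : ℕ) (c : Cmd) : Cmd :=
  .seq (.setN x (.lit 0)) (.loop (.neg (.nle (.var y) (.var x)))
    (.seq c (.setN x (.add (.var x) (.lit 1)))))

/-- `for x = n - 1, …, 0 do c`, where `n` is the content of register `y`. -/
def Cmd.forDown (x y : ℕ) (c : Cmd) : Cmd :=
  .seq (.setN x (.var y)) (.loop (.nle (.lit 1) (.var x))
    (.seq (.setN x (.sub (.var x) (.lit 1))) c))

theorem State.setN_nv (s : State) (x v y : ℕ) :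
    (s.setN x v).nv y = if y = x then v else s.nv y := by
  simp [State.setN, Function.update_apply]

theorem State.setR_rv (s : State) (x : ℕ) (v : ℝ) (y : ℕ) :
    (s.setR x v).rv y = if y = x then v else s.rv y := by
  simp [State.setR, Function.update_apply]

theorem State.putN_na (s : State) (a i v b j : ℕ) :
    (s.putN a i v).na b j = if b = a then (if j = i then v else s.na a j) else s.na b j := by
  by_cases h : b = a
  · subst h; simp [State.putN, Function.update_apply]
  · simp [State.putN, h]

theorem State.putR_ra (s : State) (a i : ℕ) (v : ℝ) (b j : ℕ) :
    (s.putR a i v).ra b j = if b = a then (if j = i then v else s.ra a j) else s.ra b j := by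
  by_cases h : b = a
  · subst h; simp [State.putR, Function.update_apply]
  · simp [State.putR, h]

theorem State.setN_rv (s : State) (x v : ℕ) : (s.setN x v).rv = s.rv := rfl
theorem State.setN_na (s : State) (x v : ℕ) : (s.setN x v).na = s.na := rfl
theorem State.setN_ra (s : State) (x v : ℕ) : (s.setN x v).ra = s.ra := rfl
theorem State.setR_nv (s : State) (x : ℕ) (v : ℝ) : (s.setR x v).nv = s.nv := rfl
theorem State.setR_na (s : State) (x : ℕ) (v : ℝ) : (s.setR x v).na = s.na := rfl
theorem State.setR_ra (s : State) (x : ℕ) (v : ℝ) : (s.setR x v).ra = s.ra := rfl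
theorem State.putN_nv (s : State) (a i v : ℕ) : (s.putN a i v).nv = s.nv := rfl
theorem State.putN_rv (s : State) (a i v : ℕ) : (s.putN a i v).rv = s.rv := rfl
theorem State.putN_ra (s : State) (a i v : ℕ) : (s.putN a i v).ra = s.ra := rfl
theorem State.putR_nv (s : State) (a i : ℕ) (v : ℝ) : (s.putR a i v).nv = s.nv := rfl
theorem State.putR_rv (s : State) (a i : ℕ) (v : ℝ) : (s.putR a i v).rv = s.rv := rfl
theorem State.putR_na (s : State) (a i : ℕ) (v : ℝ) : (s.putR a i v).na = s.na := rfl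

/-- In each round, 9 steps pay for the test and the increment; the final 8 cover the initialization
and the failing test. The loop writes the counter outside of `c`, hence `hInv`. The frame relative
to `s₀` gives each round access to everything that the whole loop leaves alone. -/
theorem WP.forUp {W x y n T : ℕ} {c : Cmd} {s₀ : State} (Inv : ℕ → State → Prop)
    (hx : c.writesNv x = false) (hy : c.writesNv y = false) (hxy : y ≠ x)
    (hn : s₀.nv y = n) (hW : n + 1 < W)
    (hInv : ∀ k s v, Inv k s → Inv k (s.setN x v)) (h0 : Inv 0 s₀)
    (hstep : ∀ k < n, ∀ s, Frame (Cmd.forUp x y c) s₀ s → s.nv x = k → s.nv y = n → Inv k s →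
      WP W c T s (Inv (k + 1))) :
    WP W (Cmd.forUp x y c) (n * (T + 9) + 8) s₀ fun s => Inv n s ∧ Frame (Cmd.forUp x y c) s₀ s := by
  refine WP.frame ?_
  have hwx : (Cmd.forUp x y c).writesNv x = true := by simp [Cmd.forUp, Cmd.writesNv]
  -- Here `k` counts the remaining rounds, so that the counter is `n - k`.
  have key := WP.loop (W := W) (b := .neg (.nle (.var y) (.var x)))
    (c := .seq c (.setN x (.add (.var x) (.lit 1)))) (T := T + 4) (Q := Inv n)
    (fun k s => k ≤ n ∧ Frame (Cmd.forUp x y c) s₀ s ∧ s.nv x = n - k ∧ s.nv y = n ∧ Inv (n - k) s)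
    (by
      rintro k s ⟨hk, hf, h1, h2, -⟩
      simp only [BExp.ok, NExp.ok, h1, h2]; omega)
    (by
      rintro k s ⟨hk, hf, h1, h2, h3⟩ hb
      simp only [BExp.val, NExp.val, h1, h2, not_not] at hb
      rwa [show n - k = n by omega] at h3)
    (by
      rintro k s ⟨hk, hf, h1, h2, h3⟩ hb
      simp only [BExp.val, NExp.val, h1, h2] at hb
      obtain ⟨k', rfl⟩ : ∃ k', k = k' + 1 := ⟨k - 1, by omega⟩
      refine ⟨k', rfl, WP.seq (T₁ := T) (T₂ := 4) ?_⟩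
      refine ((hstep _ (by omega) s hf h1 h2 h3).frame).mono le_rfl ?_
      rintro s' ⟨h4, hf'⟩
      have h5 : s'.nv x = n - (k' + 1) := by rw [hf'.nv x hx, h1]
      have h6 : s'.nv y = n := by rw [hf'.nv y hy, h2]
      refine WP.of_vc (c := .setN x (.add (.var x) (.lit 1))) ?_
      have e1 : n - (k' + 1) + 1 = n - k' := by omega
      refine ⟨?_, by omega, ?_, ?_, ?_, ?_⟩
      · simp only [NExp.ok, NExp.val, h5]; omega
      · refine (hf.trans ⟨fun z hz => hf'.nv z ?_, fun z hz => hf'.rv z ?_, fun z hz => hf'.na z ?_,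
          fun z hz => hf'.ra z ?_⟩).setN hwx <;>
          simp_all [Cmd.forUp, Cmd.writesNv, Cmd.writesRv, Cmd.writesNa, Cmd.writesRa]
      · simp [State.setN_nv, NExp.val, h5, e1]
      · simp [State.setN_nv, h6, hxy]
      · exact hInv _ _ _ (e1 ▸ h4))
    (k := n) (s := s₀.setN x 0)
    ⟨le_rfl, (Frame.refl _ _).setN hwx, by simp [State.setN_nv], by simp [State.setN_nv, hn, hxy],
      by simpa using hInv _ _ _ h0⟩
  refine (WP.seq (T₁ := 2) (WP.of_vc (c := .setN x (.lit 0)) ⟨?_, key⟩)).mono ?_ fun _ h => h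
  · simp only [NExp.ok]; omega
  · have e : (BExp.neg (.nle (.var y) (.var x))).cost + 1 + (T + 4) = T + 9 := by
      simp only [BExp.cost, NExp.cost]; ring
    rw [e]
    simp only [BExp.cost, NExp.cost]
    omega

theorem WP.forDown {W x y n T : ℕ} {c : Cmd} {s₀ : State} (Inv : ℕ → State → Prop)
    (hx : c.writesNv x = false) (hn : s₀.nv y = n) (hW : n + 1 < W)
    (hInv : ∀ k s v, Inv k s → Inv k (s.setN x v)) (h0 : Inv n s₀)
    (hstep : ∀ k < n, ∀ s, Frame (Cmd.forDown x y c) s₀ s → s.nv x = k → Inv (k + 1) s →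
      WP W c T s (Inv k)) :
    WP W (Cmd.forDown x y c) (n * (T + 9) + 8) s₀
      fun s => Inv 0 s ∧ Frame (Cmd.forDown x y c) s₀ s := by
  subst hn
  refine WP.frame ?_
  have hwx : (Cmd.forDown x y c).writesNv x = true := by simp [Cmd.forDown, Cmd.writesNv]
  have key := WP.loop (W := W) (b := .nle (.lit 1) (.var x))
    (c := .seq (.setN x (.sub (.var x) (.lit 1))) c) (T := 4 + T) (Q := Inv 0)
    (fun k s => k ≤ s₀.nv y ∧ Frame (Cmd.forDown x y c) s₀ s ∧ s.nv x = k ∧ Inv k s)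
    (by
      rintro k s ⟨hk, hf, h1, -⟩
      simp only [BExp.ok, NExp.ok, h1]; omega)
    (by
      rintro k s ⟨hk, hf, h1, h3⟩ hb
      simp only [BExp.val, NExp.val, h1] at hb
      rwa [show k = 0 by omega] at h3)
    (by
      rintro k s ⟨hk, hf, h1, h3⟩ hb
      simp only [BExp.val, NExp.val, h1] at hb
      obtain ⟨k', rfl⟩ : ∃ k', k = k' + 1 := ⟨k - 1, by omega⟩
      refine ⟨k', rfl, WP.seq (WP.of_vc (c := .setN x (.sub (.var x) (.lit 1))) ⟨?_, ?_⟩)⟩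
      · simp only [NExp.ok, h1]; omega
      have h5 : (s.setN x (NExp.val s (.sub (.var x) (.lit 1)))).nv x = k' := by
        simp [State.setN_nv, NExp.val, h1]
      refine ((hstep k' (by omega) _ (hf.setN hwx) h5 (hInv _ _ _ h3)).frame).mono le_rfl ?_
      rintro s' ⟨h4, hf'⟩
      refine ⟨by omega, ?_, by rw [hf'.nv x hx, h5], h4⟩
      refine (hf.setN hwx).trans ⟨fun z hz => hf'.nv z ?_, fun z hz => hf'.rv z ?_,
        fun z hz => hf'.na z ?_, fun z hz => hf'.ra z ?_⟩ <;>
        simp_all [Cmd.forDown, Cmd.writesNv, Cmd.writesRv, Cmd.writesNa, Cmd.writesRa])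
    (k := s₀.nv y) (s := s₀.setN x (s₀.nv y))
    ⟨le_rfl, (Frame.refl _ _).setN hwx, by simp [State.setN_nv], hInv _ _ _ h0⟩
  refine (WP.seq (T₁ := 2) (WP.of_vc (c := .setN x (.var y)) ⟨?_, key⟩)).mono ?_ fun _ h => h
  · simp only [NExp.ok]; omega
  · have e : (BExp.nle (.lit 1) (.var x)).cost + 1 + (4 + T) = T + 8 := by
      simp only [BExp.cost, NExp.cost]; ring
    rw [e]
    simp only [BExp.cost, NExp.cost]
    have : s₀.nv y * (T + 9) = s₀.nv y * (T + 8) + s₀.nv y := by ring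
    omega

theorem WP.of_vc_le {W : ℕ} {c : Cmd} {T : ℕ} {s : State} {Q : State → Prop} (hT : c.cost ≤ T)
    (h : c.vc W Q s) : WP W c T s Q :=
  (WP.of_vc h).mono hT fun _ h => h

attribute [simp] NExp.val NExp.ok RExp.val RExp.ok BExp.val BExp.ok Cmd.vc State.setN_nv
  State.setR_rv State.putN_na State.putR_ra State.setN_rv State.setN_na State.setN_ra State.setR_nv
  State.setR_na State.setR_ra State.putN_nv State.putN_rv State.putN_ra State.putR_nv State.putR_rv
  State.putR_na

end RealRAM

infixr:35 " ;; " => RealRAM.Cmd.seq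

/-! ## Preprocessing: rooting the tree -/

namespace UncertainTree

open RealRAM Finset

/-- Degrees, sums of the neighbours and sums of the incident edge lengths. -/
def degrees : Cmd :=
  .forUp 20 5 (
    .setN 21 (.get 0 (.var 20)) ;; .setN 22 (.get 1 (.var 20)) ;; .setR 1 (.get 0 (.var 20)) ;;
    .putN 5 (.var 21) (.add (.get 5 (.var 21)) (.lit 1)) ;;
    .putN 5 (.var 22) (.add (.get 5 (.var 22)) (.lit 1)) ;;
    .putN 6 (.var 21) (.add (.get 6 (.var 21)) (.var 22)) ;;
    .putN 6 (.var 22) (.add (.get 6 (.var 22)) (.var 21)) ;;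
    .putR 5 (.var 21) (.add (.get 5 (.var 21)) (.var 1)) ;;
    .putR 5 (.var 22) (.add (.get 5 (.var 22)) (.var 1)))

/-- The sum over the edge ends `(v, w)` with a given `v` of the values `f k w`, where `k` is the
number of the edge. -/
def incidentSum {α : Type} [AddCommMonoid α] (m : ℕ) (e₁ e₂ : ℕ → ℕ) (f : ℕ → ℕ → α) (v : ℕ) : α :=
  ∑ k ∈ range m, ((if v = e₁ k then f k (e₂ k) else 0) + (if v = e₂ k then f k (e₁ k) else 0))

theorem incidentSum_succ {α : Type} [AddCommMonoid α] (m : ℕ) (e₁ e₂ : ℕ → ℕ) (f : ℕ → ℕ → α)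
    (v : ℕ) : incidentSum (m + 1) e₁ e₂ f v = incidentSum m e₁ e₂ f v +
      ((if v = e₁ m then f m (e₂ m) else 0) + (if v = e₂ m then f m (e₁ m) else 0)) := by
  rw [incidentSum, sum_range_succ]; rfl

/-- Excludes overflow: with at most `N` edges and vertex numbers below `N`, the sums stay below `2 *
N * N`. This is one reason for the quadratic lower bound on `W`. -/
theorem incidentSum_le {m N : ℕ} {e₁ e₂ : ℕ → ℕ} {f : ℕ → ℕ → ℕ} (h₁ : ∀ k < m, f k (e₁ k) ≤ N)
    (h₂ : ∀ k < m, f k (e₂ k) ≤ N) (v : ℕ) : incidentSum m e₁ e₂ f v ≤ m * (2 * N) := by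
  refine (Finset.sum_le_card_nsmul _ _ (2 * N) fun k hk => ?_).trans (by simp)
  have := h₁ k (by simpa using hk)
  have := h₂ k (by simpa using hk)
  split_ifs <;> omega

/-- For a leaf, the sum of the neighbours is its only neighbour, and the sum of the incident lengths
is the length of its only edge. So these sums are all that leaf stripping has to know about the
adjacencies. -/
theorem degrees_spec {W m N : ℕ} {s₀ : State} (hm : s₀.nv 5 = m) (hmN : m ≤ N)
    (h₁ : ∀ k < m, s₀.na 0 k < N) (h₂ : ∀ k < m, s₀.na 1 k < N) (h5 : ∀ v, s₀.na 5 v = 0)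
    (h6 : ∀ v, s₀.na 6 v = 0) (hr : ∀ v, s₀.ra 5 v = 0) (hW : 4 * ((N + 1) * (N + 1)) < W) :
    WP W degrees (120 * (m + 1)) s₀ fun s =>
      (∀ v, s.na 5 v = incidentSum m (s₀.na 0) (s₀.na 1) (fun _ _ => 1) v) ∧
      (∀ v, s.na 6 v = incidentSum m (s₀.na 0) (s₀.na 1) (fun _ w => w) v) ∧
      (∀ v, s.ra 5 v = incidentSum m (s₀.na 0) (s₀.na 1) (fun k _ => s₀.ra 0 k) v) := by
  have hNN : N ≤ N * N := Nat.le_mul_self N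
  have hW' : 4 * (N * N) + 8 * N + 4 < W := by nlinarith
  refine (WP.forUp (n := m) (T := 100) (fun k s =>
      (∀ v, s.na 5 v = incidentSum k (s₀.na 0) (s₀.na 1) (fun _ _ => 1) v) ∧
      (∀ v, s.na 6 v = incidentSum k (s₀.na 0) (s₀.na 1) (fun _ w => w) v) ∧
      (∀ v, s.ra 5 v = incidentSum k (s₀.na 0) (s₀.na 1) (fun k _ => s₀.ra 0 k) v))
      rfl rfl (by decide) hm (by nlinarith) (fun _ _ _ h => h)
      (by simp [incidentSum, h5, h6, hr]) ?_).mono (by omega) fun s h => h.1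
  rintro k hk s hf hx hy ⟨i5, i6, i7⟩
  refine WP.of_vc_le (by decide) ?_
  have e0 : s.na 0 = s₀.na 0 := hf.na 0 rfl
  have e1 : s.na 1 = s₀.na 1 := hf.na 1 rfl
  have e2 : s.ra 0 = s₀.ra 0 := hf.ra 0 rfl
  have a1 := h₁ k hk
  have a2 := h₂ k hk
  have hkN : k * (2 * N) + 2 * N ≤ 2 * (N * N) := by nlinarith
  have b5 : ∀ v, incidentSum k (s₀.na 0) (s₀.na 1) (fun _ _ => 1) v ≤ k * (2 * N) := fun v =>
    incidentSum_le (by intros; omega) (by intros; omega) v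
  have b6 : ∀ v, incidentSum k (s₀.na 0) (s₀.na 1) (fun _ w => w) v ≤ k * (2 * N) := fun v =>
    incidentSum_le (f := fun _ w => w) (fun j hj => (h₁ j (by omega)).le) (fun j hj => (h₂ j (by omega)).le) v
  have b51 := b5 (s₀.na 0 k)
  have b52 := b5 (s₀.na 1 k)
  have b61 := b6 (s₀.na 0 k)
  have b62 := b6 (s₀.na 1 k)
  simp [hx, e0, e1, e2, i5, i6, i7, incidentSum_succ]
  split_ands <;> (try intro v) <;> grind

end UncertainTree

/-! ### Rooted trees and the combinatorics of leaf stripping -/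

namespace UncertainTree

open RealRAM Finset

/-- A rooted tree given by its parent function; `lev` witnesses well-foundedness. -/
structure Rooting (N : ℕ) where
  par : Fin N → Fin N
  root : Fin N
  lev : Fin N → ℕ
  par_root : par root = root
  lev_par : ∀ v, v ≠ root → lev (par v) < lev v
  lev_lt : ∀ v, lev v < N

namespace Rooting

variable {N : ℕ} (R : Rooting N)

/-- The sum of `f` over the children of `v` outside of `S`. -/
def childSum {α : Type} [AddCommMonoid α] (S : Finset (Fin N)) (f : Fin N → α) (v : Fin N) : α :=
  ∑ y with y ∉ S ∧ y ≠ R.root ∧ R.par y = v, f y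

theorem childSum_insert {α : Type} [AddCommMonoid α] {S : Finset (Fin N)} (f : Fin N → α)
    {x : Fin N} (hx : x ∉ S) (hr : x ≠ R.root) (v : Fin N) :
    R.childSum S f v = R.childSum (insert x S) f v + if v = R.par x then f x else 0 := by
  unfold childSum
  split_ifs with h
  · rw [add_comm, ← sum_insert (s := univ.filter _) (by simp)]
    congr 1
    ext y
    simp only [mem_filter, mem_univ, true_and, mem_insert]
    grind
  · rw [add_zero]
    congr 1
    ext y
    simp only [mem_filter, mem_univ, true_and, mem_insert]
    grind

theorem childSum_eq_zero {α : Type} [AddCommMonoid α] {S : Finset (Fin N)} (f : Fin N → α)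
    {v : Fin N} (h : ∀ y, y ≠ R.root → R.par y = v → y ∈ S) : R.childSum S f v = 0 := by
  unfold childSum
  rw [filter_false_of_mem, sum_empty]
  grind

theorem childSum_one_eq_zero {S : Finset (Fin N)} {v : Fin N} :
    R.childSum S (fun _ => 1) v = 0 ↔ ∀ y, y ≠ R.root → R.par y = v → y ∈ S := by
  refine ⟨fun h y hy hv => ?_, fun h => R.childSum_eq_zero _ h⟩
  by_contra hS
  have := (sum_eq_zero_iff.1 h) y (by simp [hS, hy, hv])
  omega

theorem childSum_le (S : Finset (Fin N)) (v : Fin N) :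
    R.childSum S (fun y => (y : ℕ)) v ≤ N * N := by
  unfold childSum
  refine (sum_le_card_nsmul _ _ N fun y _ => y.isLt.le).trans ?_
  rw [smul_eq_mul]
  exact Nat.mul_le_mul_right _ ((card_le_univ _).trans (by simp))

/-- The invariant of leaf stripping: the vertices `q 0, …, q (h - 1)` have been removed, and
`q h, …, q (t - 1)` are the present leaves. -/
structure StripInv (plen : Fin N → ℝ) (h t : ℕ) (q : ℕ → Fin N) (deg sx : Fin N → ℕ)
    (sl : Fin N → ℝ) : Prop where
  le : h ≤ t
  ne_root : ∀ k < t, q k ≠ R.root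
  inj : ∀ a < t, ∀ b < t, q a = q b → a = b
  child : ∀ b < t, ∀ y, y ≠ R.root → R.par y = q b → ∃ a < b, a < h ∧ q a = y
  leaf : ∀ v, v ≠ R.root → (∀ y, y ≠ R.root → R.par y = v → y ∈ (range h).image q) →
    ∃ k < t, q k = v
  deg : ∀ v, deg v = R.childSum ((range h).image q) (fun _ => 1) v + if v = R.root then 0 else 1
  sx : ∀ v, sx v = R.childSum ((range h).image q) (fun y => (y : ℕ)) v +
    if v = R.root then 0 else (R.par v : ℕ)
  sl : ∀ v, sl v = R.childSum ((range h).image q) plen v + if v = R.root then 0 else plen v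

variable {R} {plen : Fin N → ℝ} {h t : ℕ} {q : ℕ → Fin N} {deg sx : Fin N → ℕ} {sl : Fin N → ℝ}

theorem card_nonroot (R : Rooting N) : (univ.filter fun v => v ≠ R.root).card = N - 1 := by
  rw [filter_ne' univ R.root, card_erase_of_mem (mem_univ _)]
  simp

theorem StripInv.t_le (H : R.StripInv plen h t q deg sx sl) : t ≤ N - 1 := by
  rw [← R.card_nonroot, ← card_range t]
  refine card_le_card_of_injOn q (fun k hk => ?_) fun a ha b hb => ?_
  · simpa using H.ne_root k (by simpa using hk)
  · exact H.inj a (by simpa using ha) b (by simpa using hb)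

/-- The queue does not run empty too early: a remaining non-root vertex of maximal level has no
remaining child, so by `leaf` it has been put into the queue. -/
theorem StripInv.lt (H : R.StripInv plen h t q deg sx sl) (hh : h < N - 1) : h < t := by
  by_contra hlt
  obtain rfl : h = t := le_antisymm H.le (not_lt.1 hlt)
  have hne : (univ.filter fun v => v ≠ R.root ∧ v ∉ (range h).image q).Nonempty := by
    by_contra hemp
    rw [not_nonempty_iff_eq_empty, filter_eq_empty_iff] at hemp
    have hsub : (univ.filter fun v => v ≠ R.root) ⊆ (range h).image q := by
      intro v hv
      have := hemp (mem_univ v)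
      have hv' : v ≠ R.root := by simpa using hv
      tauto
    have := (card_le_card hsub).trans card_image_le
    rw [R.card_nonroot, card_range] at this
    omega
  obtain ⟨v, hv, hmax⟩ := exists_max_image _ R.lev hne
  simp only [mem_filter, mem_univ, true_and] at hv hmax
  obtain ⟨k, hk, rfl⟩ := H.leaf v hv.1 fun y hy hyv => by
    by_contra hS
    have h1 := hmax y ⟨hy, hS⟩
    have h2 := R.lev_par y hy
    rw [hyv] at h2
    omega
  exact hv.2 (mem_image_of_mem _ (by simpa using hk))

theorem StripInv.notMem (H : R.StripInv plen h t q deg sx sl) {k : ℕ} (hk : h ≤ k) (hkt : k < t) :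
    q k ∉ (range h).image q := by
  simp only [mem_image, mem_range, not_exists, not_and]
  intro a ha hqa
  have := H.inj a (by omega) k hkt hqa
  omega

theorem StripInv.children (H : R.StripInv plen h t q deg sx sl) (hh : h < t) :
    ∀ y, y ≠ R.root → R.par y = q h → y ∈ (range h).image q := fun y hy hyq => by
  obtain ⟨a, ha, -, rfl⟩ := H.child h hh y hy hyq
  exact mem_image_of_mem _ (by simpa using ha)

/-- All children of the head of the queue are gone, so its neighbour sum has shrunk to the parent;
`sl_head` is the same for the lengths. -/
theorem StripInv.sx_head (H : R.StripInv plen h t q deg sx sl) (hh : h < t) :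
    sx (q h) = R.par (q h) := by
  rw [H.sx, R.childSum_eq_zero _ (H.children hh), if_neg (H.ne_root h hh), zero_add]

theorem StripInv.sl_head (H : R.StripInv plen h t q deg sx sl) (hh : h < t) :
    sl (q h) = plen (q h) := by
  rw [H.sl, R.childSum_eq_zero _ (H.children hh), if_neg (H.ne_root h hh), zero_add]

theorem StripInv.sx_le (H : R.StripInv plen h t q deg sx sl) (v : Fin N) : sx v ≤ N * N + N := by
  rw [H.sx]
  have := R.childSum_le ((range h).image q) v
  have := (R.par v).isLt
  split_ifs <;> omega

/-- Removing `q h` changes the sums at its parent `p` only, so `p` is the only vertex that may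
become a leaf. The root is never queued, and the degree of any other vertex counts the edge to its
own parent, whence the test `deg' p ≤ 1`. -/
theorem StripInv.step (H : R.StripInv plen h t q deg sx sl) (hh : h < t) {p : Fin N}
    (hp : p = R.par (q h)) {t' : ℕ} {q' : ℕ → Fin N} {deg' sx' : Fin N → ℕ} {sl' : Fin N → ℝ}
    (hdeg : ∀ v, deg' v = if v = p then deg p - 1 else deg v)
    (hsx : ∀ v, sx' v = if v = p then sx p - q h else sx v)
    (hsl : ∀ v, sl' v = if v = p then sl p - sl (q h) else sl v)
    (hpush : (deg' p ≤ 1 ∧ p ≠ R.root) → t' = t + 1 ∧ q' = Function.update q t p)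
    (hkeep : ¬ (deg' p ≤ 1 ∧ p ≠ R.root) → t' = t ∧ q' = q) :
    R.StripInv plen (h + 1) t' q' deg' sx' sl' := by
  have hroot := H.ne_root h hh
  have hnot := H.notMem le_rfl hh
  have hS : (range (h + 1)).image q = insert (q h) ((range h).image q) := by
    rw [range_add_one, image_insert]
  have himg : (range (h + 1)).image q' = (range (h + 1)).image q := by
    refine image_congr fun k hk => ?_
    have hk' : k < h + 1 := by simpa using hk
    by_cases hc : deg' p ≤ 1 ∧ p ≠ R.root
    · rw [(hpush hc).2, Function.update_of_ne (by omega)]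
    · rw [(hkeep hc).2]
  have hdeg2 : ∀ v, deg' v = R.childSum ((range (h + 1)).image q) (fun _ => 1) v +
      if v = R.root then 0 else 1 := by
    intro v
    rw [hdeg]
    have e1 := H.deg v
    have e2 := H.deg p
    rw [R.childSum_insert _ hnot hroot, ← hS] at e1 e2
    rw [← hp] at e1 e2
    by_cases hv : v = p
    · subst hv; simp only [if_true] at e1 ⊢; omega
    · simp only [if_neg hv] at e1 ⊢; omega
  have hleaf : (deg' p ≤ 1 ∧ p ≠ R.root) ↔ p ≠ R.root ∧
      ∀ y, y ≠ R.root → R.par y = p → y ∈ (range (h + 1)).image q := by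
    rw [← R.childSum_one_eq_zero, hdeg2]
    constructor
    · rintro ⟨h1, h2⟩; rw [if_neg h2] at h1; exact ⟨h2, by omega⟩
    · rintro ⟨h1, h2⟩; rw [if_neg h1]; exact ⟨by omega, h1⟩
  -- If `p` were in the queue already, its child `q h` would have been removed before, against
  -- injectivity.
  have hpq : ∀ k < t, q k ≠ p := by
    intro k hk hkp
    obtain ⟨a, ha, hah, hqa⟩ := H.child k hk (q h) hroot (hkp ▸ hp.symm)
    have ha' := H.inj a (by omega) h hh hqa
    omega
  have hkids : ∀ v, v ≠ p → (∀ y, y ≠ R.root → R.par y = v → y ∈ (range (h + 1)).image q) →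
      ∀ y, y ≠ R.root → R.par y = v → y ∈ (range h).image q := by
    intro v hv hall y hy hyv
    have := hall y hy hyv
    rw [hS, mem_insert] at this
    rcases this with rfl | h'
    · exact absurd (hyv.symm.trans hp.symm) hv
    · exact h'
  have hsx2 : ∀ v, sx' v = R.childSum ((range (h + 1)).image q) (fun y => (y : ℕ)) v +
      if v = R.root then 0 else (R.par v : ℕ) := by
    intro v
    rw [hsx]
    have e1 := H.sx v
    have e2 := H.sx p
    rw [R.childSum_insert _ hnot hroot, ← hS] at e1 e2
    rw [← hp] at e1 e2
    by_cases hv : v = p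
    · subst hv; simp only [if_true] at e1 ⊢; omega
    · simp only [if_neg hv] at e1 ⊢; omega
  have hsl2 : ∀ v, sl' v = R.childSum ((range (h + 1)).image q) plen v +
      if v = R.root then 0 else plen v := by
    intro v
    rw [hsl, H.sl_head hh]
    have e1 := H.sl v
    have e2 := H.sl p
    rw [R.childSum_insert _ hnot hroot, ← hS] at e1 e2
    rw [← hp] at e1 e2
    by_cases hv : v = p
    · subst hv; simp only [if_true] at e1 ⊢; linarith
    · simp only [if_neg hv] at e1 ⊢; linarith
  by_cases hc : deg' p ≤ 1 ∧ p ≠ R.root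
  · obtain ⟨rfl, rfl⟩ := hpush hc
    have hold : ∀ k < t, Function.update q t p k = q k := fun k hk =>
      Function.update_of_ne (by omega) _ _
    have hnew : Function.update q t p t = p := Function.update_self _ _ _
    refine ⟨by omega, ?_, ?_, ?_, ?_, by rwa [himg], by rwa [himg], by rwa [himg]⟩
    · intro k hk
      rcases Nat.lt_succ_iff_lt_or_eq.1 hk with hk | rfl
      · rw [hold k hk]; exact H.ne_root k hk
      · rw [hnew]; exact hc.2
    · intro a ha b hb hab
      rcases Nat.lt_succ_iff_lt_or_eq.1 ha with ha | rfl <;>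
        rcases Nat.lt_succ_iff_lt_or_eq.1 hb with hb | rfl
      · rw [hold a ha, hold b hb] at hab; exact H.inj a ha b hb hab
      · rw [hold a ha, hnew] at hab; exact absurd hab (hpq a ha)
      · rw [hold b hb, hnew] at hab; exact absurd hab.symm (hpq b hb)
      · rfl
    · intro b hb y hy hyb
      rcases Nat.lt_succ_iff_lt_or_eq.1 hb with hb | rfl
      · rw [hold b hb] at hyb
        obtain ⟨a, ha, hah, rfl⟩ := H.child b hb y hy hyb
        exact ⟨a, ha, by omega, hold a (by omega)⟩
      · rw [hnew] at hyb
        have := (hleaf.1 hc).2 y hy hyb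
        simp only [mem_image, mem_range] at this
        obtain ⟨a, ha, rfl⟩ := this
        exact ⟨a, by omega, ha, hold a (by omega)⟩
    · intro v hv hall
      rw [himg] at hall
      by_cases hvp : v = p
      · exact ⟨t, by omega, by rw [hnew, hvp]⟩
      · obtain ⟨k, hk, rfl⟩ := H.leaf v hv (hkids v hvp hall)
        exact ⟨k, by omega, hold k hk⟩
  · obtain ⟨rfl, rfl⟩ := hkeep hc
    refine ⟨by omega, H.ne_root, H.inj, ?_, ?_, hdeg2, hsx2, hsl2⟩
    · intro b hb y hy hyb
      obtain ⟨a, ha, hah, e⟩ := H.child b hb y hy hyb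
      exact ⟨a, ha, by omega, e⟩
    · intro v hv hall
      by_cases hvp : v = p
      · subst hvp
        exact absurd (hleaf.2 ⟨hv, hall⟩) hc
      · exact H.leaf v hv (hkids v hvp hall)

/-- `q` lists the vertices other than the root, children before parents. -/
structure IsOrder (R : Rooting N) (q : ℕ → Fin N) : Prop where
  ne_root : ∀ k < N - 1, q k ≠ R.root
  inj : ∀ a < N - 1, ∀ b < N - 1, q a = q b → a = b
  surj : ∀ v, v ≠ R.root → ∃ k < N - 1, q k = v
  child : ∀ a < N - 1, ∀ b < N - 1, R.par (q a) = q b → a < b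

/-- After `N - 1` removals every vertex other than the root is gone, by counting. No remaining
children contribute to the sums, so only the terms of the parents are left. -/
theorem StripInv.final (H : R.StripInv plen (N - 1) t q deg sx sl) :
    R.IsOrder q ∧ (∀ v, v ≠ R.root → sx v = R.par v) ∧
      (∀ v, sl v = if v = R.root then 0 else plen v) := by
  obtain rfl : t = N - 1 := le_antisymm H.t_le H.le
  have himg : (range (N - 1)).image q = univ.filter fun v => v ≠ R.root := by
    refine eq_of_subset_of_card_le ?_ ?_
    · intro v hv
      simp only [mem_image, mem_range] at hv
      obtain ⟨k, hk, rfl⟩ := hv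
      simpa using H.ne_root k hk
    · rw [R.card_nonroot, card_image_of_injOn, card_range]
      intro a ha b hb
      exact H.inj a (by simpa using ha) b (by simpa using hb)
  have hall : ∀ v, v ≠ R.root → v ∈ (range (N - 1)).image q := fun v hv => by
    rw [himg]; simpa using hv
  refine ⟨⟨H.ne_root, H.inj, fun v hv => by simpa using hall v hv, ?_⟩, ?_, ?_⟩
  · intro a ha b hb hab
    obtain ⟨a', ha', -, e⟩ := H.child b hb (q a) (H.ne_root a ha) hab
    have := H.inj a' (by omega) a ha e
    omega
  · intro v hv
    rw [H.sx, R.childSum_eq_zero _ fun y hy _ => hall y hy, if_neg hv, zero_add]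
  · intro v
    rw [H.sl, R.childSum_eq_zero _ fun y hy _ => hall y hy, zero_add]

end Rooting

end UncertainTree

/-! ### The leaf-stripping program -/

namespace UncertainTree

open RealRAM Finset

/-- Append the content of register `x` to the queue. -/
def push (x : ℕ) : Cmd :=
  .putN 7 (.var 23) (.var x) ;; .setN 23 (.add (.var 23) (.lit 1))

/-- Append the vertex in register `x` to the queue if it is a leaf other than the root. -/
def pushLeaf (x : ℕ) : Cmd :=
  .ite (.conj (.nle (.get 5 (.var x)) (.lit 1))
    (.neg (.conj (.nle (.var x) (.var 3)) (.nle (.var 3) (.var x))))) (push x) .nop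

/-- Put all leaves into the queue. -/
def initQueue : Cmd := .setN 23 (.lit 0) ;; .forUp 20 0 (pushLeaf 20)

/-- Remove the leaves one by one. -/
def stripLoop : Cmd :=
  .forUp 20 5 (
    .setN 21 (.get 7 (.var 20)) ;; .setN 22 (.get 6 (.var 21)) ;;
    .putN 5 (.var 22) (.sub (.get 5 (.var 22)) (.lit 1)) ;;
    .putN 6 (.var 22) (.sub (.get 6 (.var 22)) (.var 21)) ;;
    .putR 5 (.var 22) (.sub (.get 5 (.var 22)) (.get 5 (.var 21))) ;;
    pushLeaf 22)

/-- Compute parents, lengths of the edges to the parents, and an order with children before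
parents. -/
def strip : Cmd := initQueue ;; stripLoop ;; .putN 6 (.var 3) (.var 3)

namespace Rooting

variable {N : ℕ} (R : Rooting N)

/-- The invariant of leaf stripping for a machine state. -/
def StripState (plen : Fin N → ℝ) (h : ℕ) (q : ℕ → Fin N) (s : State) : Prop :=
  R.StripInv plen h (s.nv 23) q (fun v => s.na 5 v) (fun v => s.na 6 v) (fun v => s.ra 5 v) ∧
    ∀ k < s.nv 23, s.na 7 k = q k

theorem initQueue_spec {W : ℕ} {plen : Fin N → ℝ} {s₀ : State} (hN : s₀.nv 0 = N)
    (hr : s₀.nv 3 = R.root) (hW : 4 * ((N + 1) * (N + 1)) < W)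
    (hdeg : ∀ v : Fin N, s₀.na 5 v = R.childSum ∅ (fun _ => 1) v + if v = R.root then 0 else 1)
    (hsx : ∀ v : Fin N, s₀.na 6 v = R.childSum ∅ (fun y => (y : ℕ)) v +
      if v = R.root then 0 else (R.par v : ℕ))
    (hsl : ∀ v : Fin N, s₀.ra 5 v = R.childSum ∅ plen v + if v = R.root then 0 else plen v) :
    WP W initQueue (120 * (N + 1)) s₀ fun s => ∃ q, R.StripState plen 0 q s := by
  have hNN : N ≤ N * N := Nat.le_mul_self N
  have hW' : 4 * (N * N) + 8 * N + 4 < W := by nlinarith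
  have hdegW : ∀ v : Fin N, s₀.na 5 v < W := by
    intro v
    have : R.childSum ∅ (fun _ => 1) v ≤ N := by
      simpa [childSum] using (card_le_univ (univ.filter fun y => y ≠ R.root ∧ R.par y = v))
    rw [hdeg]; split_ifs <;> omega
  have hs : (Cmd.setN 23 (.lit 0)).vc W (fun s => s = s₀.setN 23 0) s₀ := by simp; omega
  refine (WP.seq (T₁ := 2) ((WP.of_vc_le (by decide) hs).mono le_rfl ?_)).mono
    (T := 2 + (N * (100 + 9) + 8)) (by omega) fun _ h => h
  rintro _ rfl
  refine (WP.forUp (x := 20) (y := 0) (n := N) (T := 100)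
    (fun k s => s.nv 23 ≤ k ∧ ∃ q : ℕ → Fin N, (∀ j < s.nv 23, s.na 7 j = q j) ∧
      (∀ a < s.nv 23, ∀ b < s.nv 23, q a = q b → a = b) ∧
      ∀ v, (∃ j < s.nv 23, q j = v) ↔ (v : ℕ) < k ∧ s₀.na 5 v ≤ 1 ∧ v ≠ R.root)
      rfl rfl (by decide) (by simpa using hN) (by omega) (fun _ _ _ h => h)
      ⟨by simp, fun _ => R.root, by simp, by simp, by simp⟩ ?_).mono le_rfl ?_
  · rintro k hk s hf hx hy ⟨htk, q, hq, hinj, hmem⟩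
    refine WP.of_vc_le (by decide) ?_
    have e5 : s.na 5 = s₀.na 5 := hf.na 5 rfl
    have e3 : s.nv 3 = R.root := (hf.nv 3 rfl).trans hr
    obtain ⟨v, rfl⟩ : ∃ v : Fin N, (v : ℕ) = k := ⟨⟨k, hk⟩, rfl⟩
    have hroot := R.root.isLt
    have hdv := hdegW v
    have hvr : v = R.root ↔ (v : ℕ) = R.root := Fin.ext_iff
    simp only [pushLeaf, push, Cmd.vc, BExp.ok, BExp.val, NExp.ok, NExp.val, hx, e3, e5]
    refine ⟨⟨⟨⟨by omega, hdv⟩, by omega⟩, ⟨by omega, by omega⟩, by omega, by omega⟩, ?_, ?_⟩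
    · rintro ⟨hd, hne⟩
      have hne' : v ≠ R.root := fun h => hne ⟨by rw [h], by rw [h]⟩
      refine ⟨by omega, by omega, ⟨by simp; omega, by omega, by simp; omega⟩, by simp; omega,
        Function.update q (s.nv 23) v, ?_, ?_, ?_⟩
      · intro j hj
        simp [Function.update_apply] at hj ⊢
        split_ifs with h1
        · rfl
        · exact hq j (by omega)
      · intro a ha b hb hab
        have hnew : ∀ a < s.nv 23, q a ≠ v := fun a ha h => by
          have := (hmem v).1 ⟨a, ha, h⟩
          omega
        simp [Function.update_apply] at ha hb hab
        split_ifs at hab with h1 h2 h2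
        · omega
        · exact absurd hab.symm (hnew b (by omega))
        · exact absurd hab (hnew a (by omega))
        · exact hinj a (by omega) b (by omega) hab
      · intro u
        simp only [State.setN_nv, State.putN_nv, if_true]
        constructor
        · rintro ⟨j, hj, rfl⟩
          by_cases h1 : j = s.nv 23
          · subst h1; simp [hd, hne']
          · rw [Function.update_of_ne h1]
            have := (hmem (q j)).1 ⟨j, by omega, rfl⟩
            exact ⟨by omega, this.2⟩
        · rintro ⟨h1, h2⟩
          by_cases h3 : u = v
          · exact ⟨s.nv 23, by omega, by rw [h3, Function.update_self]⟩
          · have h4 : (u : ℕ) ≠ v := fun h => h3 (Fin.ext h)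
            obtain ⟨j, hj, rfl⟩ := (hmem u).2 ⟨by omega, h2⟩
            exact ⟨j, by omega, Function.update_of_ne (by omega) _ _⟩
    · intro hne
      refine ⟨by omega, q, hq, hinj, fun u => (hmem u).trans ?_⟩
      refine ⟨fun h => ⟨by omega, h.2⟩, fun h => ⟨?_, h.2⟩⟩
      have : (u : ℕ) ≠ v := fun h3 => by
        obtain rfl := Fin.ext h3
        refine hne ⟨h.2.1, fun h4 => h.2.2 (hvr.2 (by omega))⟩
      omega
  · rintro s ⟨⟨-, q, hq, hinj, hmem⟩, hf⟩
    have e5 : s.na 5 = s₀.na 5 := hf.na 5 rfl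
    have e6 : s.na 6 = s₀.na 6 := hf.na 6 rfl
    have e7 : s.ra 5 = s₀.ra 5 := hf.ra 5 rfl
    have hleaf : ∀ v : Fin N, s₀.na 5 v ≤ 1 ∧ v ≠ R.root ↔
        v ≠ R.root ∧ ∀ y, y ≠ R.root → R.par y ≠ v := by
      intro v
      have := R.childSum_one_eq_zero (S := ∅) (v := v)
      simp only [notMem_empty] at this
      rw [show (∀ y, y ≠ R.root → R.par y ≠ v) ↔ _ from this.symm, hdeg]
      constructor
      · rintro ⟨h1, h2⟩; rw [if_neg h2] at h1; exact ⟨h2, by omega⟩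
      · rintro ⟨h1, h2⟩; rw [if_neg h1]; exact ⟨by omega, h1⟩
    refine ⟨q, ⟨Nat.zero_le _, ?_, hinj, ?_, ?_, by simpa [e5] using hdeg, by simpa [e6] using hsx,
      by simpa [e7] using hsl⟩, hq⟩
    · intro k hk
      exact ((hmem (q k)).1 ⟨k, hk, rfl⟩).2.2
    · intro b hb y hy hyb
      exact absurd hyb (((hleaf (q b)).1 ((hmem (q b)).1 ⟨b, hb, rfl⟩).2).2 y hy)
    · intro v hv hall
      exact (hmem v).2 ⟨v.isLt, (hleaf v).2 ⟨hv, fun y hy hyv => by simpa using hall y hy hyv⟩⟩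

/-- The loop counter is the head of the queue; by `StripInv.lt` it points to a filled cell in each
of the `N - 1` rounds. -/
theorem stripLoop_spec {W : ℕ} {plen : Fin N → ℝ} {s₀ : State} (hN : s₀.nv 5 = N - 1)
    (hr : s₀.nv 3 = R.root) (hW : 4 * ((N + 1) * (N + 1)) < W)
    (h0 : ∃ q, R.StripState plen 0 q s₀) :
    WP W stripLoop (120 * (N + 1)) s₀ fun s => ∃ q, R.StripState plen (N - 1) q s := by
  have hNN : N ≤ N * N := Nat.le_mul_self N
  have hW' : 4 * (N * N) + 8 * N + 4 < W := by nlinarith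
  refine (WP.forUp (x := 20) (y := 5) (n := N - 1) (T := 100) (fun k s => ∃ q, R.StripState plen k q s)
    rfl rfl (by decide) hN (by omega) (fun _ _ _ ⟨q, H, hq⟩ => ⟨q, H, hq⟩) h0 ?_).mono (by omega) fun s h => h.1
  rintro k hk s hf hx hy ⟨q, H, hq⟩
  refine WP.of_vc_le (by decide) ?_
  have e3 : s.nv 3 = R.root := (hf.nv 3 rfl).trans hr
  have hkt := H.lt hk
  have htl := H.t_le
  have hp : s.na 6 (q k) = R.par (q k) := H.sx_head hkt
  have hFin : ∀ v : Fin N, (v : ℕ) < W := fun v => by omega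
  have hsx : ∀ v : Fin N, s.na 6 v < W := fun v => by
    have : s.na 6 v ≤ _ := H.sx_le v
    omega
  have hdeg : ∀ v : Fin N, s.na 5 v < W := by
    intro v
    have : s.na 5 v = _ := H.deg v
    have h2 : R.childSum ((range k).image q) (fun _ => 1) v ≤ N := by
      rw [childSum, sum_const, smul_eq_mul, mul_one]
      exact (card_le_univ _).trans (by simp)
    split_ifs at this <;> omega
  have hroot := R.root.isLt
  have h1W : 1 < W := by omega
  have hkW : k < W := by omega
  have htW : s.nv 23 < W := by omega
  have htW' : s.nv 23 + 1 < W := by omega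
  simp [pushLeaf, push, hx, hq k hkt, hp, e3, hFin, hsx, hdeg, h1W, hkW, htW, htW']
  set p := R.par (q k) with hpdef
  have hdp : (s.na 5 p - 1 ≤ 1) ↔ s.na 5 p ≤ 2 := by omega
  refine ⟨(Nat.sub_le _ _).trans_lt (hdeg _), fun h1 h2 => ?_, fun h1 => ?_⟩
  · have hne : p ≠ R.root := fun h => (h2 h.le).ne h
    refine ⟨Function.update q (s.nv 23) p, H.step hkt hpdef ?_ ?_ ?_ (fun _ => ⟨?_, rfl⟩)
      fun hc => ?_, ?_⟩
    · intro v; simp [Fin.ext_iff]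
    · intro v; simp [Fin.ext_iff]
    · intro v; simp [Fin.ext_iff]
    · simp
    · refine absurd ⟨?_, hne⟩ hc
      simpa using h1
    · intro j hj
      simp [Function.update_apply] at hj ⊢
      split_ifs with h3
      · rfl
      · exact hq j (by omega)
  · refine ⟨q, H.step hkt hpdef ?_ ?_ ?_ (fun hc => ?_) fun _ => ⟨?_, rfl⟩, ?_⟩
    · intro v; simp [Fin.ext_iff]
    · intro v; simp [Fin.ext_iff]
    · intro v; simp [Fin.ext_iff]
    · have h3 := h1 (by simpa using hc.1)
      exact absurd (le_antisymm h3.1 h3.2) hc.2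
    · simp
    · simpa using hq

theorem strip_spec {W : ℕ} {plen : Fin N → ℝ} {s₀ : State} (hN : s₀.nv 0 = N)
    (hN' : s₀.nv 5 = N - 1) (hr : s₀.nv 3 = R.root) (hW : 4 * ((N + 1) * (N + 1)) < W)
    (hdeg : ∀ v : Fin N, s₀.na 5 v = R.childSum ∅ (fun _ => 1) v + if v = R.root then 0 else 1)
    (hsx : ∀ v : Fin N, s₀.na 6 v = R.childSum ∅ (fun y => (y : ℕ)) v +
      if v = R.root then 0 else (R.par v : ℕ))
    (hsl : ∀ v : Fin N, s₀.ra 5 v = R.childSum ∅ plen v + if v = R.root then 0 else plen v)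
    (hplen : plen R.root = 0) :
    WP W strip (400 * (N + 1)) s₀ fun s => ∃ q, R.IsOrder q ∧ (∀ k < N - 1, s.na 7 k = q k) ∧
      (∀ v : Fin N, s.na 6 v = R.par v) ∧ (∀ v : Fin N, s.ra 5 v = plen v) := by
  have hNN : N ≤ N * N := Nat.le_mul_self N
  have hW' : 4 * (N * N) + 8 * N + 4 < W := by nlinarith
  have hroot := R.root.isLt
  refine (WP.seq ((R.initQueue_spec hN hr hW hdeg hsx hsl).frame.mono le_rfl ?_)).mono
    (T := 120 * (N + 1) + (120 * (N + 1) + 10)) (by omega) fun _ h => h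
  rintro s₁ ⟨h₁, hf₁⟩
  have e5 : s₁.nv 5 = N - 1 := (hf₁.nv 5 rfl).trans hN'
  have e3 : s₁.nv 3 = R.root := (hf₁.nv 3 rfl).trans hr
  refine WP.seq ((R.stripLoop_spec e5 e3 hW h₁).frame.mono le_rfl ?_)
  rintro s₂ ⟨⟨q, H, hq⟩, hf₂⟩
  have e3' : s₂.nv 3 = R.root := (hf₂.nv 3 rfl).trans e3
  refine WP.of_vc_le (by decide) ?_
  obtain ⟨h1, h2, h3⟩ := H.final
  have ht : s₂.nv 23 = N - 1 := le_antisymm H.t_le H.le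
  simp only [Cmd.vc, NExp.ok, NExp.val, e3']
  refine ⟨by omega, by omega, q, h1, fun k hk => ?_, fun v => ?_, fun v => ?_⟩
  · simpa using hq k (by omega)
  -- Stripping leaves `0` as the neighbour sum of the root. The last assignment of `strip` replaces
  -- it by the root itself, in accordance with `par_root`.
  · by_cases hv : v = R.root
    · simp [hv, R.par_root]
    · simpa [hv, Fin.val_inj] using h2 v hv
  · refine (h3 v).trans ?_
    split_ifs with hv
    · rw [hv, hplen]
    · rfl

end Rooting

end UncertainTree

/-! ### Depths, subtree sizes and nested intervals -/

namespace UncertainTree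

open RealRAM Finset

/-- Compute the depths, parents before children. -/
def depths : Cmd :=
  .forDown 20 5 (.setN 21 (.get 7 (.var 20)) ;;
    .putR 6 (.var 21) (.add (.get 6 (.get 6 (.var 21))) (.get 5 (.var 21))))

/-- Compute the sizes of the subtrees, where vertex `v` counts with multiplicity `c v` (array 8). -/
def sizes : Cmd :=
  .forUp 20 0 (.putN 9 (.var 20) (.get 8 (.var 20))) ;;
  .forUp 20 5 (.setN 21 (.get 7 (.var 20)) ;; .setN 22 (.get 6 (.var 21)) ;;
    .putN 9 (.var 22) (.add (.get 9 (.var 22)) (.get 9 (.var 21))))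

/-- Assign nested intervals to the vertices. -/
def starts : Cmd :=
  (.putN 10 (.var 3) (.lit 0) ;; .putN 11 (.var 3) (.get 8 (.var 3))) ;;
  .forDown 20 5 (.setN 21 (.get 7 (.var 20)) ;; .setN 22 (.get 6 (.var 21)) ;;
    .putN 10 (.var 21) (.get 11 (.var 22)) ;;
    .putN 11 (.var 21) (.add (.get 11 (.var 22)) (.get 8 (.var 21))) ;;
    .putN 11 (.var 22) (.add (.get 11 (.var 22)) (.get 9 (.var 21))))

namespace Rooting

variable {N : ℕ} (R : Rooting N)

/-- The state holds the rooted tree, with the order `q` of its vertices. -/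
structure Stored (q : ℕ → Fin N) (s : State) : Prop where
  nv0 : s.nv 0 = N
  nv3 : s.nv 3 = R.root
  nv5 : s.nv 5 = N - 1
  na6 : ∀ v : Fin N, s.na 6 v = R.par v
  na7 : ∀ k < N - 1, s.na 7 k = q k

variable {R} {q : ℕ → Fin N}

theorem Stored.of_frame {c : Cmd} {s s' : State} (h : R.Stored q s) (hf : Frame c s s')
    (hc : (c.writesNv 0 || c.writesNv 3 || c.writesNv 5 || c.writesNa 6 || c.writesNa 7) = false) :
    R.Stored q s' := by
  simp only [Bool.or_eq_false_iff] at hc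
  refine ⟨by rw [hf.nv 0 (by tauto), h.nv0], by rw [hf.nv 3 (by tauto), h.nv3],
    by rw [hf.nv 5 (by tauto), h.nv5], by rw [hf.na 6 (by tauto)]; exact h.na6,
    by rw [hf.na 7 (by tauto)]; exact h.na7⟩

theorem IsOrder.par_mem (hq : R.IsOrder q) {k : ℕ} (hk : k < N - 1) :
    R.par (q k) = R.root ∨ ∃ j, k < j ∧ j < N - 1 ∧ R.par (q k) = q j := by
  by_cases h : R.par (q k) = R.root
  · exact .inl h
  · obtain ⟨j, hj, e⟩ := hq.surj _ h
    exact .inr ⟨j, hq.child k hk j hj e.symm, hj, e.symm⟩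

theorem IsOrder.notMem (hq : R.IsOrder q) {k j : ℕ} (hj : j < N - 1) (hkj : k ≤ j) :
    q j ∉ (range k).image q := by
  simp only [mem_image, mem_range, not_exists, not_and]
  intro a ha e
  have := hq.inj a (by omega) j hj e
  omega

theorem IsOrder.root_notMem (hq : R.IsOrder q) {k : ℕ} (hk : k ≤ N - 1) :
    R.root ∉ (range k).image q := by
  simp only [mem_image, mem_range, not_exists, not_and]
  intro a ha e
  exact hq.ne_root a (by omega) e

theorem IsOrder.par_notMem (hq : R.IsOrder q) {k : ℕ} (hk : k < N - 1) :
    R.par (q k) ∉ (range (k + 1)).image q := by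
  rcases hq.par_mem hk with e | ⟨j, hj, hjN, e⟩ <;> rw [e]
  · exact hq.root_notMem (by omega)
  · exact hq.notMem hjN hj

theorem IsOrder.par_ne (hq : R.IsOrder q) {k : ℕ} (hk : k < N - 1) : R.par (q k) ≠ q k :=
  fun h => hq.par_notMem hk (by rw [h]; exact mem_image_of_mem _ (by simp))

theorem IsOrder.par_notMem_of (hq : R.IsOrder q) {k : ℕ} (hk : k ≤ N - 1) {y : Fin N}
    (hy : y ∉ (range k).image q) : R.par y ∉ (range k).image q := by
  by_cases hr : y = R.root
  · rw [hr, R.par_root]; exact hq.root_notMem hk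
  · obtain ⟨j, hj, rfl⟩ := hq.surj y hr
    have hjk : k ≤ j := by
      by_contra h
      exact hy (mem_image_of_mem _ (by simpa using h))
    exact fun h => hq.par_notMem hj (image_subset_image (range_subset_range.2 (by omega)) h)

theorem IsOrder.image_eq (hq : R.IsOrder q) {v : Fin N} :
    v ∈ (range (N - 1)).image q ↔ v ≠ R.root := by
  constructor
  · rintro h rfl; exact hq.root_notMem le_rfl h
  · intro h; obtain ⟨k, hk, rfl⟩ := hq.surj v h; exact mem_image_of_mem _ (by simpa using hk)

theorem depths_spec {W : ℕ} {plen dep : Fin N → ℝ} {s₀ : State} (hq : R.IsOrder q)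
    (hs : R.Stored q s₀) (hW : N < W) (hlen : ∀ v : Fin N, s₀.ra 5 v = plen v)
    (h0 : s₀.ra 6 R.root = 0) (hdr : dep R.root = 0)
    (hd : ∀ v, v ≠ R.root → dep v = dep (R.par v) + plen v) :
    WP W depths (120 * (N + 1)) s₀ fun s => ∀ v : Fin N, s.ra 6 v = dep v := by
  have hNpos := R.root.isLt
  refine (WP.forDown (x := 20) (y := 5) (n := N - 1) (T := 100) (fun k s =>
    s.ra 6 R.root = 0 ∧ ∀ j, k ≤ j → j < N - 1 → s.ra 6 (q j) = dep (q j))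
    rfl hs.nv5 (by omega) (fun _ _ _ h => h) ⟨h0, fun j h1 h2 => by omega⟩ ?_).mono (by omega) ?_
  · rintro k hk s hf hx ⟨hr, hj⟩
    have hs' := hs.of_frame hf rfl
    have e5 : ∀ v : Fin N, s.ra 5 v = plen v := by rw [hf.ra 5 rfl]; exact hlen
    refine WP.of_vc_le (by decide) ?_
    -- The parent is the root or comes later in `q`, so the backward pass has treated it already.
    have hp : s.ra 6 (R.par (q k)) = dep (R.par (q k)) := by
      rcases hq.par_mem hk with e | ⟨j, hkj, hjN, e⟩ <;> rw [e]
      · rw [hr, hdr]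
      · exact hj j hkj hjN
    have hFin : ∀ v : Fin N, (v : ℕ) < W := fun v => by omega
    have hkW : k < W := by omega
    simp only [Cmd.vc, NExp.ok, NExp.val, RExp.ok, RExp.val, hx, hs'.na7 k hk, State.setN_nv,
      State.setN_na, State.setN_ra, State.putR_ra, if_true, hs'.na6, e5, hp, hFin, hkW, true_and]
    refine ⟨?_, fun j h1 h2 => ?_⟩
    · rw [if_neg (by simpa [Fin.val_inj] using (hq.ne_root k hk).symm), hr]
    · by_cases h3 : k = j
      · subst h3
        rw [if_pos rfl, hd _ (hq.ne_root k hk)]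
      · rw [if_neg, hj j (by omega) h2]
        intro h4
        exact h3 (hq.inj k hk j h2 (Fin.ext h4.symm))
  · rintro s ⟨⟨h1, h2⟩, hf⟩ v
    by_cases hv : v = R.root
    · rw [hv, h1, hdr]
    · obtain ⟨j, hj, rfl⟩ := hq.surj v hv
      exact h2 j (Nat.zero_le _) hj

/-- The sum of `f` over the children of `v` in `S`. -/
theorem sum_children_insert {S : Finset (Fin N)} (f : Fin N → ℕ) {x : Fin N} (hx : x ∉ S)
    (hr : x ≠ R.root) (v : Fin N) :
    (∑ y with y ∈ insert x S ∧ y ≠ R.root ∧ R.par y = v, f y) =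
      (∑ y with y ∈ S ∧ y ≠ R.root ∧ R.par y = v, f y) + if v = R.par x then f x else 0 := by
  split_ifs with h
  · rw [add_comm, ← sum_insert (s := univ.filter _) (by simp [hx])]
    congr 1
    ext y
    simp only [mem_filter, mem_univ, true_and, mem_insert]
    grind
  · rw [add_zero]
    congr 1
    ext y
    simp only [mem_filter, mem_univ, true_and, mem_insert]
    grind

/-- The invariant of the computation of the subtree sizes. -/
structure SizeInv (R : Rooting N) (c : Fin N → ℕ) (S : Finset (Fin N)) (sz : Fin N → ℕ) :
    Prop where
  eq : ∀ v, sz v = c v + ∑ y with y ∈ S ∧ y ≠ R.root ∧ R.par y = v, sz y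
  total : ∑ v ∈ Sᶜ, sz v = ∑ v, c v
  le : ∀ v, sz v ≤ ∑ v, c v

/-- Excludes overflow: by `total`, the sizes of the vertices that have not yet been added to their
parents sum up to the total multiplicity, so any two of them stay within it. -/
theorem SizeInv.add_le {c : Fin N → ℕ} {S : Finset (Fin N)} {sz : Fin N → ℕ}
    (H : R.SizeInv c S sz) {x p : Fin N} (hx : x ∉ S) (hp : p ∉ S) (hpx : p ≠ x) :
    sz p + sz x ≤ ∑ v, c v := by
  rw [← H.total, ← sum_pair hpx]
  refine sum_le_sum_of_subset ?_
  intro y hy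
  simp only [mem_insert, mem_singleton] at hy
  rcases hy with rfl | rfl <;> simpa

theorem SizeInv.step {c : Fin N → ℕ} {S : Finset (Fin N)} {sz sz' : Fin N → ℕ}
    (H : R.SizeInv c S sz) {x p : Fin N} (hx : x ∉ S) (hr : x ≠ R.root) (hp : p = R.par x)
    (hpS : p ∉ insert x S) (hsz : ∀ v, sz' v = if v = p then sz p + sz x else sz v) :
    R.SizeInv c (insert x S) sz' := by
  have hpx : p ≠ x := fun h => hpS (by simp [h])
  have hpS' : p ∉ S := fun h => hpS (by simp [h])
  refine ⟨fun v => ?_, ?_, fun v => ?_⟩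
  · have e : (∑ y with y ∈ insert x S ∧ y ≠ R.root ∧ R.par y = v, sz' y) =
        ∑ y with y ∈ insert x S ∧ y ≠ R.root ∧ R.par y = v, sz y := by
      refine sum_congr rfl fun y hy => ?_
      rw [hsz, if_neg]
      rintro rfl
      exact hpS (mem_filter.1 hy).2.1
    rw [e, sum_children_insert _ hx hr, ← hp, hsz]
    have h1 := H.eq v
    by_cases hv : v = p
    · subst hv; simp only [if_true]; omega
    · simp only [if_neg hv]; omega
  · have hpc : p ∈ (insert x S)ᶜ := by simpa using hpS
    have hxc : insert x (insert x S)ᶜ = Sᶜ := by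
      ext y; simp only [mem_insert, mem_compl]; grind
    have h1 := H.total
    rw [← hxc, sum_insert (by simp), ← add_sum_erase _ _ hpc] at h1
    rw [← add_sum_erase _ _ hpc, hsz p, if_pos rfl, ← h1]
    have : ∑ v ∈ ((insert x S)ᶜ).erase p, sz' v = ∑ v ∈ ((insert x S)ᶜ).erase p, sz v :=
      sum_congr rfl fun v hv => by rw [hsz, if_neg (ne_of_mem_erase hv)]
    rw [this]
    ring
  · rw [hsz]
    split_ifs
    · exact H.add_le hx hpS' hpx
    · exact H.le v

theorem sizes_spec {W : ℕ} {c : Fin N → ℕ} {s₀ : State} (hq : R.IsOrder q)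
    (hs : R.Stored q s₀) (hW : N + 1 < W) (hc : ∀ v : Fin N, s₀.na 8 v = c v)
    (hcW : ∑ v, c v < W) :
    WP W sizes (240 * (N + 1)) s₀ fun s =>
      R.SizeInv c ((range (N - 1)).image q) (fun v => s.na 9 v) := by
  have hFin : ∀ v : Fin N, (v : ℕ) < W := fun v => by omega
  have hcv : ∀ v, c v ≤ ∑ v, c v := fun v => single_le_sum (fun _ _ => Nat.zero_le _) (mem_univ v)
  have hinit := WP.forUp (W := W) (x := 20) (y := 0) (n := N) (T := 100)
    (c := .putN 9 (.var 20) (.get 8 (.var 20))) (fun k s => ∀ v : Fin N, v < k → s.na 9 v = c v)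
    rfl rfl (by decide) hs.nv0 (by omega) (fun _ _ _ h => h) (by simp) (by
      intro k hk s hf hx hy h
      refine WP.of_vc_le (by decide) ?_
      have e8 : s.na 8 = s₀.na 8 := hf.na 8 rfl
      have hk' := hc ⟨k, hk⟩
      have hk2 := hcv ⟨k, hk⟩
      simp only at hk'
      simp only [Cmd.vc, NExp.ok, NExp.val, hx, e8, hk', State.putN_na, if_true]
      refine ⟨by omega, ⟨by omega, by omega⟩, fun v hv => ?_⟩
      split_ifs with h1
      · congr 1; exact Fin.ext h1.symm
      · exact h v (by omega))
  refine (WP.seq (hinit.mono le_rfl ?_)).mono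
    (T := (N * (100 + 9) + 8) + ((N - 1) * (100 + 9) + 8)) (by omega) fun _ h => h
  rintro s₁ ⟨h9, hf₁⟩
  have hs₁ := hs.of_frame hf₁ rfl
  refine (WP.forUp (x := 20) (y := 5) (n := N - 1) (T := 100)
    (fun k s => R.SizeInv c ((range k).image q) (fun v => s.na 9 v)) rfl rfl (by decide)
    hs₁.nv5 (by omega) (fun _ _ _ h => h) ?_ ?_).mono le_rfl fun s h => h.1
  · refine ⟨fun v => ?_, ?_, fun v => ?_⟩
    · simp [h9]
    · simp [h9]
    · rw [h9 v v.isLt]; exact hcv v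
  · intro k hk s hf hx hy H
    have hs' := hs₁.of_frame hf rfl
    refine WP.of_vc_le (by decide) ?_
    have hkW : k < W := by omega
    have hx' := hq.notMem hk le_rfl
    have hp' := hq.par_notMem hk
    have hS : (range (k + 1)).image q = insert (q k) ((range k).image q) := by
      rw [range_add_one, image_insert]
    rw [hS] at hp'
    have hle := fun v => (H.le v).trans_lt hcW
    have hadd := (H.add_le hx' (fun h => hp' (mem_insert_of_mem h)) (hq.par_ne hk)).trans_lt hcW
    simp only [Cmd.vc, NExp.ok, NExp.val, hx, hs'.na7 k hk, State.setN_nv, hkW,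
      State.setN_na, if_true, hs'.na6, hFin, true_and, hle, hadd, if_neg (show (21 : ℕ) ≠ 22 by decide)]
    rw [hS]
    exact H.step hx' (hq.ne_root k hk) rfl hp' fun v => by simp [Fin.ext_iff]

/-- Nested intervals `[lo v, lo v + sz v)` for the vertices, where the first `c v` elements of the
interval belong to `v` itself. -/
structure Intervals (R : Rooting N) (c lo sz : Fin N → ℕ) : Prop where
  own : ∀ v, c v ≤ sz v
  child_lo : ∀ v, v ≠ R.root → lo (R.par v) + c (R.par v) ≤ lo v
  child_hi : ∀ v, v ≠ R.root → lo v + sz v ≤ lo (R.par v) + sz (R.par v)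
  disj : ∀ u v, u ≠ v → u ≠ R.root → v ≠ R.root → R.par u = R.par v →
    lo u + sz u ≤ lo v ∨ lo v + sz v ≤ lo u
  hi_le : ∀ v, lo v + sz v ≤ ∑ v, c v

/-- The invariant of the computation of the intervals, where the vertices outside of `S` have
been processed. -/
structure StartInv (R : Rooting N) (c sz : Fin N → ℕ) (S : Finset (Fin N)) (lo nxt : Fin N → ℕ) :
    Prop where
  nxt_eq : ∀ p ∉ S, nxt p = lo p + c p + R.childSum S sz p
  child_lo : ∀ v ∉ S, v ≠ R.root → lo (R.par v) + c (R.par v) ≤ lo v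
  child_hi : ∀ v ∉ S, v ≠ R.root → lo v + sz v ≤ nxt (R.par v)
  disj : ∀ u ∉ S, ∀ v ∉ S, u ≠ v → u ≠ R.root → v ≠ R.root → R.par u = R.par v →
    lo u + sz u ≤ lo v ∨ lo v + sz v ≤ lo u
  hi_le : ∀ v ∉ S, lo v + sz v ≤ ∑ v, c v

theorem childSum_mono {S : Finset (Fin N)} (f : Fin N → ℕ) (v : Fin N) :
    R.childSum S f v ≤ R.childSum ∅ f v := by
  refine sum_le_sum_of_subset fun y hy => ?_
  simp only [mem_filter, mem_univ, true_and, notMem_empty, not_false_eq_true] at hy ⊢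
  exact hy.2

/-- The sizes of the children treated so far and of `x` are part of the size of the parent, so there
is still room for `x` in the interval of the parent. -/
theorem StartInv.nxt_add_le {c sz lo nxt : Fin N → ℕ} {S : Finset (Fin N)} {x : Fin N}
    (hx : x ∉ S) (H : R.StartInv c sz (insert x S) lo nxt)
    (hsz : ∀ v, sz v = c v + R.childSum ∅ sz v) (hr : x ≠ R.root) (hp : R.par x ∉ insert x S) :
    nxt (R.par x) + sz x ≤ ∑ v, c v := by
  have h1 := H.nxt_eq _ hp
  have h2 := H.hi_le _ hp
  have h3 := R.childSum_insert sz hx hr (R.par x)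
  have h4 := childSum_mono (R := R) (S := S) sz (R.par x)
  have h5 := hsz (R.par x)
  simp only [if_true] at h3
  omega

/-- The vertex `x` receives the next free stretch in the interval of its parent, behind all siblings
treated before; this yields the disjointness. By `hclosed` no treated vertex has `x` as its parent,
so the earlier conditions persist. -/
theorem StartInv.step {c sz lo nxt lo' nxt' : Fin N → ℕ} {S : Finset (Fin N)} {x p : Fin N}
    (hx : x ∉ S) (H : R.StartInv c sz (insert x S) lo nxt)
    (hsz : ∀ v, sz v = c v + R.childSum ∅ sz v) (hr : x ≠ R.root) (hpx : p = R.par x)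
    (hp : p ∉ insert x S) (hkids : ∀ y, y ≠ R.root → R.par y = x → y ∈ S)
    (hclosed : ∀ y ∉ insert x S, R.par y ∉ insert x S)
    (hlo : ∀ v, lo' v = if v = x then nxt p else lo v)
    (hnxt : ∀ v, nxt' v = if v = p then nxt p + sz x else if v = x then nxt p + c x else nxt v) :
    R.StartInv c sz S lo' nxt' := by
  subst hpx
  have hne : R.par x ≠ x := fun h => hp (by simp [h])
  have hmem : ∀ v ∉ S, v ≠ x → v ∉ insert x S := fun v hv hvx h => by
    rcases mem_insert.1 h with h | h <;> contradiction
  have hnx := H.nxt_eq _ hp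
  have hlop : lo' (R.par x) = lo (R.par x) := by rw [hlo, if_neg hne]
  refine ⟨fun v hv => ?_, fun v hv hvr => ?_, fun v hv hvr => ?_, ?_, fun v hv => ?_⟩
  · by_cases hvx : v = x
    · subst hvx
      rw [hnxt, if_neg hne.symm, if_pos rfl, hlo, if_pos rfl, R.childSum_eq_zero sz hkids]
      omega
    · have h1 := H.nxt_eq v (hmem v hv hvx)
      have h2 := R.childSum_insert sz hx hr v
      rw [hnxt, hlo, if_neg hvx, if_neg hvx]
      by_cases hvp : v = R.par x
      · subst hvp; simp only [if_true] at h2 ⊢; omega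
      · simp only [if_neg hvp] at h2 ⊢; omega
  · by_cases hvx : v = x
    · subst hvx
      rw [hlop, hlo, if_pos rfl]; omega
    · have h1 := H.child_lo v (hmem v hv hvx) hvr
      have h2 : R.par v ≠ x := fun h => hclosed v (hmem v hv hvx) (by simp [h])
      rw [hlo, hlo, if_neg hvx, if_neg h2]; exact h1
  · by_cases hvx : v = x
    · subst hvx
      rw [hlo, if_pos rfl, hnxt, if_pos rfl]
    · have h1 := H.child_hi v (hmem v hv hvx) hvr
      have h2 : R.par v ≠ x := fun h => hclosed v (hmem v hv hvx) (by simp [h])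
      rw [hlo, if_neg hvx, hnxt, if_neg h2]
      split_ifs with h3
      · rw [h3] at h1; omega
      · exact h1
  · have key : ∀ v ∉ S, v ≠ x → v ≠ R.root → R.par x = R.par v → lo v + sz v ≤ nxt (R.par x) := by
      intro v hv hvx hvr e
      rw [e]; exact H.child_hi v (hmem v hv hvx) hvr
    intro u hu v hv huv hur hvr e
    rw [hlo, hlo]
    by_cases hux : u = x
    · subst hux
      rw [if_pos rfl, if_neg huv.symm]
      exact .inr (key v hv huv.symm hvr e)
    · by_cases hvx : v = x
      · subst hvx
        rw [if_pos rfl, if_neg huv]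
        exact .inl (key u hu huv hur e.symm)
      · rw [if_neg hux, if_neg hvx]
        exact H.disj u (hmem u hu hux) v (hmem v hv hvx) huv hur hvr e
  · by_cases hvx : v = x
    · subst hvx
      rw [hlo, if_pos rfl]
      exact H.nxt_add_le hx hsz hr hp
    · rw [hlo, if_neg hvx]; exact H.hi_le v (hmem v hv hvx)

theorem starts_spec {W : ℕ} {c sz : Fin N → ℕ} {s₀ : State} (hq : R.IsOrder q)
    (hs : R.Stored q s₀) (hW : N + 1 < W) (hc : ∀ v : Fin N, s₀.na 8 v = c v)
    (hsz : ∀ v : Fin N, s₀.na 9 v = sz v) (hcW : ∑ v, c v < W)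
    (H : R.SizeInv c ((range (N - 1)).image q) sz) :
    WP W starts (120 * (N + 1)) s₀ fun s => R.Intervals c (fun v => s.na 10 v) sz := by
  have hFin : ∀ v : Fin N, (v : ℕ) < W := fun v => by omega
  have hcv : ∀ v, c v < W := fun v =>
    (single_le_sum (fun _ _ => Nat.zero_le _) (mem_univ v)).trans_lt hcW
  have hszW : ∀ v, sz v < W := fun v => (H.le v).trans_lt hcW
  have hsz' : ∀ v, sz v = c v + R.childSum ∅ sz v := by
    intro v
    rw [H.eq v]
    congr 1
    unfold childSum
    refine sum_congr ?_ fun _ _ => rfl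
    ext y
    simp [← hq.image_eq]
  have hcle : ∀ v, c v ≤ sz v := fun v => by have := hsz' v; omega
  have hinit : (Cmd.putN 10 (.var 3) (.lit 0) ;; .putN 11 (.var 3) (.get 8 (.var 3))).vc W
      (fun s => R.Stored q s ∧ s.na 8 = s₀.na 8 ∧ s.na 9 = s₀.na 9 ∧
        s.na 10 R.root = 0 ∧ s.na 11 R.root = c R.root) s₀ := by
    simp only [Cmd.vc, NExp.ok, NExp.val, State.putN_nv, hs.nv3, State.putN_na, hFin, hc]
    refine ⟨trivial, by omega, trivial, ⟨trivial, by simpa [hc] using hcv _⟩,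
      ⟨hs.nv0, hs.nv3, hs.nv5, hs.na6, hs.na7⟩, ?_, ?_, ?_, ?_⟩
    · ext; simp
    · ext; simp
    · simp
    · simp
  refine (WP.seq (T₁ := 20) ((WP.of_vc_le (by decide) hinit).mono le_rfl ?_)).mono
    (T := 20 + ((N - 1) * (100 + 9) + 8)) (by have := R.root.isLt; omega) fun _ h => h
  rintro s₁ ⟨hs₁, e8, e9, h10, h11⟩
  refine (WP.forDown (x := 20) (y := 5) (n := N - 1) (T := 100)
    (fun k s => R.StartInv c sz ((range k).image q) (fun v => s.na 10 v) (fun v => s.na 11 v))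
    rfl hs₁.nv5 (by omega) (fun _ _ _ h => h) ?_ ?_).mono le_rfl ?_
  · have hout : ∀ v, v ∉ (range (N - 1)).image q → v = R.root := fun v hv => by
      by_contra h; exact hv (hq.image_eq.2 h)
    refine ⟨fun p hp => ?_, fun v hv hvr => absurd (hout v hv) hvr,
      fun v hv hvr => absurd (hout v hv) hvr,
      fun u hu v hv _ hur => absurd (hout u hu) hur, fun v hv => ?_⟩
    · rw [hout p hp, h10, h11, R.childSum_eq_zero sz fun y hy _ => hq.image_eq.2 hy]; omega
    · rw [hout v hv, h10, zero_add]; exact H.le _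
  · intro k hk s hf hx H'
    have hs' := hs₁.of_frame hf rfl
    refine WP.of_vc_le (by decide) ?_
    have hkW : k < W := by omega
    have hx' := hq.notMem hk le_rfl
    have hp' := hq.par_notMem hk
    have hS : (range (k + 1)).image q = insert (q k) ((range k).image q) := by
      rw [range_add_one, image_insert]
    have hclosed := fun y => hq.par_notMem_of (k := k + 1) (by omega) (y := y)
    rw [hS] at hp' H' hclosed
    have hadd : s.na 11 (R.par (q k)) + sz (q k) < W :=
      (H'.nxt_add_le hx' hsz' (hq.ne_root k hk) hp').trans_lt hcW
    have hadd' : s.na 11 (R.par (q k)) + c (q k) < W := by have := hcle (q k); omega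
    have hn : s.na 11 (R.par (q k)) < W := by omega
    have hne : (R.par (q k) : ℕ) ≠ q k := fun h => hq.par_ne hk (Fin.ext h)
    have e8' : ∀ v : Fin N, s.na 8 v = c v := by rw [hf.na 8 rfl, e8]; exact hc
    have e9' : ∀ v : Fin N, s.na 9 v = sz v := by rw [hf.na 9 rfl, e9]; exact hsz
    simp [hx, hs'.na7 k hk, hs'.na6, hkW, hFin, hn, hadd, hadd', e8', e9', hcv, hszW, Fin.val_inj,
      hq.par_ne hk]
    refine H'.step hx' hsz' (hq.ne_root k hk) rfl hp' (fun y hy hyx => ?_) hclosed (fun v => rfl)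
      fun v => rfl
    by_contra hyS
    obtain ⟨j, hj, rfl⟩ := hq.surj y hy
    have := hq.child j hj k hk hyx
    exact hyS (mem_image_of_mem _ (by simpa using this))
  · rintro s ⟨H', -⟩
    simp only [range_zero, image_empty] at H'
    refine ⟨hcle, fun v => H'.child_lo v (by simp), fun v hv => ?_,
      fun u v => H'.disj u (by simp) v (by simp), fun v => H'.hi_le v (by simp)⟩
    refine (H'.child_hi v (by simp) hv).trans ?_
    rw [H'.nxt_eq _ (by simp), hsz' (R.par v)]
    omega

/-- `u` is an ancestor of `v` (possibly `u = v`). -/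
def Anc (R : Rooting N) (u v : Fin N) : Prop := ∃ m, R.par^[m] v = u

theorem Anc.refl (v : Fin N) : R.Anc v v := ⟨0, rfl⟩

theorem Anc.trans {u v w : Fin N} : R.Anc u v → R.Anc v w → R.Anc u w := by
  rintro ⟨a, rfl⟩ ⟨b, rfl⟩
  exact ⟨a + b, Function.iterate_add_apply _ _ _ _⟩

theorem Anc.par (v : Fin N) : R.Anc (R.par v) v := ⟨1, rfl⟩

theorem Anc.eq_or {u v : Fin N} (h : R.Anc u v) : u = v ∨ R.Anc u (R.par v) := by
  obtain ⟨m, rfl⟩ := h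
  cases m with
  | zero => exact .inl rfl
  | succ m => exact .inr ⟨m, rfl⟩

theorem Anc.root (v : Fin N) : R.Anc R.root v := by
  induction h : R.lev v using Nat.strong_induction_on generalizing v with
  | _ l ih =>
    by_cases hv : v = R.root
    · rw [hv]; exact Anc.refl _
    · exact (ih _ (h ▸ R.lev_par v hv) _ rfl).trans (Anc.par v)

/-- A strict descendant of `u` is below some child of `u`. -/
theorem Anc.exists_child {u v : Fin N} (h : R.Anc u v) (hne : u ≠ v) :
    ∃ y, y ≠ R.root ∧ R.par y = u ∧ R.Anc y v := by
  obtain ⟨m, hm⟩ := h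
  induction m generalizing v with
  | zero => exact absurd hm.symm hne
  | succ m ih =>
    by_cases hv : v = R.root
    · refine absurd ?_ hne
      rw [← hm, hv, Function.iterate_fixed R.par_root]
    · by_cases hp : u = R.par v
      · exact ⟨v, hv, hp.symm, Anc.refl v⟩
      · obtain ⟨y, hy, e, ha⟩ := ih hp hm
        exact ⟨y, hy, e, ha.trans (Anc.par v)⟩

variable {c lo sz : Fin N → ℕ}

theorem Intervals.of_anc (H : R.Intervals c lo sz) {u v : Fin N} (h : R.Anc u v) :
    lo u ≤ lo v ∧ lo v + sz v ≤ lo u + sz u := by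
  obtain ⟨m, hm⟩ := h
  induction m generalizing v with
  | zero => cases hm; exact ⟨le_rfl, le_rfl⟩
  | succ m ih =>
    by_cases hv : v = R.root
    · rw [hv, Function.iterate_fixed R.par_root] at hm
      rw [hv, hm]; exact ⟨le_rfl, le_rfl⟩
    · have h1 := ih hm
      have h2 := H.child_lo v hv
      have h3 := H.child_hi v hv
      omega

/-- The own elements of `v` are outside of the interval of `u` unless `u` is an ancestor
of `v`. -/
theorem Intervals.of_not_anc (H : R.Intervals c lo sz) {u v : Fin N} (h : ¬ R.Anc u v) :
    lo v + c v ≤ lo u ∨ lo u + sz u ≤ lo v := by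
  induction hl : R.lev u using Nat.strong_induction_on generalizing u with
  | _ l ih =>
    have hu : u ≠ R.root := fun e => h (e ▸ Anc.root v)
    have h1 := H.child_lo u hu
    have h2 := H.child_hi u hu
    -- If the parent of `u` is an ancestor of `v`, then `v` is this parent, whose own elements
    -- precede the intervals of its children, or `v` is below a sibling of `u`. Otherwise the
    -- induction hypothesis applies to the larger interval of the parent.
    by_cases hp : R.Anc (R.par u) v
    · by_cases hpv : R.par u = v
      · rw [hpv] at h1
        exact .inl h1
      · obtain ⟨y, hy, e, hyv⟩ := hp.exists_child hpv
        have h3 := H.of_anc hyv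
        have h4 := H.own v
        rcases H.disj y u (fun e => h (e ▸ hyv)) hy hu e with h5 | h5 <;> omega
    · rcases ih _ (hl ▸ R.lev_par u hu) hp rfl with h5 | h5 <;> omega

/-- An ancestor test in constant time, for which any own element `k` of `v` may serve. It is used
with one element per vertex for the lowest common ancestors, and with one element per median for the
queries. -/
theorem Intervals.anc_iff (H : R.Intervals c lo sz) {u v : Fin N} {k : ℕ} (h₁ : lo v ≤ k)
    (h₂ : k < lo v + c v) : R.Anc u v ↔ lo u ≤ k ∧ k < lo u + sz u := by
  constructor
  · intro h
    have h3 := H.of_anc h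
    have h4 := H.own v
    omega
  · intro h
    by_contra hn
    have := H.of_not_anc hn
    omega

end Rooting

end UncertainTree

/-! ### Binary lifting -/

namespace UncertainTree

open RealRAM Finset

/-- Tabulate the `2 ^ k`-th ancestors of all vertices. -/
def liftTable : Cmd :=
  .forUp 20 0 (.putN 12 (.var 20) (.get 6 (.var 20))) ;;
  (.setN 24 (.lit 1) ;; .setN 25 (.lit 2)) ;;
  .loop (.neg (.nle (.var 0) (.var 25)))
    (.forUp 20 0 (.putN 12 (.add (.mul (.var 24) (.var 0)) (.var 20))
      (.get 12 (.add (.mul (.sub (.var 24) (.lit 1)) (.var 0))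
        (.get 12 (.add (.mul (.sub (.var 24) (.lit 1)) (.var 0)) (.var 20)))))) ;;
    (.setN 24 (.add (.var 24) (.lit 1)) ;; .setN 25 (.add (.var 25) (.var 25))))

namespace Rooting

variable {N : ℕ} {R : Rooting N} {q : ℕ → Fin N}

/-- The state holds the ancestor table with `L` levels. -/
structure Lifted (R : Rooting N) (L : ℕ) (s : State) : Prop where
  nv24 : s.nv 24 = L
  le_pow : N ≤ 2 ^ L
  le_log : L ≤ Nat.log 2 N + 1
  na12 : ∀ k < L, ∀ v : Fin N, s.na 12 (k * N + v) = R.par^[2 ^ k] v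

theorem Lifted.of_frame {L : ℕ} {c : Cmd} {s s' : State} (h : R.Lifted L s) (hf : Frame c s s')
    (hc : (c.writesNv 24 || c.writesNa 12) = false) : R.Lifted L s' := by
  simp only [Bool.or_eq_false_iff] at hc
  exact ⟨by rw [hf.nv 24 hc.1, h.nv24], h.le_pow, h.le_log, by rw [hf.na 12 hc.2]; exact h.na12⟩

theorem mul_add_lt {a b L N : ℕ} (ha : a < L) (hb : b < N) : a * N + b < L * N := by
  nlinarith

/-- Row `k` of the table occupies the cells from `k * N` on. At most `Nat.log 2 N + 1` rows are
needed, so the indices stay below about `N * N`. -/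
theorem liftTable_spec {W : ℕ} {s₀ : State} (hs : R.Stored q s₀)
    (hW : 4 * ((N + 1) * (N + 1)) < W) :
    WP W liftTable (300 * ((N + 1) * (Nat.log 2 N + 2))) s₀ fun s => ∃ L, R.Lifted L s := by
  have hNpos := R.root.isLt
  have hNN : N ≤ N * N := Nat.le_mul_self N
  have hW' : 4 * (N * N) + 8 * N + 4 < W := by nlinarith
  have hFin : ∀ v : Fin N, (v : ℕ) < W := fun v => by omega
  have hlog : Nat.log 2 N < N := Nat.log_lt_self 2 (by omega)
  have hinit := WP.forUp (W := W) (x := 20) (y := 0) (n := N) (T := 100)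
    (c := .putN 12 (.var 20) (.get 6 (.var 20)))
    (fun k s => ∀ v : Fin N, v < k → s.na 12 v = R.par v)
    rfl rfl (by decide) hs.nv0 (by omega) (fun _ _ _ h => h) (by simp) (by
      intro k hk s hf hx hy h
      have hs' := hs.of_frame hf rfl
      refine WP.of_vc_le (by decide) ?_
      have hk' := hs'.na6 ⟨k, hk⟩
      simp only at hk'
      simp only [Cmd.vc, NExp.ok, NExp.val, hx, hk', State.putN_na, if_true, hFin, and_true]
      refine ⟨by omega, by omega, fun v hv => ?_⟩
      split_ifs with h1
      · congr 2; exact Fin.ext h1.symm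
      · exact h v (by omega))
  refine (WP.seq (hinit.mono le_rfl ?_)).mono (T := (N * (100 + 9) + 8) +
    (10 + ((Nat.log 2 N) * (4 + 1 + (N * (100 + 9) + 8 + 20)) + (4 + 1)))) (by nlinarith)
    fun _ h => h
  rintro s₁ ⟨h12, hf₁⟩
  have hs₁ := hs.of_frame hf₁ rfl
  refine WP.seq (WP.of_vc_le (by decide) ⟨?_, ?_, ?_⟩)
  · simp only [NExp.ok]; omega
  · simp only [NExp.ok]; omega
  -- There are `L` finished rows. The disjunction bounds `2 ^ L` by `2 * N`, which excludes overflow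
  -- in register 25.
  refine WP.loop (fun k s => R.Stored q s ∧ ∃ L, 1 ≤ L ∧ s.nv 24 = L ∧ s.nv 25 = 2 ^ L ∧
    (L = 1 ∨ 2 ^ (L - 1) < N) ∧ k + L = Nat.log 2 N + 1 ∧
    ∀ k < L, ∀ v : Fin N, s.na 12 (k * N + v) = R.par^[2 ^ k] v) ?_ ?_ ?_ ?_
  · rintro k s ⟨hs, L, h1, h24, h25, hL, hk, h⟩
    have : 2 ^ L ≤ 2 * N := by
      rcases hL with rfl | h
      · omega
      · rw [show L = L - 1 + 1 by omega, pow_succ]; omega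
    simp only [BExp.ok, NExp.ok, hs.nv0, h25]
    omega
  · rintro k s ⟨hs, L, h1, h24, h25, hL, hk, h⟩ hb
    simp only [BExp.val, NExp.val, hs.nv0, h25, not_not] at hb
    exact ⟨L, h24, hb, by omega, h⟩
  · rintro k s ⟨hs, L, h1, h24, h25, hL, hk, h⟩ hb
    simp only [BExp.val, NExp.val, hs.nv0, h25, not_le] at hb
    have hLlog : L ≤ Nat.log 2 N := Nat.le_log_of_pow_le (by omega) hb.le
    have hLN : L * N + N ≤ N * N := by nlinarith
    refine ⟨k - 1, by omega, ?_⟩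
    have hbody := WP.forUp (W := W) (x := 20) (y := 0) (n := N) (T := 100)
      (c := .putN 12 (.add (.mul (.var 24) (.var 0)) (.var 20))
        (.get 12 (.add (.mul (.sub (.var 24) (.lit 1)) (.var 0))
        (.get 12 (.add (.mul (.sub (.var 24) (.lit 1)) (.var 0)) (.var 20))))))
      (fun j s => (∀ v : Fin N, v < j → s.na 12 (L * N + v) = R.par^[2 ^ L] v) ∧
        ∀ k < L, ∀ v : Fin N, s.na 12 (k * N + v) = R.par^[2 ^ k] v)
      rfl rfl (by decide) hs.nv0 (by omega) (fun _ _ _ h => h) ⟨by simp, h⟩ (by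
        rintro j hj s' hf hx hy ⟨h2, h3⟩
        have hs' := hs.of_frame hf rfl
        have h24' : s'.nv 24 = L := (hf.nv 24 rfl).trans h24
        refine WP.of_vc_le (by decide) ?_
        obtain ⟨v, rfl⟩ : ∃ v : Fin N, (v : ℕ) = j := ⟨⟨j, hj⟩, rfl⟩
        have e1 := h3 (L - 1) (by omega) v
        have e2 := h3 (L - 1) (by omega) (R.par^[2 ^ (L - 1)] v)
        rw [← Function.iterate_add_apply, ← two_mul, ← pow_succ', show L - 1 + 1 = L by omega] at e2
        have hLN' : (L - 1) * N ≤ L * N := Nat.mul_le_mul_right _ (by omega)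
        have hb1 := (R.par^[2 ^ (L - 1)] v).isLt
        have hb2 := (R.par^[2 ^ L] v).isLt
        have hLW : L < W := by omega
        simp only [Cmd.vc, NExp.ok, NExp.val, hx, hs'.nv0, h24', e1, e2, State.putN_na, if_true]
        refine ⟨by omega, by omega, ⟨fun u hu => ?_, fun k hk u => ?_⟩⟩
        · split_ifs with h4
          · congr 2; exact Fin.ext (by omega)
          · exact h2 u (by omega)
        · have := mul_add_lt hk u.isLt
          rw [if_neg (by omega)]
          exact h3 k hk u)
    refine WP.seq (hbody.mono le_rfl ?_)
    rintro s' ⟨⟨h2, h3⟩, hf⟩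
    have hs' := hs.of_frame hf rfl
    have h24' : s'.nv 24 = L := (hf.nv 24 rfl).trans h24
    have h25' : s'.nv 25 = 2 ^ L := (hf.nv 25 rfl).trans h25
    refine WP.of_vc_le (by decide) ?_
    simp only [Cmd.vc, NExp.ok, NExp.val, h24', h25', State.setN_nv]
    refine ⟨by omega, by simp; omega, ⟨by simpa using hs'.nv0, by simpa using hs'.nv3,
      by simpa using hs'.nv5, hs'.na6, hs'.na7⟩, L + 1, by omega, by simp,
      by simp [pow_succ, mul_two], .inr (by simpa using hb), by omega, fun k hk v => ?_⟩
    rcases Nat.lt_succ_iff_lt_or_eq.1 hk with hk | rfl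
    · exact h3 k hk v
    · exact h2 v v.isLt
  · refine ⟨⟨by simpa using hs₁.nv0, by simpa using hs₁.nv3, by simpa using hs₁.nv5, hs₁.na6,
      hs₁.na7⟩, 1, le_rfl, by simp, by simp, .inl rfl, rfl, fun k hk v => ?_⟩
    obtain rfl : k = 0 := by omega
    simpa using h12 v v.isLt

/-- The invariant of binary lifting: `x` is an ancestor of `x₀` that satisfies `Q`, and fewer than
`2 ^ k` steps upwards from `x` lead to the highest such vertex. -/
def LiftInv (R : Rooting N) (Q : Fin N → Prop) (x₀ : Fin N) (k : ℕ) (x : Fin N) : Prop :=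
  R.Anc x x₀ ∧ Q x ∧ ∃ m < 2 ^ k, R.par^[m] x = R.root ∨ ¬ Q (R.par^[m + 1] x)

/-- The level drops in every step until the root is reached, which is a fixed point of `par`. -/
theorem iterate_lev (v : Fin N) : R.par^[R.lev v] v = R.root := by
  have key : ∀ j, R.par^[j] v = R.root ∨ R.lev (R.par^[j] v) + j ≤ R.lev v := by
    intro j
    induction j with
    | zero => exact .inr le_rfl
    | succ j ih =>
      rw [Function.iterate_succ_apply']
      by_cases h : R.par^[j] v = R.root
      · rw [h, R.par_root]; exact .inl rfl
      · have := R.lev_par _ h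
        rcases ih with ih | ih
        · exact absurd ih h
        · right; omega
  rcases key (R.lev v) with h | h
  · exact h
  · by_contra hr
    have := R.lev_par _ hr
    omega

theorem LiftInv.start {Q : Fin N → Prop} {x₀ : Fin N} {L : ℕ} (hL : N ≤ 2 ^ L) (hQ : Q x₀) :
    R.LiftInv Q x₀ L x₀ :=
  ⟨Anc.refl _, hQ, R.lev x₀, (R.lev_lt x₀).trans_le hL, .inl (iterate_lev x₀)⟩

theorem iterate_of_le {Q : Fin N → Prop} {x₀ x : Fin N}
    (hmono : ∀ y, R.Anc y x₀ → Q (R.par y) → Q y) (hx : R.Anc x x₀) {a b : ℕ} (hab : a ≤ b)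
    (hb : Q (R.par^[b] x)) : Q (R.par^[a] x) := by
  induction b, hab using Nat.le_induction with
  | base => exact hb
  | succ b hab ih =>
    rw [Function.iterate_succ_apply'] at hb
    exact ih (hmono _ (Anc.trans ⟨b, rfl⟩ hx) hb)

/-- By `hmono` the property `Q` is inherited downwards on the path from `x₀` to the root, so a
successful test at distance `2 ^ k` cannot have skipped a failure. -/
theorem LiftInv.step_pos {Q : Fin N → Prop} {x₀ x : Fin N} {k : ℕ}
    (hmono : ∀ y, R.Anc y x₀ → Q (R.par y) → Q y) (h : R.LiftInv Q x₀ (k + 1) x)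
    (hy : Q (R.par^[2 ^ k] x)) : R.LiftInv Q x₀ k (R.par^[2 ^ k] x) := by
  obtain ⟨hx, hQ, m, hm, hd⟩ := h
  refine ⟨Anc.trans ⟨_, rfl⟩ hx, hy, ?_⟩
  rw [pow_succ] at hm
  by_cases hmk : 2 ^ k ≤ m
  · refine ⟨m - 2 ^ k, by omega, ?_⟩
    rw [← Function.iterate_add_apply, ← Function.iterate_add_apply, Nat.sub_add_cancel hmk,
      show m - 2 ^ k + 1 + 2 ^ k = m + 1 by omega]
    exact hd
  -- The jump is longer than `m`: beyond the root it ends at the root, and beyond a failure of `Q`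
  -- it would contradict monotonicity.
  · refine ⟨0, by positivity, .inl ?_⟩
    rcases hd with hd | hd
    · rw [show 2 ^ k = 2 ^ k - m + m by omega, Function.iterate_add_apply, hd]
      exact Function.iterate_fixed R.par_root _
    · exact absurd (iterate_of_le hmono hx (by omega) hy) hd

theorem LiftInv.step_neg {Q : Fin N → Prop} {x₀ x : Fin N} {k : ℕ}
    (h : R.LiftInv Q x₀ (k + 1) x) (hy : ¬ Q (R.par^[2 ^ k] x)) : R.LiftInv Q x₀ k x := by
  have : 0 < 2 ^ k := by positivity
  exact ⟨h.1, h.2.1, 2 ^ k - 1, by omega, .inr (by rwa [show 2 ^ k - 1 + 1 = 2 ^ k by omega])⟩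

theorem LiftInv.final {Q : Fin N → Prop} {x₀ x : Fin N} (h : R.LiftInv Q x₀ 0 x) :
    R.Anc x x₀ ∧ Q x ∧ (x = R.root ∨ ¬ Q (R.par x)) := by
  obtain ⟨h1, h2, m, hm, h3⟩ := h
  obtain rfl : m = 0 := by simpa using hm
  exact ⟨h1, h2, h3⟩

end Rooting

end UncertainTree

/-! ## Preprocessing: the lowest common ancestors and the highest covering points -/

namespace UncertainTree

open RealRAM Finset

/-- Jump from the vertex in register 21 to the highest ancestor that is not an ancestor of the
vertex in register 22. -/
def climb : Cmd :=
  .forDown 25 24 (.setN 26 (.get 12 (.add (.mul (.var 25) (.var 0)) (.var 21))) ;;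
    .ite (.conj (.nle (.get 10 (.var 26)) (.var 23))
      (.neg (.nle (.add (.get 10 (.var 26)) (.get 9 (.var 26))) (.var 23))))
      .nop (.setN 21 (.var 26)))

/-- Compute the depth of the lowest common ancestor of each location and the median of its
owner. -/
def lcaDepths : Cmd :=
  .forUp 20 2 (
    (.setN 21 (.get 4 (.get 3 (.var 20))) ;; .setN 22 (.get 2 (.var 20)) ;;
      .setN 23 (.get 10 (.var 22))) ;;
    climb ;;
    .ite (.conj (.nle (.get 10 (.var 21)) (.var 23))
      (.neg (.nle (.add (.get 10 (.var 21)) (.get 9 (.var 21))) (.var 23))))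
      .nop (.setN 21 (.get 6 (.var 21))) ;;
    .putR 7 (.var 20) (.get 6 (.var 21)))

/-- Evaluate the expected distances of the uncertain points from the vertices in array 14. -/
def evalAll : Cmd :=
  .forUp 20 1 (.putR 10 (.var 20) .zero) ;;
  .forUp 20 2 (
    .setN 21 (.get 3 (.var 20)) ;; .setR 1 (.get 6 (.get 14 (.var 21))) ;;
    .setR 2 (.get 7 (.var 20)) ;; .ite (.rle (.var 1) (.var 2)) (.setR 2 (.var 1)) .nop ;;
    .putR 10 (.var 21) (.add (.get 10 (.var 21)) (.mul (.get 1 (.var 20))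
      (.sub (.add (.var 1) (.get 6 (.get 2 (.var 20)))) (.add (.var 2) (.var 2)))))) ;;
  .forUp 20 1 (.putR 10 (.var 20) (.mul (.get 2 (.var 20)) (.get 10 (.var 20))))

/-- The uncertain points as the machine knows them. -/
structure Points (N n M : ℕ) where
  med : Fin n → Fin N
  owner : Fin M → Fin n
  loc : Fin M → Fin N
  prob : Fin M → ℝ
  weight : Fin n → ℝ
  range : ℝ

/-- The state holds the input. -/
structure Points.Held {N n M : ℕ} (P : Points N n M) (s : State) : Prop where
  nv1 : s.nv 1 = n
  nv2 : s.nv 2 = M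
  rv0 : s.rv 0 = P.range
  na2 : ∀ j : Fin M, s.na 2 j = P.loc j
  na3 : ∀ j : Fin M, s.na 3 j = P.owner j
  na4 : ∀ i : Fin n, s.na 4 i = P.med i
  ra1 : ∀ j : Fin M, s.ra 1 j = P.prob j
  ra2 : ∀ i : Fin n, s.ra 2 i = P.weight i

namespace Points

variable {N n M : ℕ} {P : Points N n M} {R : Rooting N} {q : ℕ → Fin N}

theorem Held.of_frame {c : Cmd} {s s' : State} (h : P.Held s) (hf : Frame c s s')
    (hc : (c.writesNv 1 || c.writesNv 2 || c.writesRv 0 || c.writesNa 2 || c.writesNa 3 ||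
      c.writesNa 4 || c.writesRa 1 || c.writesRa 2) = false) : P.Held s' := by
  simp only [Bool.or_eq_false_iff] at hc
  obtain ⟨⟨⟨⟨⟨⟨⟨c1, c2⟩, c3⟩, c4⟩, c5⟩, c6⟩, c7⟩, c8⟩ := hc
  exact ⟨by rw [hf.nv 1 c1, h.nv1], by rw [hf.nv 2 c2, h.nv2], by rw [hf.rv 0 c3, h.rv0],
    by rw [hf.na 2 c4]; exact h.na2, by rw [hf.na 3 c5]; exact h.na3,
    by rw [hf.na 4 c6]; exact h.na4, by rw [hf.ra 1 c7]; exact h.ra1,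
    by rw [hf.ra 2 c8]; exact h.ra2⟩

/-- `z` is the lowest common ancestor of `u` and `v`. -/
def IsLca (R : Rooting N) (z u v : Fin N) : Prop :=
  R.Anc z u ∧ R.Anc z v ∧ ∀ y, R.Anc y u → R.Anc y v → R.Anc y z

theorem anc_total {u v w : Fin N} (hu : R.Anc u w) (hv : R.Anc v w) : R.Anc u v ∨ R.Anc v u := by
  obtain ⟨a, rfl⟩ := hu
  obtain ⟨b, rfl⟩ := hv
  rcases le_total a b with h | h
  · exact .inr ⟨b - a, by rw [← Function.iterate_add_apply, Nat.sub_add_cancel h]⟩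
  · exact .inl ⟨a - b, by rw [← Function.iterate_add_apply, Nat.sub_add_cancel h]⟩

theorem isLca_self {u v : Fin N} (h : R.Anc u v) : IsLca R u u v :=
  ⟨Rooting.Anc.refl u, h, fun _ hy _ => hy⟩

/-- Any common ancestor `y` of `u` and `v` is comparable with `x`. It is not below `x`, since then
`x` would be an ancestor of `v`; hence it is a proper ancestor of `x`. -/
theorem isLca_par {x u v : Fin N} (hx : R.Anc x u) (hxv : ¬ R.Anc x v) (hp : R.Anc (R.par x) v) :
    IsLca R (R.par x) u v := by
  refine ⟨(Rooting.Anc.par x).trans hx, hp, fun y hyu hyv => ?_⟩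
  rcases anc_total hyu hx with h | h
  · rcases h.eq_or with rfl | h
    · exact absurd hyv hxv
    · exact h
  · exact absurd (h.trans hyv) hxv

/-- Binary lifting for the property of not being an ancestor of `p`, which is inherited downwards.
If `x₀` itself is an ancestor of `p`, so are all its ancestors, and no jump is made. -/
theorem climb_spec {W L : ℕ} {lo sz : Fin N → ℕ} {s₀ : State} (hs : R.Stored q s₀)
    (hL : R.Lifted L s₀) (hW : 4 * ((N + 1) * (N + 1)) < W)
    (hI : R.Intervals (fun _ => 1) lo sz) (hlo : ∀ v : Fin N, s₀.na 10 v = lo v)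
    (hsz : ∀ v : Fin N, s₀.na 9 v = sz v) {x₀ p : Fin N} (h21 : s₀.nv 21 = x₀)
    (h23 : s₀.nv 23 = lo p) :
    WP W climb (60 * (L + 1)) s₀ fun s => ∃ x : Fin N, s.nv 21 = x ∧
      ((x = x₀ ∧ R.Anc x p) ∨ R.Anc x x₀ ∧ ¬ R.Anc x p ∧ R.Anc (R.par x) p) := by
  have hNpos := R.root.isLt
  have hNN : N ≤ N * N := Nat.le_mul_self N
  have hW' : 4 * (N * N) + 8 * N + 4 < W := by nlinarith
  have hFin : ∀ v : Fin N, (v : ℕ) < W := fun v => by omega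
  have hhi : ∀ v, lo v + sz v ≤ N := fun v => by simpa using hI.hi_le v
  have hLN : L ≤ N := hL.le_log.trans (Nat.log_lt_self 2 (by omega))
  have hanc : ∀ u, R.Anc u p ↔ lo u ≤ lo p ∧ lo p < lo u + sz u := fun u =>
    hI.anc_iff le_rfl (by omega)
  have hmono : ∀ y, R.Anc y x₀ → ¬ R.Anc (R.par y) p → ¬ R.Anc y p := fun y _ h h' =>
    h ((Rooting.Anc.par y).trans h')
  refine (WP.forDown (x := 25) (y := 24) (n := L) (T := 40) (fun k s => ∃ x : Fin N, s.nv 21 = x ∧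
      ((x = x₀ ∧ R.Anc x p) ∨ R.LiftInv (fun y => ¬ R.Anc y p) x₀ k x))
    rfl hL.nv24 (by omega) (fun _ _ _ h => h) ?_ ?_).mono (by omega) ?_
  · refine ⟨x₀, h21, ?_⟩
    by_cases h : R.Anc x₀ p
    · exact .inl ⟨rfl, h⟩
    · exact .inr (Rooting.LiftInv.start hL.le_pow h)
  · rintro k hk s hf hx ⟨x, h21', hinv⟩
    have hs' := hs.of_frame hf rfl
    have hL' := hL.of_frame hf rfl
    have e23 : s.nv 23 = lo p := (hf.nv 23 rfl).trans h23
    have e10 : ∀ v : Fin N, s.na 10 v = lo v := by rw [hf.na 10 rfl]; exact hlo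
    have e9 : ∀ v : Fin N, s.na 9 v = sz v := by rw [hf.na 9 rfl]; exact hsz
    have e12 := hL'.na12 k hk x
    set y := R.par^[2 ^ k] x with hy
    have h1 := Rooting.mul_add_lt hk x.isLt
    have h2 : L * N ≤ N * N := Nat.mul_le_mul_right _ hLN
    have h3 := hhi y
    have h4 := hhi p
    refine WP.of_vc_le (by decide) ?_
    simp [hx, hs'.nv0, h21', e12, e10, e9, e23, hFin]
    refine ⟨⟨by omega, by omega⟩, ⟨⟨by omega, by omega⟩, by omega, by omega⟩, fun h5 h6 => ?_,
      fun h5 => ?_⟩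
    · have hyp : R.Anc y p := (hanc y).2 ⟨h5, h6⟩
      refine ⟨x, rfl, ?_⟩
      rcases hinv with h7 | h7
      · exact .inl h7
      · exact .inr (h7.step_neg (by simpa using hyp))
    · have hyp : ¬ R.Anc y p := fun h => by
        have := (hanc y).1 h
        have := h5 this.1
        omega
      refine ⟨y, rfl, ?_⟩
      rcases hinv with h7 | h7
      · exact absurd (Rooting.Anc.trans ⟨_, hy.symm⟩ h7.2) hyp
      · exact .inr (h7.step_pos hmono hyp)
  · rintro s ⟨⟨x, h21', hinv⟩, hf⟩
    refine ⟨x, h21', hinv.imp_right fun h => ?_⟩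
    obtain ⟨h1, h2, h3⟩ := h.final
    refine ⟨h1, h2, ?_⟩
    rcases h3 with rfl | h3
    · exact absurd (Rooting.Anc.root p) h2
    · exact not_not.1 h3

/-- Repeating the interval test after `climb` tells its two outcomes apart: the median is an
ancestor of the location and thus the lowest common ancestor, or the vertex reached is a child of
it. -/
theorem lcaDepths_spec {W L : ℕ} {lo sz : Fin N → ℕ} {dep : Fin N → ℝ} {s₀ : State}
    (hP : P.Held s₀) (hs : R.Stored q s₀)
    (hL : R.Lifted L s₀) (hW : 4 * ((N + 1) * (N + 1)) < W) (hMW : M + 1 < W) (hnW : n < W)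
    (hI : R.Intervals (fun _ => 1) lo sz) (hlo : ∀ v : Fin N, s₀.na 10 v = lo v)
    (hsz : ∀ v : Fin N, s₀.na 9 v = sz v) (hdep : ∀ v : Fin N, s₀.ra 6 v = dep v) :
    WP W lcaDepths (300 * ((M + 1) * (L + 1))) s₀ fun s => ∀ j : Fin M, ∃ z,
      IsLca R z (P.med (P.owner j)) (P.loc j) ∧ s.ra 7 j = dep z := by
  have hNpos := R.root.isLt
  have hNN : N ≤ N * N := Nat.le_mul_self N
  have hW' : 4 * (N * N) + 8 * N + 4 < W := by nlinarith
  have hFin : ∀ v : Fin N, (v : ℕ) < W := fun v => by omega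
  have hFin' : ∀ v : Fin n, (v : ℕ) < W := fun v => by omega
  have hhi : ∀ v, lo v + sz v ≤ N := fun v => by simpa using hI.hi_le v
  refine (WP.forUp (x := 20) (y := 2) (n := M) (T := 100 + 60 * (L + 1)) (fun k s =>
    ∀ j : Fin M, j < k → ∃ z, IsLca R z (P.med (P.owner j)) (P.loc j) ∧ s.ra 7 j = dep z)
    rfl rfl (by decide) hP.nv2 hMW (fun _ _ _ h => h) (by simp) ?_).mono (by nlinarith) ?_
  · rintro k hk s hf hx hy h
    obtain ⟨j, rfl⟩ : ∃ j : Fin M, (j : ℕ) = k := ⟨⟨k, hk⟩, rfl⟩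
    have hP' := hP.of_frame hf rfl
    have hs' := hs.of_frame hf rfl
    have hL' := hL.of_frame hf rfl
    have e10 : ∀ v : Fin N, s.na 10 v = lo v := by rw [hf.na 10 rfl]; exact hlo
    have e9 : ∀ v : Fin N, s.na 9 v = sz v := by rw [hf.na 9 rfl]; exact hsz
    have e6 : ∀ v : Fin N, s.ra 6 v = dep v := by rw [hf.ra 6 rfl]; exact hdep
    have hlop := hhi (P.loc j)
    have hvc : (Cmd.setN 21 (.get 4 (.get 3 (.var 20))) ;; Cmd.setN 22 (.get 2 (.var 20)) ;;
        Cmd.setN 23 (.get 10 (.var 22))).vc W (fun s => s.nv 21 = P.med (P.owner j) ∧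
          s.nv 23 = lo (P.loc j)) s := by
      simp [hx, hP'.na2, hP'.na3, hP'.na4, e10, hFin, hFin']
      omega
    refine (WP.seq (T₁ := 40) ((WP.of_vc_le (by decide) hvc).frame.mono le_rfl ?_)).mono
      (T := 40 + (60 * (L + 1) + 60)) (by omega) fun _ h => h
    rintro s₁ ⟨⟨h21, h23⟩, hf₁⟩
    refine WP.seq ((climb_spec (hs'.of_frame hf₁ rfl) (hL'.of_frame hf₁ rfl) hW hI
      (by rw [hf₁.na 10 rfl]; exact e10) (by rw [hf₁.na 9 rfl]; exact e9) h21 h23).frame.mono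
      le_rfl ?_)
    rintro s₂ ⟨⟨x, hx21, hcase⟩, hf₂⟩
    have hs₂ := (hs'.of_frame hf₁ rfl).of_frame hf₂ rfl
    have hx' : s₂.nv 20 = j := by rw [hf₂.nv 20 rfl, hf₁.nv 20 rfl, hx]
    have h23' : s₂.nv 23 = lo (P.loc j) := by rw [hf₂.nv 23 rfl, h23]
    have e10' : ∀ v : Fin N, s₂.na 10 v = lo v := by
      rw [hf₂.na 10 rfl, hf₁.na 10 rfl]; exact e10
    have e9' : ∀ v : Fin N, s₂.na 9 v = sz v := by rw [hf₂.na 9 rfl, hf₁.na 9 rfl]; exact e9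
    have e6' : ∀ v : Fin N, s₂.ra 6 v = dep v := by rw [hf₂.ra 6 rfl, hf₁.ra 6 rfl]; exact e6
    have e7' : s₂.ra 7 = s.ra 7 := by rw [hf₂.ra 7 rfl, hf₁.ra 7 rfl]
    have hanc : ∀ u, R.Anc u (P.loc j) ↔ lo u ≤ lo (P.loc j) ∧ lo (P.loc j) < lo u + sz u :=
      fun u => hI.anc_iff le_rfl (by omega)
    have hhx := hhi x
    have hput : ∀ z, IsLca R z (P.med (P.owner j)) (P.loc j) → ∀ i : Fin M, (i : ℕ) < j + 1 →
        ∃ z', IsLca R z' (P.med (P.owner i)) (P.loc i) ∧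
          (if (i : ℕ) = j then dep z else s.ra 7 i) = dep z' := by
      intro z hz i hi
      split_ifs with hij
      · obtain rfl := Fin.ext hij
        exact ⟨z, hz, rfl⟩
      · exact h i (by omega)
    have hjW : (j : ℕ) < W := by omega
    refine WP.of_vc_le (by decide) ?_
    simp only [Cmd.vc, BExp.ok, BExp.val, NExp.ok, NExp.val, RExp.ok, RExp.val, hx21, e10', e9',
      h23', hs₂.na6, State.setN_nv, hFin, true_and]
    refine ⟨⟨⟨by omega, by omega⟩, ⟨by omega, by omega, by omega⟩, by omega⟩, fun hc => ?_,
      fun hc => ?_⟩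
    · have hxp : R.Anc x (P.loc j) := (hanc x).2 ⟨hc.1, by omega⟩
      have hlca : IsLca R x (P.med (P.owner j)) (P.loc j) := by
        rcases hcase with ⟨rfl, h1⟩ | ⟨-, h1, -⟩
        · exact isLca_self h1
        · exact absurd hxp h1
      refine ⟨by omega, fun i hi => ?_⟩
      simpa only [State.putR_ra, hx', if_true, e6', e7'] using hput x hlca i hi
    · have hxp : ¬ R.Anc x (P.loc j) := fun h1 => by
        have := (hanc x).1 h1
        exact hc ⟨this.1, by omega⟩
      have hlca : IsLca R (R.par x) (P.med (P.owner j)) (P.loc j) := by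
        rcases hcase with ⟨rfl, h1⟩ | ⟨h1, h2, h3⟩
        · exact absurd h1 hxp
        · exact isLca_par h1 h2 h3
      have e20 : (20 : ℕ) ≠ 21 := by decide
      simp only [if_neg e20, if_true]
      refine ⟨by omega, hFin _, fun i hi => ?_⟩
      simpa only [State.putR_ra, hx', if_true, e6', e7', State.setN_ra] using hput _ hlca i hi
  · rintro s ⟨h, -⟩ j
    exact h j j.isLt

end Points

end UncertainTree

/-! ### Searching for the highest covering points -/

namespace UncertainTree

open RealRAM Finset

/-- Find the highest vertices that cover the uncertain points. -/
def search : Cmd :=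
  .forUp 20 1 (.putN 13 (.var 20) (.get 4 (.var 20))) ;;
  .forDown 27 24 (
    .forUp 20 1 (.putN 14 (.var 20)
      (.get 12 (.add (.mul (.var 27) (.var 0)) (.get 13 (.var 20))))) ;;
    evalAll ;;
    .forUp 20 1 (.ite (.rle (.get 10 (.var 20)) (.var 0))
      (.putN 13 (.var 20) (.get 14 (.var 20))) .nop))

/-- Find the highest covering points on the edges above the vertices found by `search`. -/
def interpolate : Cmd :=
  .forUp 20 1 (.putN 14 (.var 20) (.get 13 (.var 20))) ;;
  evalAll ;;
  .forUp 20 1 (.putR 11 (.var 20) (.get 10 (.var 20))) ;;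
  .forUp 20 1 (.putN 14 (.var 20) (.get 6 (.get 13 (.var 20)))) ;;
  evalAll ;;
  .forUp 20 1 (
    .setN 21 (.get 13 (.var 20)) ;;
    .ite (.conj (.nle (.var 21) (.var 3)) (.nle (.var 3) (.var 21))) (.setR 1 .zero)
      (.setR 1 (.div (.mul (.sub (.var 0) (.get 11 (.var 20))) (.get 5 (.var 21)))
        (.sub (.get 10 (.var 20)) (.get 11 (.var 20))))) ;;
    .putN 16 (.var 20) (.var 21) ;; .putN 17 (.var 20) (.get 6 (.var 21)) ;;
    .putR 13 (.var 20) (.var 1) ;; .putR 12 (.var 20) (.sub (.get 6 (.var 21)) (.var 1)))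

namespace Points

variable {N n M : ℕ} {P : Points N n M} {R : Rooting N} {q : ℕ → Fin N}

/-- The expected distance of the uncertain point `i` from the point at depth `δ` above its median,
where `g j` is the depth of the lowest common ancestor of location `j` and the median. -/
noncomputable def ed (P : Points N n M) (dep : Fin N → ℝ) (g : Fin M → ℝ) (i : Fin n) (δ : ℝ) : ℝ :=
  P.weight i * ∑ j with P.owner j = i,
    P.prob j * (δ + dep (P.loc j) - (min δ (g j) + min δ (g j)))

theorem sum_filter_lt_succ {f : Fin M → ℝ} {i : Fin n} (j : Fin M) :
    (∑ k : Fin M with k.val < j.val + 1 ∧ P.owner k = i, f k) =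
      (∑ k : Fin M with k.val < j.val ∧ P.owner k = i, f k) + if i = P.owner j then f j else 0 := by
  split_ifs with h
  · rw [add_comm _ (f j), ← sum_insert (s := univ.filter _) (by simp)]
    congr 1
    ext y
    simp only [mem_filter, mem_univ, true_and, mem_insert, Fin.ext_iff]
    grind
  · rw [add_zero]
    congr 1
    ext y
    simp only [mem_filter, mem_univ, true_and]
    grind

/-- A single pass over the locations evaluates one expected distance for every uncertain point,
since each location contributes to its owner only; the time is linear in `n + M`. -/
theorem evalAll_spec {W : ℕ} {dep : Fin N → ℝ} {g : Fin M → ℝ} {U : Fin n → Fin N} {s₀ : State}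
    (hP : P.Held s₀) (hNW : N < W) (hMW : M + 1 < W) (hnW : n + 1 < W)
    (hdep : ∀ v : Fin N, s₀.ra 6 v = dep v) (hg : ∀ j : Fin M, s₀.ra 7 j = g j)
    (hU : ∀ i : Fin n, s₀.na 14 i = U i) :
    WP W evalAll (300 * (n + M + 1)) s₀ fun s =>
      ∀ i : Fin n, s.ra 10 i = P.ed dep g i (dep (U i)) := by
  have hFin : ∀ v : Fin N, (v : ℕ) < W := fun v => by omega
  have hFin' : ∀ v : Fin n, (v : ℕ) < W := fun v => by omega
  have hFin'' : ∀ v : Fin M, (v : ℕ) < W := fun v => by omega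
  have hinit := WP.forUp (W := W) (x := 20) (y := 1) (n := n) (T := 60)
    (c := .putR 10 (.var 20) .zero) (fun k s => ∀ i : Fin n, i < k → s.ra 10 i = 0)
    rfl rfl (by decide) hP.nv1 (by omega) (fun _ _ _ h => h) (by simp) (by
      intro k hk s hf hx hy h
      refine WP.of_vc_le (by decide) ?_
      simp only [Cmd.vc, NExp.ok, NExp.val, RExp.ok, RExp.val, hx, State.putR_ra, if_true]
      refine ⟨by omega, trivial, fun v hv => ?_⟩
      split_ifs with h1
      · rfl
      · exact h v (by omega))
  refine (WP.seq (hinit.mono le_rfl ?_)).mono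
    (T := (n * (60 + 9) + 8) + ((M * (60 + 9) + 8) + (n * (60 + 9) + 8))) (by omega) fun _ h => h
  rintro s₁ ⟨h₁, hf₁⟩
  have hP₁ := hP.of_frame hf₁ rfl
  refine WP.seq ((WP.forUp (W := W) (x := 20) (y := 2) (n := M) (T := 60) (fun k s =>
    ∀ i : Fin n, s.ra 10 i = ∑ j : Fin M with j.val < k ∧ P.owner j = i,
      P.prob j * (dep (U i) + dep (P.loc j) - (min (dep (U i)) (g j) + min (dep (U i)) (g j))))
    rfl rfl (by decide) hP₁.nv2 (by omega) (fun _ _ _ h => h) ?_ ?_).mono le_rfl ?_)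
  · intro i
    simp [h₁ i i.isLt]
  · intro k hk s hf hx hy h
    obtain ⟨j, rfl⟩ : ∃ j : Fin M, (j : ℕ) = k := ⟨⟨k, hk⟩, rfl⟩
    have hP' := hP₁.of_frame hf rfl
    have e6 : ∀ v : Fin N, s.ra 6 v = dep v := by rw [hf.ra 6 rfl, hf₁.ra 6 rfl]; exact hdep
    have e7 : ∀ v : Fin M, s.ra 7 v = g v := by rw [hf.ra 7 rfl, hf₁.ra 7 rfl]; exact hg
    have e14 : ∀ v : Fin n, s.na 14 v = U v := by rw [hf.na 14 rfl, hf₁.na 14 rfl]; exact hU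
    refine WP.of_vc_le (by decide) ?_
    have key : ∀ m, m = min (dep (U (P.owner j))) (g j) → ∀ i : Fin n,
        (if i = P.owner j then
          (∑ k : Fin M with k.val < j.val ∧ P.owner k = P.owner j, P.prob k * (dep (U (P.owner j)) +
            dep (P.loc k) - (min (dep (U (P.owner j))) (g k) + min (dep (U (P.owner j))) (g k)))) +
            P.prob j * (dep (U (P.owner j)) + dep (P.loc j) - (m + m))
        else ∑ k : Fin M with k.val < j.val ∧ P.owner k = i, P.prob k * (dep (U i) +
            dep (P.loc k) - (min (dep (U i)) (g k) + min (dep (U i)) (g k)))) =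
        ∑ k : Fin M with k.val < j.val + 1 ∧ P.owner k = i, P.prob k * (dep (U i) +
            dep (P.loc k) - (min (dep (U i)) (g k) + min (dep (U i)) (g k))) := by
      rintro m rfl i
      rw [sum_filter_lt_succ]
      split_ifs with h1
      · rw [h1]
      · rw [add_zero]
    simp [hx, hP'.na2, hP'.na3, hP'.ra1, e6, e7, e14, hFin, hFin', hFin'', h, Fin.val_inj]
    exact ⟨fun h1 => by simpa using key _ (min_eq_left h1).symm,
      fun h1 => by simpa using key _ (min_eq_right h1.le).symm⟩
  · rintro s₂ ⟨h₂, hf₂⟩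
    have hP₂ := hP₁.of_frame hf₂ rfl
    have h₂' : ∀ i : Fin n, s₂.ra 10 i = ∑ j with P.owner j = i, P.prob j *
        (dep (U i) + dep (P.loc j) - (min (dep (U i)) (g j) + min (dep (U i)) (g j))) := by
      intro i; simpa using h₂ i
    refine (WP.forUp (W := W) (x := 20) (y := 1) (n := n) (T := 60) (fun k s =>
      (∀ i : Fin n, i < k → s.ra 10 i = P.ed dep g i (dep (U i))) ∧
      ∀ i : Fin n, k ≤ i → s.ra 10 i = s₂.ra 10 i)
      rfl rfl (by decide) hP₂.nv1 (by omega) (fun _ _ _ h => h) ?_ ?_).mono le_rfl ?_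
    · exact ⟨by simp, fun _ _ => rfl⟩
    · rintro k hk s hf hx hy ⟨h3, h4⟩
      obtain ⟨i, rfl⟩ : ∃ i : Fin n, (i : ℕ) = k := ⟨⟨k, hk⟩, rfl⟩
      have hP' := hP₂.of_frame hf rfl
      refine WP.of_vc_le (by decide) ?_
      simp only [Cmd.vc, NExp.ok, NExp.val, RExp.ok, RExp.val, hx, State.putR_ra, if_true, hFin',
        true_and, hP'.ra2, h4 i le_rfl, h₂' i]
      refine ⟨fun l hl => ?_, fun l hl => ?_⟩
      · split_ifs with h5
        · rw [Fin.ext h5]; rfl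
        · exact h3 l (by omega)
      · rw [if_neg (by omega)]; exact h4 l (by omega)
    · rintro s ⟨⟨h, -⟩, -⟩ i
      exact h i i.isLt

/-- A loop that fills an integer array, indexed by the uncertain points. -/
theorem fill_spec {W a : ℕ} {e : NExp} {U : Fin n → Fin N} {s₀ : State} (hn : s₀.nv 1 = n)
    (hnW : n + 1 < W) (he : e.cost ≤ 50)
    (h : ∀ i : Fin n, ∀ s, Frame (.forUp 20 1 (.putN a (.var 20) e)) s₀ s → s.nv 20 = i →
      e.ok W s ∧ e.val s = U i) :
    WP W (.forUp 20 1 (.putN a (.var 20) e)) (n * (60 + 9) + 8) s₀ fun s =>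
      ∀ i : Fin n, s.na a i = U i := by
  refine (WP.forUp (x := 20) (y := 1) (n := n) (T := 60)
    (fun k s => ∀ i : Fin n, i < k → s.na a i = U i)
    rfl rfl (by decide) hn (by omega) (fun _ _ _ h => h) (by simp) ?_).mono le_rfl
    fun s h i => h.1 i i.isLt
  intro k hk s hf hx hy h'
  obtain ⟨i, rfl⟩ : ∃ i : Fin n, (i : ℕ) = k := ⟨⟨k, hk⟩, rfl⟩
  obtain ⟨h1, h2⟩ := h i s hf hx
  refine WP.of_vc_le (by simp only [Cmd.cost, NExp.cost]; omega) ?_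
  simp only [Cmd.vc, NExp.ok, NExp.val, hx, h1, h2, State.putN_na, if_true]
  refine ⟨by omega, trivial, fun l hl => ?_⟩
  split_ifs with h5
  · rw [Fin.ext h5]
  · exact h' l (by omega)

/-- The binary searches of all uncertain points run in lockstep, with one call of `evalAll` per
level of the ancestor table. The hypothesis `hmono` makes coverage inherited downwards, as
`LiftInv.step_pos` requires; it will come from convexity. -/
theorem search_spec {W L : ℕ} {dep : Fin N → ℝ} {g : Fin M → ℝ} {s₀ : State}
    (hP : P.Held s₀) (hs : R.Stored q s₀) (hL : R.Lifted L s₀)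
    (hW : 4 * ((N + 1) * (N + 1)) < W) (hMW : M + 1 < W) (hnW : n + 1 < W)
    (hdep : ∀ v : Fin N, s₀.ra 6 v = dep v) (hg : ∀ j : Fin M, s₀.ra 7 j = g j)
    (hmed : ∀ i, P.ed dep g i (dep (P.med i)) ≤ P.range)
    (hmono : ∀ i y, R.Anc y (P.med i) → P.ed dep g i (dep (R.par y)) ≤ P.range →
      P.ed dep g i (dep y) ≤ P.range) :
    WP W search (800 * ((n + M + 1) * (L + 1))) s₀ fun s => ∃ cur : Fin n → Fin N,
      (∀ i : Fin n, s.na 13 i = cur i) ∧ ∀ i, R.Anc (cur i) (P.med i) ∧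
        P.ed dep g i (dep (cur i)) ≤ P.range ∧
        (cur i = R.root ∨ ¬ P.ed dep g i (dep (R.par (cur i))) ≤ P.range) := by
  have hNpos := R.root.isLt
  have hNN : N ≤ N * N := Nat.le_mul_self N
  have hW' : 4 * (N * N) + 8 * N + 4 < W := by nlinarith
  have hFin : ∀ v : Fin N, (v : ℕ) < W := fun v => by omega
  have hFin' : ∀ v : Fin n, (v : ℕ) < W := fun v => by omega
  have hLN : L ≤ N := hL.le_log.trans (Nat.log_lt_self 2 (by omega))
  refine (WP.seq ((fill_spec (U := P.med) hP.nv1 hnW (by decide) ?_).frame.mono le_rfl ?_)).mono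
    (T := (n * (60 + 9) + 8) + (L * ((n * (60 + 9) + 8) +
      (300 * (n + M + 1) + (n * (60 + 9) + 8)) + 9) + 8)) (by nlinarith) fun _ h => h
  · intro i s hf hx
    have hP' := hP.of_frame hf rfl
    simp [hx, hP'.na4, hFin, hFin']
  rintro s₁ ⟨h₁, hf₁⟩
  have hP₁ := hP.of_frame hf₁ rfl
  have hs₁ := hs.of_frame hf₁ rfl
  have hL₁ := hL.of_frame hf₁ rfl
  refine (WP.forDown (x := 27) (y := 24) (n := L) (fun k s => ∃ cur : Fin n → Fin N,
      (∀ i : Fin n, s.na 13 i = cur i) ∧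
      ∀ i, R.LiftInv (fun y => P.ed dep g i (dep y) ≤ P.range) (P.med i) k (cur i))
    rfl hL₁.nv24 (by omega) (fun _ _ _ h => h) ?_ ?_).mono le_rfl ?_
  · exact ⟨P.med, h₁, fun i => Rooting.LiftInv.start hL.le_pow (hmed i)⟩
  · rintro k hk s hf hx ⟨cur, hcur, hinv⟩
    have hP' := hP₁.of_frame hf rfl
    have hs' := hs₁.of_frame hf rfl
    have hL' := hL₁.of_frame hf rfl
    have h2 : L * N ≤ N * N := Nat.mul_le_mul_right _ hLN
    refine WP.seq ((fill_spec (U := fun i => R.par^[2 ^ k] (cur i)) hP'.nv1 hnW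
      (by decide) ?_).frame.mono le_rfl ?_)
    · intro i t hft hxt
      have hst := hs'.of_frame hft rfl
      have e12 := (hL'.of_frame hft rfl).na12 k hk (cur i)
      have e27 : t.nv 27 = k := (hft.nv 27 rfl).trans hx
      have e13 : t.na 13 i = cur i := by rw [hft.na 13 rfl, hcur]
      have h1 := Rooting.mul_add_lt hk (cur i).isLt
      simp [hxt, hst.nv0, e27, e13, e12, hFin, hFin']
      omega
    rintro s₂ ⟨h14, hf₂⟩
    have hP₂ := hP'.of_frame hf₂ rfl
    refine WP.seq ((evalAll_spec hP₂ (by omega) hMW hnW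
      (by rw [hf₂.ra 6 rfl, hf.ra 6 rfl, hf₁.ra 6 rfl]; exact hdep)
      (by rw [hf₂.ra 7 rfl, hf.ra 7 rfl, hf₁.ra 7 rfl]; exact hg) h14).frame.mono le_rfl ?_)
    rintro s₃ ⟨h10, hf₃⟩
    have hP₃ := hP₂.of_frame hf₃ rfl
    have h13 : ∀ i : Fin n, s₃.na 13 i = cur i := by
      rw [hf₃.na 13 rfl, hf₂.na 13 rfl]; exact hcur
    have h14' : ∀ i : Fin n, s₃.na 14 i = (R.par^[2 ^ k] (cur i) : Fin N) := by
      rw [hf₃.na 14 rfl]; exact h14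
    set cur' : Fin n → Fin N := fun i =>
      if P.ed dep g i (dep (R.par^[2 ^ k] (cur i))) ≤ P.range then R.par^[2 ^ k] (cur i)
      else cur i with hcur'
    refine (WP.forUp (x := 20) (y := 1) (n := n) (T := 60) (fun m s =>
      ∀ i : Fin n, s.na 13 i = if (i : ℕ) < m then cur' i else cur i)
      rfl rfl (by decide) hP₃.nv1 (by omega) (fun _ _ _ h => h) (by simpa using h13) ?_).mono
      le_rfl ?_
    · intro m hm t hft hxt hyt h
      obtain ⟨i, rfl⟩ : ∃ i : Fin n, (i : ℕ) = m := ⟨⟨m, hm⟩, rfl⟩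
      have e10 : t.ra 10 i = P.ed dep g i (dep (R.par^[2 ^ k] (cur i))) := by
        rw [hft.ra 10 rfl, h10]
      have e14 : t.na 14 i = (R.par^[2 ^ k] (cur i) : Fin N) := by rw [hft.na 14 rfl, h14']
      have e0 : t.rv 0 = P.range := (hP₃.of_frame hft rfl).rv0
      refine WP.of_vc_le (by decide) ?_
      simp only [Cmd.vc, BExp.ok, BExp.val, NExp.ok, NExp.val, RExp.ok, RExp.val, hxt, e10, e14,
        e0, hFin, hFin', true_and, State.putN_na, if_true]
      refine ⟨fun hc l => ?_, fun hc l => ?_⟩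
      · have := h l
        by_cases hl : (l : ℕ) = i
        · obtain rfl := Fin.ext hl
          simp [hcur', if_pos hc]
        · rw [if_neg hl, this]
          simp [show (l : ℕ) < i + 1 ↔ (l : ℕ) < i by omega]
      · have := h l
        by_cases hl : (l : ℕ) = i
        · obtain rfl := Fin.ext hl
          simp [this, hcur', if_neg hc]
        · rw [this]
          simp [show (l : ℕ) < i + 1 ↔ (l : ℕ) < i by omega]
    · rintro t ⟨h, -⟩
      refine ⟨cur', fun i => by simpa using h i, fun i => ?_⟩
      simp only [hcur']
      split_ifs with hc
      · exact (hinv i).step_pos (hmono i) hc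
      · exact (hinv i).step_neg hc
  · rintro s ⟨⟨cur, hcur, hinv⟩, -⟩
    exact ⟨cur, hcur, fun i => (hinv i).final⟩

/-- The distance from the vertex `x` to the highest covering point on the edge above. -/
noncomputable def offset (P : Points N n M) (R : Rooting N) (plen dep : Fin N → ℝ)
    (g : Fin M → ℝ) (i : Fin n) (x : Fin N) : ℝ :=
  if x = R.root then 0 else (P.range - P.ed dep g i (dep x)) * plen x /
    (P.ed dep g i (dep (R.par x)) - P.ed dep g i (dep x))

/-- The offset is where the affine interpolation between the two ends of the edge above `cur i`
takes the value `P.range`. At the root there is no such edge, and the program stores `0`. -/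
theorem interpolate_spec {W : ℕ} {plen dep : Fin N → ℝ} {g : Fin M → ℝ} {cur : Fin n → Fin N}
    {s₀ : State} (hP : P.Held s₀) (hs : R.Stored q s₀)
    (hNW : N < W) (hMW : M + 1 < W) (hnW : n + 1 < W)
    (hplen : ∀ v : Fin N, s₀.ra 5 v = plen v)
    (hdep : ∀ v : Fin N, s₀.ra 6 v = dep v) (hg : ∀ j : Fin M, s₀.ra 7 j = g j)
    (h13 : ∀ i : Fin n, s₀.na 13 i = cur i)
    (hcov : ∀ i, P.ed dep g i (dep (cur i)) ≤ P.range)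
    (htop : ∀ i, cur i = R.root ∨ ¬ P.ed dep g i (dep (R.par (cur i))) ≤ P.range) :
    WP W interpolate (1000 * (n + M + 1)) s₀ fun s => ∀ i : Fin n,
      s.na 16 i = cur i ∧ s.na 17 i = R.par (cur i) ∧
      s.ra 13 i = P.offset R plen dep g i (cur i) ∧
      s.ra 12 i = dep (cur i) - P.offset R plen dep g i (cur i) := by
  have hFin : ∀ v : Fin N, (v : ℕ) < W := fun v => by omega
  have hFin' : ∀ v : Fin n, (v : ℕ) < W := fun v => by omega
  refine (WP.seq ((fill_spec (U := cur) hP.nv1 hnW (by decide) ?_).frame.mono le_rfl ?_)).mono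
    (T := (n * (60 + 9) + 8) + (300 * (n + M + 1) + ((n * (60 + 9) + 8) + ((n * (60 + 9) + 8) +
      (300 * (n + M + 1) + (n * (60 + 9) + 8)))))) (by omega) fun _ h => h
  · intro i s hf hx
    have e13 : s.na 13 i = cur i := by rw [hf.na 13 rfl, h13]
    simp [hx, e13, hFin, hFin']
  rintro s₁ ⟨h14, hf₁⟩
  have hP₁ := hP.of_frame hf₁ rfl
  have hs₁ := hs.of_frame hf₁ rfl
  refine WP.seq ((evalAll_spec hP₁ (by omega) hMW hnW (by rw [hf₁.ra 6 rfl]; exact hdep)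
    (by rw [hf₁.ra 7 rfl]; exact hg) h14).frame.mono le_rfl ?_)
  rintro s₂ ⟨h10, hf₂⟩
  have hP₂ := hP₁.of_frame hf₂ rfl
  have hs₂ := hs₁.of_frame hf₂ rfl
  have hcopy := WP.forUp (W := W) (x := 20) (y := 1) (n := n) (T := 60) (s₀ := s₂)
    (c := .putR 11 (.var 20) (.get 10 (.var 20)))
    (fun k s => ∀ i : Fin n, i < k → s.ra 11 i = P.ed dep g i (dep (cur i)))
    rfl rfl (by decide) hP₂.nv1 (by omega) (fun _ _ _ h => h) (by simp) (by
      intro k hk s hf hx hy h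
      obtain ⟨i, rfl⟩ : ∃ i : Fin n, (i : ℕ) = k := ⟨⟨k, hk⟩, rfl⟩
      have e10 : s.ra 10 i = P.ed dep g i (dep (cur i)) := by rw [hf.ra 10 rfl, h10]
      refine WP.of_vc_le (by decide) ?_
      simp only [Cmd.vc, NExp.ok, NExp.val, RExp.ok, RExp.val, hx, State.putR_ra, if_true, e10,
        hFin', true_and]
      intro v hv
      split_ifs with h1
      · rw [Fin.ext h1]
      · exact h v (by omega))
  refine WP.seq (hcopy.mono le_rfl ?_)
  rintro s₃ ⟨h11, hf₃⟩
  have hP₃ := hP₂.of_frame hf₃ rfl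
  have hs₃ := hs₂.of_frame hf₃ rfl
  have h13₃ : ∀ i : Fin n, s₃.na 13 i = cur i := by
    rw [hf₃.na 13 rfl, hf₂.na 13 rfl, hf₁.na 13 rfl]; exact h13
  refine WP.seq ((fill_spec (U := fun i => R.par (cur i)) hP₃.nv1 hnW (by decide)
    ?_).frame.mono le_rfl ?_)
  · intro i s hf hx
    have hs' := hs₃.of_frame hf rfl
    have e13 : s.na 13 i = cur i := by rw [hf.na 13 rfl, h13₃]
    simp [hx, e13, hs'.na6, hFin, hFin']
  rintro s₄ ⟨h14', hf₄⟩
  have hP₄ := hP₃.of_frame hf₄ rfl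
  have hs₄ := hs₃.of_frame hf₄ rfl
  have e6 : s₄.ra 6 = s₀.ra 6 := by
    rw [hf₄.ra 6 rfl, hf₃.ra 6 rfl, hf₂.ra 6 rfl, hf₁.ra 6 rfl]
  have e7 : s₄.ra 7 = s₀.ra 7 := by
    rw [hf₄.ra 7 rfl, hf₃.ra 7 rfl, hf₂.ra 7 rfl, hf₁.ra 7 rfl]
  have e5 : s₄.ra 5 = s₀.ra 5 := by
    rw [hf₄.ra 5 rfl, hf₃.ra 5 rfl, hf₂.ra 5 rfl, hf₁.ra 5 rfl]
  refine WP.seq ((evalAll_spec hP₄ (by omega) hMW hnW (by rw [e6]; exact hdep)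
    (by rw [e7]; exact hg) h14').frame.mono le_rfl ?_)
  rintro s₅ ⟨h10', hf₅⟩
  have hP₅ := hP₄.of_frame hf₅ rfl
  have hs₅ := hs₄.of_frame hf₅ rfl
  refine (WP.forUp (W := W) (x := 20) (y := 1) (n := n) (T := 60) (fun k s =>
    ∀ i : Fin n, i < k → s.na 16 i = cur i ∧ s.na 17 i = R.par (cur i) ∧
      s.ra 13 i = P.offset R plen dep g i (cur i) ∧
      s.ra 12 i = dep (cur i) - P.offset R plen dep g i (cur i))
    rfl rfl (by decide) hP₅.nv1 (by omega) (fun _ _ _ h => h) (by simp) ?_).mono le_rfl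
    fun s h i => h.1 i i.isLt
  intro k hk s hf hx hy h
  obtain ⟨i, rfl⟩ : ∃ i : Fin n, (i : ℕ) = k := ⟨⟨k, hk⟩, rfl⟩
  have hP' := hP₅.of_frame hf rfl
  have hs' := hs₅.of_frame hf rfl
  have a6 : ∀ v : Fin N, s.ra 6 v = dep v := by rw [hf.ra 6 rfl, hf₅.ra 6 rfl, e6]; exact hdep
  have a5 : ∀ v : Fin N, s.ra 5 v = plen v := by rw [hf.ra 5 rfl, hf₅.ra 5 rfl, e5]; exact hplen
  have a10 : s.ra 10 i = P.ed dep g i (dep (R.par (cur i))) := by rw [hf.ra 10 rfl, h10']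
  have a11 : s.ra 11 i = P.ed dep g i (dep (cur i)) := by
    rw [hf.ra 11 rfl, hf₅.ra 11 rfl, hf₄.ra 11 rfl, h11 i i.isLt]
  have a13 : s.na 13 i = cur i := by rw [hf.na 13 rfl, hf₅.na 13 rfl, hf₄.na 13 rfl, h13₃]
  refine WP.of_vc_le (by decide) ?_
  simp [hx, a13, a5, a6, a10, a11, hs'.nv3, hs'.na6, hP'.rv0, hFin, hFin', Fin.val_inj]
  have done : ∀ o, o = P.offset R plen dep g i (cur i) → ∀ l : Fin n, (l : ℕ) < i + 1 →
      (if l = i then ((cur i : Fin N) : ℕ) else s.na 16 l) = cur l ∧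
      (if l = i then ((R.par (cur i) : Fin N) : ℕ) else s.na 17 l) = R.par (cur l) ∧
      (if l = i then o else s.ra 13 l) = P.offset R plen dep g l (cur l) ∧
      (if l = i then dep (cur i) - o else s.ra 12 l) =
        dep (cur l) - P.offset R plen dep g l (cur l) := by
    rintro o rfl l hl
    by_cases hli : l = i
    · subst hli; simp
    · simp only [if_neg hli]
      have : (l : ℕ) ≠ i := fun h => hli (Fin.ext h)
      exact h l (by omega)
  refine ⟨fun h1 h2 l hl => ?_, fun h1 => ⟨?_, fun l hl => ?_⟩⟩
  · have hroot : cur i = R.root := le_antisymm h1 h2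
    simpa using done 0 (by simp [offset, hroot]) l (by have : (l : ℕ) ≤ i := hl; omega)
  -- The denominator does not vanish: `cur i` covers the uncertain point and its parent does not.
  · have hne : cur i ≠ R.root := fun e => (h1 e.le).ne e
    have h3 := hcov i
    have h4 := (htop i).resolve_left hne
    intro h5
    linarith
  · have hne : cur i ≠ R.root := fun e => (h1 e.le).ne e
    exact done _ (by simp [offset, hne]) l (by have : (l : ℕ) ≤ i := hl; omega)

end Points

end UncertainTree

/-! ## The segment tree: construction, queries, deletions -/

namespace UncertainTree

open RealRAM Finset

/-- Count the medians at each vertex. -/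
def countMedians : Cmd :=
  .forUp 20 0 (.putN 8 (.var 20) (.lit 0)) ;;
  .forUp 20 1 (.setN 21 (.get 4 (.var 20)) ;;
    .putN 8 (.var 21) (.add (.get 8 (.var 21)) (.lit 1)))

/-- Assign positions to the uncertain points, according to their medians. -/
def positions : Cmd :=
  .forUp 20 1 (.setN 21 (.get 4 (.var 20)) ;;
    .putN 8 (.var 21) (.sub (.get 8 (.var 21)) (.lit 1)) ;;
    .putN 18 (.var 20) (.add (.get 10 (.var 21)) (.get 8 (.var 21))))

/-- Recompute the node in register 21 of the segment tree from its children. -/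
def pull : Cmd :=
  .setN 22 (.get 15 (.add (.var 21) (.var 21))) ;;
  .setN 23 (.get 15 (.add (.add (.var 21) (.var 21)) (.lit 1))) ;;
  .ite (.rle (.get 12 (.var 22)) (.get 12 (.var 23))) (.putN 15 (.var 21) (.var 23))
    (.putN 15 (.var 21) (.var 22))

/-- Build the segment tree. The sentinel `n` stands for the root of the tree as a center. -/
def buildTree : Cmd :=
  .forUp 20 1 (.putN 15 (.add (.var 1) (.get 18 (.var 20))) (.var 20)) ;;
  (.putR 12 (.var 1) .zero ;; .putN 16 (.var 1) (.var 3) ;; .putN 17 (.var 1) (.var 3) ;;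
    .putR 13 (.var 1) .zero ;; .setN 4 (.var 1) ;; .setN 6 (.sub (.var 1) (.lit 1))) ;;
  .forDown 20 6 (.setN 21 (.add (.var 20) (.lit 1)) ;; pull)

/-- Deactivate the uncertain point in register 0. -/
def deleteCmd : Cmd :=
  (.setN 21 (.add (.var 4) (.get 18 (.var 0))) ;; .putN 15 (.var 21) (.var 4) ;;
    .setN 21 (.div (.var 21) (.lit 2))) ;;
  .loop (.nle (.lit 1) (.var 21)) (pull ;; .setN 21 (.div (.var 21) (.lit 2)))

/-- Register 22 gets the better one of the uncertain points in the registers 22 and 23. -/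
def pick : Cmd := .ite (.rle (.get 12 (.var 22)) (.get 12 (.var 23))) (.setN 22 (.var 23)) .nop

/-- The content of register `x` is odd. -/
def odd (x : ℕ) : BExp :=
  .nle (.lit 1) (.sub (.var x) (.mul (.lit 2) (.div (.var x) (.lit 2))))

/-- Answer the candidate-center-query at the vertex in register 0. -/
def queryCmd : Cmd :=
  (.setN 20 (.add (.var 4) (.get 10 (.var 0))) ;; .setN 21 (.add (.var 20) (.get 9 (.var 0))) ;;
    .setN 22 (.var 4)) ;;
  .loop (.neg (.nle (.var 21) (.var 20))) (
    .ite (odd 20) (.setN 23 (.get 15 (.var 20)) ;; .setN 20 (.add (.var 20) (.lit 1)) ;; pick)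
      .nop ;;
    .ite (odd 21) (.setN 21 (.sub (.var 21) (.lit 1)) ;; .setN 23 (.get 15 (.var 21)) ;; pick)
      .nop ;;
    (.setN 20 (.div (.var 20) (.lit 2)) ;; .setN 21 (.div (.var 21) (.lit 2)))) ;;
  .ite (.rle (.get 12 (.var 22)) (.get 6 (.var 0)))
    (.setN 1 (.get 16 (.var 22)) ;; .setN 2 (.get 17 (.var 22)) ;; .setR 0 (.get 13 (.var 22)) ;;
      .setN 0 (.lit 1))
    (.setN 0 (.lit 0))

namespace Points

variable {N n M : ℕ} {P : Points N n M} {R : Rooting N} {q : ℕ → Fin N}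

/-- The number of medians at a vertex. -/
def medCount (P : Points N n M) (v : Fin N) : ℕ := #{i | P.med i = v}

theorem sum_medCount (P : Points N n M) : ∑ v, P.medCount v = n := by
  have := card_eq_sum_card_fiberwise (f := P.med) (s := univ) (t := univ) (by simp)
  simpa [medCount] using this.symm

theorem countMedians_spec {W : ℕ} {s₀ : State} (hP : P.Held s₀) (hs : R.Stored q s₀)
    (hNW : N + 1 < W) (hnW : n + 1 < W) :
    WP W countMedians (200 * (N + n + 1)) s₀ fun s => ∀ v : Fin N, s.na 8 v = P.medCount v := by
  have hFin : ∀ v : Fin N, (v : ℕ) < W := fun v => by omega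
  have hFin' : ∀ v : Fin n, (v : ℕ) < W := fun v => by omega
  have hinit := WP.forUp (W := W) (x := 20) (y := 0) (n := N) (T := 60)
    (c := .putN 8 (.var 20) (.lit 0)) (fun k s => ∀ v : Fin N, v < k → s.na 8 v = 0)
    rfl rfl (by decide) hs.nv0 (by omega) (fun _ _ _ h => h) (by simp) (by
      intro k hk s hf hx hy h
      refine WP.of_vc_le (by decide) ?_
      simp only [Cmd.vc, NExp.ok, NExp.val, hx, State.putN_na, if_true]
      refine ⟨by omega, by omega, fun v hv => ?_⟩
      split_ifs with h1
      · rfl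
      · exact h v (by omega))
  refine (WP.seq (hinit.mono le_rfl ?_)).mono
    (T := (N * (60 + 9) + 8) + (n * (60 + 9) + 8)) (by omega) fun _ h => h
  rintro s₁ ⟨h₁, hf₁⟩
  have hP₁ := hP.of_frame hf₁ rfl
  refine (WP.forUp (W := W) (x := 20) (y := 1) (n := n) (T := 60)
    (fun k s => ∀ v : Fin N, s.na 8 v = #{i : Fin n | i.val < k ∧ P.med i = v})
    rfl rfl (by decide) hP₁.nv1 (by omega) (fun _ _ _ h => h) ?_ ?_).mono le_rfl ?_
  · intro v; simp [h₁ v v.isLt]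
  · intro k hk s hf hx hy h
    obtain ⟨i, rfl⟩ : ∃ i : Fin n, (i : ℕ) = k := ⟨⟨k, hk⟩, rfl⟩
    have hP' := hP₁.of_frame hf rfl
    have hle : ∀ v, #{i' : Fin n | i'.val < i.val ∧ P.med i' = v} ≤ n := fun v =>
      (card_le_univ _).trans (by simp)
    have hle1 := hle (P.med i)
    refine WP.of_vc_le (by decide) ?_
    simp only [Cmd.vc, NExp.ok, NExp.val, hx, hP'.na4, State.setN_nv, State.setN_na, State.putN_na,
      if_true, h, hFin]
    refine ⟨⟨by omega, trivial⟩, trivial, ⟨⟨trivial, by omega⟩, by omega, by omega⟩, fun v => ?_⟩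
    have hset : ∀ v, #{i' : Fin n | i'.val < i.val + 1 ∧ P.med i' = v} =
        #{i' : Fin n | i'.val < i.val ∧ P.med i' = v} + if v = P.med i then 1 else 0 := by
      intro v
      split_ifs with hv
      · rw [← card_insert_of_notMem (a := i) (by simp)]
        congr 1
        ext y
        simp only [mem_filter, mem_univ, true_and, mem_insert, Fin.ext_iff]
        grind
      · rw [add_zero]
        congr 1
        ext y
        simp only [mem_filter, mem_univ, true_and]
        grind
    rw [hset]
    by_cases hv : v = P.med i
    · simp [hv]
    · simp [hv, Fin.val_inj]
  · rintro s ⟨h, -⟩ v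
    simpa [medCount] using h v

/-- The position of an uncertain point in the segment tree. -/
def pos (P : Points N n M) (lo : Fin N → ℕ) (i : Fin n) : ℕ :=
  lo (P.med i) + #{i' : Fin n | i < i' ∧ P.med i' = P.med i}

theorem pos_lt (P : Points N n M) (lo : Fin N → ℕ) (i : Fin n) :
    P.pos lo i < lo (P.med i) + P.medCount (P.med i) := by
  refine Nat.add_lt_add_left (card_lt_card ?_) _
  rw [ssubset_iff_of_subset (fun y hy => by simp at hy ⊢; exact hy.2)]
  exact ⟨i, by simp, by simp⟩

/-- The points with medians in the subtree of `v` are contiguous in the order of the positions; this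
turns candidate-center-queries into range queries. -/
theorem anc_iff_pos {lo sz : Fin N → ℕ} (hI : R.Intervals P.medCount lo sz) (v : Fin N)
    (i : Fin n) : R.Anc v (P.med i) ↔ lo v ≤ P.pos lo i ∧ P.pos lo i < lo v + sz v :=
  hI.anc_iff (Nat.le_add_right _ _) (P.pos_lt lo i)

theorem pos_lt_n {lo sz : Fin N → ℕ} (hI : R.Intervals P.medCount lo sz) (i : Fin n) :
    P.pos lo i < n := by
  have h1 := P.pos_lt lo i
  have h2 := hI.hi_le (P.med i)
  have h3 := hI.own (P.med i)
  rw [sum_medCount] at h2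
  omega

/-- Of two points with the same position, the one median is an ancestor of the other. If the medians
differ, the second is below a child of the first, and the interval of this child begins after the
own elements of the first. If they agree, the counts of later points differ. -/
theorem pos_injective {lo sz : Fin N → ℕ} (hI : R.Intervals P.medCount lo sz) :
    Function.Injective (P.pos lo) := by
  have hmed : ∀ i j, P.pos lo i = P.pos lo j → R.Anc (P.med i) (P.med j) := fun i j h =>
    (anc_iff_pos hI _ _).2 (h ▸ (anc_iff_pos hI _ i).1 (Rooting.Anc.refl _))
  have hlt : ∀ i j, i < j → P.pos lo i = P.pos lo j → False := by
    intro i j hij h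
    have e : P.med i = P.med j := by
      have h1 := P.pos_lt lo i
      have h2 := P.pos_lt lo j
      have h3 : lo (P.med i) ≤ P.pos lo i := Nat.le_add_right _ _
      have h4 : lo (P.med j) ≤ P.pos lo j := Nat.le_add_right _ _
      by_contra hne
      by_cases ha : R.Anc (P.med i) (P.med j)
      · obtain ⟨y, hy, e, hyj⟩ := ha.exists_child hne
        have h5 := hI.child_lo y hy
        have h6 := (hI.of_anc hyj).1
        rw [e] at h5
        omega
      · exact ha (hmed i j h)
    unfold pos at h
    rw [e] at h
    refine absurd (Nat.add_left_cancel h) (ne_of_gt (card_lt_card ?_))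
    rw [ssubset_iff_of_subset (fun y hy => by
      simp at hy ⊢; exact ⟨hij.trans hy.1, hy.2⟩)]
    exact ⟨j, by simpa using hij, by simp⟩
  intro i j h
  rcases lt_trichotomy i j with hij | hij | hij
  · exact (hlt i j hij h).elim
  · exact hij
  · exact (hlt j i hij h.symm).elim

theorem exists_pos_eq {lo sz : Fin N → ℕ} (hI : R.Intervals P.medCount lo sz) {k : ℕ} (hk : k < n) :
    ∃ i, P.pos lo i = k := by
  have hinj : Function.Injective fun i : Fin n => (⟨P.pos lo i, pos_lt_n hI i⟩ : Fin n) := by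
    intro i j h
    exact pos_injective hI (Fin.ext_iff.1 h)
  obtain ⟨i, hi⟩ := (Finite.injective_iff_surjective.1 hinj) ⟨k, hk⟩
  exact ⟨i, Fin.ext_iff.1 hi⟩

/-- The counters of the medians are counted down, so the offset of a point in the own part of its
median is the number of later points with this median, as in `pos`. -/
theorem positions_spec {W : ℕ} {lo sz : Fin N → ℕ} {s₀ : State} (hP : P.Held s₀)
    (hNW : N + 1 < W) (hnW : n + 1 < W) (hI : R.Intervals P.medCount lo sz)
    (h8 : ∀ v : Fin N, s₀.na 8 v = P.medCount v) (hlo : ∀ v : Fin N, s₀.na 10 v = lo v) :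
    WP W positions (100 * (n + 1)) s₀ fun s => ∀ i : Fin n, s.na 18 i = P.pos lo i := by
  have hFin : ∀ v : Fin N, (v : ℕ) < W := fun v => by omega
  have hFin' : ∀ v : Fin n, (v : ℕ) < W := fun v => by omega
  refine (WP.forUp (W := W) (x := 20) (y := 1) (n := n) (T := 60) (fun k s =>
    (∀ v : Fin N, s.na 8 v = #{i : Fin n | k ≤ i.val ∧ P.med i = v}) ∧
      ∀ i : Fin n, i < k → s.na 18 i = P.pos lo i)
    rfl rfl (by decide) hP.nv1 (by omega) (fun _ _ _ h => h) ?_ ?_).mono (by omega) ?_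
  · exact ⟨fun v => by simpa [medCount] using h8 v, by simp⟩
  · rintro k hk s hf hx hy ⟨h1, h2⟩
    obtain ⟨i, rfl⟩ : ∃ i : Fin n, (i : ℕ) = k := ⟨⟨k, hk⟩, rfl⟩
    have hP' := hP.of_frame hf rfl
    have e10 : ∀ v : Fin N, s.na 10 v = lo v := by rw [hf.na 10 rfl]; exact hlo
    have hset : ∀ v, #{i' : Fin n | i.val ≤ i'.val ∧ P.med i' = v} =
        #{i' : Fin n | i.val + 1 ≤ i'.val ∧ P.med i' = v} + if v = P.med i then 1 else 0 := by
      intro v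
      split_ifs with hv
      · rw [← card_insert_of_notMem (a := i) (by simp)]
        congr 1
        ext y
        simp only [mem_filter, mem_univ, true_and, mem_insert, Fin.ext_iff]
        grind
      · rw [add_zero]
        congr 1
        ext y
        simp only [mem_filter, mem_univ, true_and]
        grind
    have hpos : lo (P.med i) + (#{i' : Fin n | i.val ≤ i'.val ∧ P.med i' = P.med i} - 1) =
        P.pos lo i := by
      rw [hset, if_pos rfl, Nat.add_sub_cancel]
      rfl
    have hpn := pos_lt_n hI i
    refine WP.of_vc_le (by decide) ?_
    have e10_8 : (10 : ℕ) ≠ 8 := by decide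
    have e18_8 : (18 : ℕ) ≠ 8 := by decide
    have e8_18 : (8 : ℕ) ≠ 18 := by decide
    have e20_21 : (20 : ℕ) ≠ 21 := by decide
    have hcle : #{i' : Fin n | i.val ≤ i'.val ∧ P.med i' = P.med i} ≤ n :=
      (card_le_univ _).trans (by simp)
    simp only [Cmd.vc, NExp.ok, NExp.val, hx, hP'.na4, State.setN_nv, State.setN_na, State.putN_na,
      State.putN_nv, if_true, h1, hFin, e10, hpos, if_neg e10_8, if_neg e18_8, if_neg e8_18,
      if_neg e20_21]
    refine ⟨⟨by omega, trivial⟩, trivial, ⟨⟨trivial, by omega⟩, by omega⟩, by omega,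
      ⟨⟨trivial, by omega⟩, ⟨trivial, by omega⟩, by omega⟩, fun v => ?_, fun l hl => ?_⟩
    · have h3 := hset v
      by_cases hv : v = P.med i
      · subst hv; simp only [if_true] at h3 ⊢; omega
      · rw [if_neg hv] at h3
        rw [if_neg (fun h => hv (Fin.ext h))]; omega
    · split_ifs with h5
      · rw [Fin.ext h5]
      · exact h2 l (by omega)
  · rintro s ⟨⟨-, h⟩, -⟩ i
    exact h i i.isLt

end Points

end UncertainTree

/-! ### Operations on the segment tree -/

namespace UncertainTree

open RealRAM Finset

/-- The better one of two entries of the segment tree. -/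
noncomputable def better (key : ℕ → ℝ) (a b : ℕ) : ℕ := if key a ≤ key b then b else a

theorem le_better_left (key : ℕ → ℝ) (a b : ℕ) : key a ≤ key (better key a b) := by
  unfold better; split_ifs with h
  · exact h
  · exact le_rfl

theorem le_better_right (key : ℕ → ℝ) (a b : ℕ) : key b ≤ key (better key a b) := by
  unfold better; split_ifs with h
  · exact le_rfl
  · exact (not_le.1 h).le

theorem better_eq (key : ℕ → ℝ) (a b : ℕ) : better key a b = a ∨ better key a b = b := by
  unfold better; split_ifs
  · exact .inr rfl
  · exact .inl rfl

/-- Node `x` of the segment tree agrees with its children. -/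
def NodeOk (key : ℕ → ℝ) (T : ℕ → ℕ) (x : ℕ) : Prop := T x = better key (T (x + x)) (T (x + x + 1))

/-- The segment tree for `n` leaves, where `D` is the set of deactivated points, and all inner
nodes with the possible exception of those in `E` agree with their children. -/
structure TreeInv {n : ℕ} (pos : Fin n → ℕ) (key : ℕ → ℝ) (D : Set (Fin n)) (E : Set ℕ)
    (T : ℕ → ℕ) : Prop where
  leaf : ∀ i, (i ∈ D → T (n + pos i) = n) ∧ (i ∉ D → T (n + pos i) = i)
  node : ∀ x, 1 ≤ x → x < n → x ∉ E → NodeOk key T x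
  le : ∀ x, 1 ≤ x → x < n + n → x ∉ E → T x ≤ n

/-- Recomputing `x` repairs `x` and can spoil only its parent `x / 2`; `hE` says that `E'` takes
account of both. -/
theorem TreeInv.pull {n : ℕ} {pos : Fin n → ℕ} {key : ℕ → ℝ} {D : Set (Fin n)} {E E' : Set ℕ}
    {T T' : ℕ → ℕ} (H : TreeInv pos key D E T) {x : ℕ} (hx : 1 ≤ x) (hxn : x < n)
    (h1 : x + x ∉ E) (h2 : x + x + 1 ∉ E)
    (hT : ∀ y, T' y = if y = x then better key (T (x + x)) (T (x + x + 1)) else T y)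
    (hE : ∀ y, 1 ≤ y → y ∉ E' → y = x ∨ (y ∉ E ∧ y ≠ x / 2)) :
    TreeInv pos key D E' T' := by
  refine ⟨fun i => ?_, fun y hy hyn hyE => ?_, fun y hy hyn hyE => ?_⟩
  · rw [hT, if_neg (by omega)]; exact H.leaf i
  · unfold NodeOk
    rcases hE y hy hyE with rfl | ⟨h3, h4⟩
    · rw [hT, hT, hT, if_pos rfl, if_neg (by omega), if_neg (by omega)]
    · by_cases hyx : y = x
      · subst hyx
        rw [hT, hT, hT, if_pos rfl, if_neg (by omega), if_neg (by omega)]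
      · rw [hT, hT, hT, if_neg hyx, if_neg (by omega), if_neg (by omega)]
        exact H.node y hy hyn h3
  · rw [hT]
    split_ifs with h3
    · have h4 := H.le (x + x) (by omega) (by omega) h1
      have h5 := H.le (x + x + 1) (by omega) (by omega) h2
      rcases better_eq key (T (x + x)) (T (x + x + 1)) with h | h <;> rw [h] <;> assumption
    · rcases hE y hy hyE with h | ⟨h, -⟩
      · exact absurd h h3
      · exact H.le y hy hyn h

/-- The state holds the data structure. -/
structure Ready {n : ℕ} (pos : Fin n → ℕ) (key : ℕ → ℝ) (D : Set (Fin n)) (s : State) : Prop where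
  nv4 : s.nv 4 = n
  na18 : ∀ i : Fin n, s.na 18 i = pos i
  ra12 : ∀ j ≤ n, s.ra 12 j = key j
  tree : TreeInv pos key D ∅ (s.na 15)

theorem Ready.of_frame {n : ℕ} {pos : Fin n → ℕ} {key : ℕ → ℝ} {D : Set (Fin n)}
    {c : Cmd} {s s' : State} (h : Ready pos key D s) (hf : Frame c s s')
    (hc : (c.writesNv 4 || c.writesNa 18 || c.writesRa 12 || c.writesNa 15) = false) :
    Ready pos key D s' := by
  simp only [Bool.or_eq_false_iff] at hc
  obtain ⟨⟨⟨c1, c2⟩, c3⟩, c4⟩ := hc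
  exact ⟨(hf.nv 4 c1).trans h.nv4, by rw [hf.na 18 c2]; exact h.na18,
    by rw [hf.ra 12 c3]; exact h.ra12, by rw [hf.na 15 c4]; exact h.tree⟩

theorem pull_spec {W n : ℕ} {key : ℕ → ℝ} {s : State} {x : ℕ} {Q : State → Prop}
    (hW : 3 * n + 3 < W) (h21 : s.nv 21 = x) (hx : x < n)
    (hkey : ∀ j ≤ n, s.ra 12 j = key j) (h1 : s.na 15 (x + x) ≤ n)
    (h2 : s.na 15 (x + x + 1) ≤ n)
    (hQ : ∀ s', Frame pull s s' → (∀ y, s'.na 15 y =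
      if y = x then better key (s.na 15 (x + x)) (s.na 15 (x + x + 1)) else s.na 15 y) → Q s') :
    WP W pull 60 s Q := by
  have hvc : pull.vc W (fun s' => ∀ y, s'.na 15 y =
      if y = x then better key (s.na 15 (x + x)) (s.na 15 (x + x + 1)) else s.na 15 y) s := by
    simp [pull, h21, hkey _ h1, hkey _ h2]
    refine ⟨by omega, by omega, by omega, fun h => ⟨by omega, by omega, fun y => ?_⟩,
      fun h => ⟨by omega, by omega, fun y => ?_⟩⟩
    · simp [better, h]
    · simp [better, not_le.2 h]
  exact (WP.of_vc_le (by decide) hvc).frame.mono le_rfl fun s' h => hQ s' h.2 h.1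

/-- The sentinel `n` is put into the leaf, and only the nodes above this leaf have to be recomputed,
from the bottom to the top. Halving the node number bounds the number of rounds. -/
theorem delete_spec {W n : ℕ} {pos : Fin n → ℕ} {key : ℕ → ℝ} {D : Set (Fin n)} {s₀ : State}
    {i : Fin n} (hpos : ∀ i, pos i < n) (hinj : Function.Injective pos) (hW : 3 * n + 3 < W)
    (h : Ready pos key D s₀) (h0 : s₀.nv 0 = i) :
    WP W deleteCmd (200 * (Nat.log 2 n + 1)) s₀ fun s => Ready pos key (insert i D) s := by
  have hpi := hpos i
  have hvc : (Cmd.setN 21 (.add (.var 4) (.get 18 (.var 0))) ;; Cmd.putN 15 (.var 21) (.var 4) ;;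
      Cmd.setN 21 (.div (.var 21) (.lit 2))).vc W (fun s => s.nv 4 = n ∧
        s.nv 21 = (n + pos i) / 2 ∧ (∀ i : Fin n, s.na 18 i = pos i) ∧
        (∀ j ≤ n, s.ra 12 j = key j) ∧
        ∀ y, s.na 15 y = if y = n + pos i then n else s₀.na 15 y) s₀ := by
    simp [h0, h.nv4, h.na18]
    exact ⟨by omega, by omega, by omega, by omega, h.ra12⟩
  refine (WP.seq (T₁ := 40) ((WP.of_vc_le (by decide) hvc).mono le_rfl ?_)).mono
    (T := 40 + ((Nat.log 2 n + 1) * (3 + 1 + (60 + 10)) + (3 + 1))) (by omega) fun _ h => h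
  rintro s₁ ⟨h4, h21, h18, h12, h15⟩
  -- The current node `x` is the only one that may be wrong. When `x` becomes `0`, the set of
  -- exceptions is empty and the tree is correct.
  refine WP.loop (fun k s => s.nv 4 = n ∧ (∀ i : Fin n, s.na 18 i = pos i) ∧
    (∀ j ≤ n, s.ra 12 j = key j) ∧ ∃ x, s.nv 21 = x ∧ x < n ∧ x < 2 ^ k ∧
      TreeInv pos key (insert i D) {y | y = x ∧ 1 ≤ x} (s.na 15)) ?_ ?_ ?_ ?_
  · rintro k s ⟨h4, h18, h12, x, h21, hxn, hxk, H⟩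
    simp only [BExp.ok, NExp.ok, h21]; omega
  · rintro k s ⟨h4, h18, h12, x, h21, hxn, hxk, H⟩ hb
    simp only [BExp.val, NExp.val, h21] at hb
    refine ⟨h4, h18, h12, ?_⟩
    convert H using 1
    ext y
    simp only [Set.mem_empty_iff_false, Set.mem_ofPred_eq, false_iff]
    omega
  · rintro k s ⟨h4, h18, h12, x, h21, hxn, hxk, H⟩ hb
    simp only [BExp.val, NExp.val, h21] at hb
    obtain ⟨k', rfl⟩ : ∃ k', k = k' + 1 := ⟨k - 1, by
      rcases k with _ | k
      · simp at hxk; omega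
      · rfl⟩
    refine ⟨k', rfl, WP.seq (pull_spec hW h21 hxn h12 (H.le _ (by omega) (by omega)
      (by simp)) (H.le _ (by omega) (by omega) (by simp; omega)) ?_)⟩
    rintro s' hf hT
    refine WP.of_vc_le (by decide) ?_
    have e21 : s'.nv 21 = x := (hf.nv 21 rfl).trans h21
    simp only [Cmd.vc, NExp.ok, NExp.val, e21]
    refine ⟨by omega, by simpa using (hf.nv 4 rfl).trans h4, by
      rw [State.setN_na, hf.na 18 rfl]; exact h18, by
      rw [State.setN_ra, hf.ra 12 rfl]; exact h12, x / 2, by simp, by omega, ?_, ?_⟩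
    · rw [pow_succ] at hxk; omega
    · refine H.pull hb hxn (by simp) (by simp; omega) hT ?_
      intro y hy1 hy
      simp only [Set.mem_ofPred_eq] at hy ⊢
      by_cases hyx : y = x
      · exact .inl hyx
      · exact .inr ⟨fun h => hyx h.1, fun h => hy ⟨h, by omega⟩⟩
  · refine ⟨h4, h18, h12, _, h21, by omega, ?_, ?_⟩
    · have := Nat.lt_pow_succ_log_self (b := 2) (by decide) n
      omega
    · refine ⟨fun l => ?_, fun y hy hyn hyE => ?_, fun y hy hyn hyE => ?_⟩
      · rw [h15]
        by_cases hl : l = i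
        · subst hl; simp
        · have hne : pos l ≠ pos i := fun e => hl (hinj e)
          rw [if_neg (by omega)]
          simpa [hl] using h.tree.leaf l
      · simp only [Set.mem_ofPred_eq, not_and] at hyE
        unfold NodeOk
        rw [h15, h15, h15, if_neg (by omega), if_neg (by omega), if_neg (by omega)]
        exact h.tree.node y hy hyn (by simp)
      · rw [h15]
        split_ifs
        · exact le_rfl
        · exact h.tree.le y hy hyn (by simp)

/-- The loop invariant of a query for the points in `A`: the answer is `res` or one of the nodes
in `[l, r)`. -/
structure FoldInv (n : ℕ) (key : ℕ → ℝ) (A : Set ℕ) (T : ℕ → ℕ) (l r res : ℕ) : Prop where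
  best : ∀ i ∈ A, key i ≤ key res ∨ ∃ x, l ≤ x ∧ x < r ∧ key i ≤ key (T x)
  mem : res = n ∨ res ∈ A
  node_mem : ∀ x, l ≤ x → x < r → T x = n ∨ T x ∈ A

theorem FoldInv.left {n : ℕ} {key : ℕ → ℝ} {A : Set ℕ} {T : ℕ → ℕ} {l r res : ℕ}
    (H : FoldInv n key A T l r res) (hlr : l < r) :
    FoldInv n key A T (l + 1) r (better key res (T l)) := by
  refine ⟨fun i hi => ?_, ?_, fun x h1 h2 => H.node_mem x (by omega) h2⟩
  · rcases H.best i hi with h | ⟨x, h1, h2, h3⟩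
    · exact .inl (h.trans (le_better_left _ _ _))
    · by_cases hx : x = l
      · subst hx; exact .inl (h3.trans (le_better_right _ _ _))
      · exact .inr ⟨x, by omega, h2, h3⟩
  · rcases better_eq key res (T l) with h | h <;> rw [h]
    · exact H.mem
    · exact H.node_mem l le_rfl hlr

theorem FoldInv.right {n : ℕ} {key : ℕ → ℝ} {A : Set ℕ} {T : ℕ → ℕ} {l r res : ℕ}
    (H : FoldInv n key A T l (r + 1) res) (hlr : l ≤ r) :
    FoldInv n key A T l r (better key res (T r)) := by
  refine ⟨fun i hi => ?_, ?_, fun x h1 h2 => H.node_mem x h1 (by omega)⟩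
  · rcases H.best i hi with h | ⟨x, h1, h2, h3⟩
    · exact .inl (h.trans (le_better_left _ _ _))
    · by_cases hx : x = r
      · subst hx; exact .inl (h3.trans (le_better_right _ _ _))
      · exact .inr ⟨x, h1, by omega, h3⟩
  · rcases better_eq key res (T r) with h | h <;> rw [h]
    · exact H.mem
    · exact H.node_mem r hlr (by omega)

/-- When both bounds are even, the nodes in the range form pairs of siblings, so their parents carry
the same maxima and no foreign entries. -/
theorem FoldInv.halve {n : ℕ} {key : ℕ → ℝ} {A : Set ℕ} {T : ℕ → ℕ} {l r res : ℕ}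
    (H : FoldInv n key A T (l + l) (r + r) res) (hT : ∀ x, l ≤ x → x < r → NodeOk key T x) :
    FoldInv n key A T l r res := by
  refine ⟨fun i hi => ?_, H.mem, fun x h1 h2 => ?_⟩
  · rcases H.best i hi with h | ⟨x, h1, h2, h3⟩
    · exact .inl h
    · refine .inr ⟨x / 2, by omega, by omega, h3.trans ?_⟩
      rw [hT (x / 2) (by omega) (by omega)]
      rcases Nat.even_or_odd' x with ⟨y, rfl | rfl⟩
      · rw [show 2 * y / 2 + 2 * y / 2 = 2 * y by omega]; exact le_better_left _ _ _
      · rw [show (2 * y + 1) / 2 + (2 * y + 1) / 2 + 1 = 2 * y + 1 by omega]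
        exact le_better_right _ _ _
  · rw [hT x h1 h2]
    rcases better_eq key (T (x + x)) (T (x + x + 1)) with h | h <;> rw [h]
    · exact H.node_mem _ (by omega) (by omega)
    · exact H.node_mem _ (by omega) (by omega)

theorem pick_vc {W a b : ℕ} {key : ℕ → ℝ} {s : State} {Q : State → Prop} (ha : s.nv 22 = a)
    (hb : s.nv 23 = b) (hWa : a < W) (hWb : b < W) (hka : s.ra 12 a = key a)
    (hkb : s.ra 12 b = key b) (hQ : Q (s.setN 22 (better key a b)) ∧
      (better key a b = a → Q s)) : pick.vc W Q s := by
  simp [pick, ha, hb, hWa, hWb, hka, hkb]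
  refine ⟨fun h => ?_, fun h => ?_⟩
  · simpa [better, h] using hQ.1
  · exact hQ.2 (by simp [better, not_le.2 h])

/-- Starting from the leaves, the range moves up one level per round. An odd left bound is a right
child, and an odd right bound ends just after a left child; such a node is evaluated separately,
because its parent would reach beyond the range. Starting with the sentinel makes `n` the result for
a range without active points. -/
theorem query_spec {W n : ℕ} {pos : Fin n → ℕ} {key : ℕ → ℝ} {D : Set (Fin n)} {s₀ : State}
    {v lo sz : ℕ} (hpos : ∀ k < n, ∃ i, pos i = k) (hn : 1 ≤ n) (hW : 3 * n + 3 < W)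
    (h : Ready pos key D s₀) (h0 : s₀.nv 0 = v) (hv : v < W) (hlo : s₀.na 10 v = lo)
    (hsz : s₀.na 9 v = sz) (hls : lo + sz ≤ n) (h16 : ∀ j ≤ n, s₀.na 16 j < W)
    (h17 : ∀ j ≤ n, s₀.na 17 j < W) :
    WP W queryCmd (400 * (Nat.log 2 n + 1)) s₀ fun s => ∃ res ≤ n,
      (res = n ∨ ∃ i ∉ D, (i : ℕ) = res ∧ lo ≤ pos i ∧ pos i < lo + sz) ∧
      (∀ i ∉ D, lo ≤ pos i → pos i < lo + sz → key i ≤ key res) ∧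
      (key res ≤ s₀.ra 6 v → s.nv 0 = 1 ∧ s.nv 1 = s₀.na 16 res ∧ s.nv 2 = s₀.na 17 res ∧
        s.rv 0 = s₀.ra 13 res) ∧ (¬ key res ≤ s₀.ra 6 v → s.nv 0 = 0) := by
  set A : Set ℕ := {j | ∃ i ∉ D, (i : ℕ) = j ∧ lo ≤ pos i ∧ pos i < lo + sz} with hA
  set T := s₀.na 15 with hT
  have hAn : ∀ a, a = n ∨ a ∈ A → a ≤ n := by
    rintro a (rfl | ⟨i, -, rfl, -⟩)
    · exact le_rfl
    · exact i.isLt.le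
  -- the state keeps its arrays, and the registers describe the current nodes
  let Mid (l r res : ℕ) (s : State) : Prop :=
    s.na = s₀.na ∧ s.ra = s₀.ra ∧ s.nv 0 = v ∧ s.nv 20 = l ∧ s.nv 21 = r ∧ s.nv 22 = res
  have hinit : (Cmd.setN 20 (.add (.var 4) (.get 10 (.var 0))) ;;
      Cmd.setN 21 (.add (.var 20) (.get 9 (.var 0))) ;; Cmd.setN 22 (.var 4)).vc W
      (Mid (n + lo) (n + lo + sz) n) s₀ := by
    simp [Mid, h0, hlo, hsz, h.nv4]
    omega
  -- The positions exhaust the numbers below `n`, so each leaf in the range holds an active point of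
  -- `A` or the sentinel.
  have hF : FoldInv n key A T (n + lo) (n + lo + sz) n := by
    refine ⟨?_, .inl rfl, fun x h1 h2 => ?_⟩
    · rintro _ ⟨i, hi, rfl, h1, h2⟩
      exact .inr ⟨n + pos i, by omega, by omega, by rw [hT, (h.tree.leaf i).2 hi]⟩
    · obtain ⟨i, hi⟩ := hpos (x - n) (by omega)
      obtain rfl : x = n + pos i := by omega
      by_cases hD : i ∈ D
      · exact .inl ((h.tree.leaf i).1 hD)
      · exact .inr ⟨i, hD, ((h.tree.leaf i).2 hD).symm, by omega, by omega⟩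
  have hodd : ∀ (s : State) (x : ℕ), s.nv x < W → (odd x).ok W s ∧
      ((odd x).val s ↔ s.nv x % 2 = 1) := by
    intro s x hx
    simp only [odd, BExp.ok, NExp.ok, BExp.val, NExp.val]
    omega
  have hkey : ∀ (s : State) (a : ℕ), s.ra = s₀.ra → a = n ∨ a ∈ A → s.ra 12 a = key a := fun s a hs ha => by
    rw [hs]; exact h.ra12 a (hAn a ha)
  -- Initially the right bound is at most `n + n < 2 ^ (Nat.log 2 n + 2)`, and every round at least
  -- halves it.
  refine (WP.seq (T₁ := 40) (T₂ := (Nat.log 2 n + 2) * (4 + 1 + 150) + (4 + 1) + 40)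
    ((WP.of_vc_le (by decide) hinit).mono le_rfl ?_)).mono (by omega) fun _ h => h
  intro s₁ hs₁
  refine WP.seq (WP.loop (b := .neg (.nle (.var 21) (.var 20))) (fun k s => ∃ l r res,
    Mid l r res s ∧ 1 ≤ l ∧ l ≤ r ∧ r ≤ n + n ∧ r < 2 ^ k ∧ FoldInv n key A T l r res)
    (Q := fun s => ∃ l res, Mid l l res s ∧ FoldInv n key A T l l res) ?_ ?_ ?_ ?_ |>.mono le_rfl ?_)
  · rintro k s ⟨l, r, res, ⟨-, -, -, e20, e21, -⟩, h1, h2, h3, -⟩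
    simp only [BExp.ok, NExp.ok, e20, e21]; omega
  · rintro k s ⟨l, r, res, hM, h1, h2, h3, h4, H⟩ hb
    simp only [BExp.val, NExp.val, hM.2.2.2.1, hM.2.2.2.2.1, not_not] at hb
    obtain rfl : r = l := le_antisymm hb h2
    exact ⟨r, res, hM, H⟩
  · rintro k s ⟨l, r, res, hM, h1, h2, h3, h4, H⟩ hb
    obtain ⟨ena, era, e0, e20, e21, e22⟩ := hM
    simp only [BExp.val, NExp.val, e20, e21, not_le] at hb
    obtain ⟨k', rfl⟩ : ∃ k', k = k' + 1 := ⟨k - 1, by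
      rcases k with _ | k
      · simp at h4; omega
      · rfl⟩
    rw [pow_succ] at h4
    refine ⟨k', rfl, ?_⟩
    refine WP.seq (T₁ := 50) (T₂ := 100) ((WP.of_vc_le (by decide) (Q := fun s =>
      ∃ l res, Mid (l + l) r res s ∧ 1 ≤ l ∧ l + l ≤ r ∧ FoldInv n key A T (l + l) r res) ?_).mono
      le_rfl ?_)
    · have ho := hodd s 20 (by omega)
      have hm := H.node_mem l le_rfl hb
      have h5 := hAn _ hm
      have h6 := hAn _ H.mem
      simp only [Cmd.vc, ho, true_and, e20]
      refine ⟨fun hl => ?_, fun hl => ?_⟩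
      · have H' := H.left hb
        obtain ⟨l', hl'⟩ : ∃ l', l + 1 = l' + l' := ⟨(l + 1) / 2, by omega⟩
        simp only [NExp.ok, NExp.val, State.setN_nv, e20, ena, ← hT]
        refine ⟨⟨by omega, by omega⟩, by simp; omega, pick_vc (key := key) (a := res) (b := T l)
          (by simpa using e22) (by simp) (by omega) (by omega) (by simpa using hkey s _ era H.mem)
          (by simpa using hkey s _ era hm) ⟨?_, fun he => ?_⟩⟩
        · refine ⟨l', _, ?_, by omega, by omega, hl' ▸ H'⟩
          simp [Mid, ena, era, e0, e21, hl']
        · refine ⟨l', _, ?_, by omega, by omega, hl' ▸ H'⟩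
          simp [Mid, ena, era, e0, e21, e22, hl', he]
      · obtain ⟨l', rfl⟩ : ∃ l', l = l' + l' := ⟨l / 2, by omega⟩
        exact ⟨l', res, ⟨ena, era, e0, e20, e21, e22⟩, by omega, by omega, H⟩
    · rintro s ⟨l, res, ⟨ena, era, e0, e20, e21, e22⟩, h1, h2, H⟩
      refine WP.seq (T₁ := 50) (T₂ := 50) ((WP.of_vc_le (by decide) (Q := fun s =>
        ∃ r' res, Mid (l + l) (r' + r') res s ∧ l + l ≤ r' + r' ∧ r' + r' ≤ r ∧
          FoldInv n key A T (l + l) (r' + r') res) ?_).mono le_rfl ?_)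
      · have ho := hodd s 21 (by omega)
        have h6 := hAn _ H.mem
        simp only [Cmd.vc, ho, true_and, e21]
        refine ⟨fun hr => ?_, fun hr => ?_⟩
        · obtain ⟨r', rfl⟩ : ∃ r', r = r' + r' + 1 := ⟨r / 2, by omega⟩
          have hm := H.node_mem (r' + r') (by omega) (by omega)
          have h5 := hAn _ hm
          have H' := H.right (by omega)
          simp only [NExp.ok, NExp.val, State.setN_nv, State.setN_na, e21, ena, if_true, ← hT,
            Nat.add_sub_cancel]
          refine ⟨by omega, by omega,
            pick_vc (key := key) (a := res) (b := T (r' + r'))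
            (by simpa using e22) (by simp) (by omega) (by omega) (by simpa using hkey s _ era H.mem)
            (by simpa using hkey s _ era hm) ⟨?_, fun he => ?_⟩⟩
          · refine ⟨r', _, ?_, by omega, by omega, H'⟩
            simp [Mid, ena, era, e0, e20]
          · refine ⟨r', _, ?_, by omega, by omega, H'⟩
            simp [Mid, ena, era, e0, e20, e22, he]
        · obtain ⟨r', rfl⟩ : ∃ r', r = r' + r' := ⟨r / 2, by omega⟩
          exact ⟨r', res, ⟨ena, era, e0, e20, e21, e22⟩, by omega, by omega, H⟩
      · rintro s ⟨r', res, ⟨ena, era, e0, e20, e21, e22⟩, h5, h6, H⟩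
        refine WP.of_vc_le (by decide) ?_
        simp only [Cmd.vc, NExp.ok, NExp.val, State.setN_nv, e20, e21]
        refine ⟨by omega, by simp; omega, l, r', res, ?_, h1, by omega, by omega, by omega,
          H.halve fun x hx hx' => h.tree.node x (by omega) (by omega) (by simp)⟩
        simp [Mid, ena, era, e0, e22, ← two_mul]
  · refine ⟨_, _, _, hs₁, by omega, by omega, by omega, ?_, hF⟩
    have := Nat.lt_pow_succ_log_self (b := 2) (by decide) n
    rw [pow_succ]
    change n + lo + sz < 2 ^ (Nat.log 2 n + 1) * 2
    omega
  · rintro s ⟨l, res, ⟨ena, era, e0, e20, e21, e22⟩, H⟩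
    have h5 := hAn _ H.mem
    have h12 := hkey s res era H.mem
    refine (WP.of_vc_le (by decide) (Q := fun s =>
      (key res ≤ s₀.ra 6 v → s.nv 0 = 1 ∧ s.nv 1 = s₀.na 16 res ∧ s.nv 2 = s₀.na 17 res ∧
        s.rv 0 = s₀.ra 13 res) ∧ (¬ key res ≤ s₀.ra 6 v → s.nv 0 = 0)) ?_).mono le_rfl ?_
    · have e6 : s.ra 6 v = s₀.ra 6 v := by rw [era]
      simp only [Cmd.vc, BExp.ok, BExp.val, RExp.ok, RExp.val, NExp.ok, NExp.val, e22, e0, h12, e6]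
      refine ⟨by omega, fun hle => ?_, fun hle => ?_⟩
      · have := h16 res h5
        have := h17 res h5
        simp [e22, ena, era, hle]
        omega
      · simp [hle]
        omega
    · rintro s hs
      refine ⟨res, h5, H.mem, fun i hi h1 h2 => ?_, hs⟩
      rcases H.best i ⟨i, hi, rfl, h1, h2⟩ with h | ⟨x, h1, h2, -⟩
      · exact h
      · omega

/-- The sentinel `n` gets the key `0` and the root as its center. Register 4 keeps a copy of `n`,
because the answers to queries overwrite register 1. -/
theorem buildTree_spec {W N n M : ℕ} {P : Points N n M} {root : ℕ} {pos : Fin n → ℕ}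
    {key : ℕ → ℝ} {s₀ : State} (hP : P.Held s₀) (h3 : s₀.nv 3 = root) (hr : root < W)
    (hpos : ∀ i, pos i < n) (hinj : Function.Injective pos) (hsurj : ∀ k < n, ∃ i, pos i = k)
    (hn : 1 ≤ n) (hW : 3 * n + 3 < W) (h18 : ∀ i : Fin n, s₀.na 18 i = pos i)
    (h12 : ∀ i : Fin n, s₀.ra 12 i = key i) (hkey : key n = 0) :
    WP W buildTree (300 * (n + 1)) s₀ fun s => Ready pos key ∅ s ∧ s.na 16 n = root ∧
      s.na 17 n = root ∧ s.ra 13 n = 0 ∧ ∀ i < n, s.na 16 i = s₀.na 16 i ∧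
        s.na 17 i = s₀.na 17 i ∧ s.ra 13 i = s₀.ra 13 i := by
  have hleaf := WP.forUp (W := W) (x := 20) (y := 1) (n := n) (T := 60)
    (c := .putN 15 (.add (.var 1) (.get 18 (.var 20))) (.var 20))
    (fun k s => ∀ i : Fin n, i < k → s.na 15 (n + pos i) = i)
    rfl rfl (by decide) hP.nv1 (by omega) (fun _ _ _ h => h) (by simp) (by
      intro k hk s hf hx hy h
      obtain ⟨i, rfl⟩ : ∃ i : Fin n, (i : ℕ) = k := ⟨⟨k, hk⟩, rfl⟩
      have e18 : s.na 18 i = pos i := by rw [hf.na 18 rfl]; exact h18 i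
      have hpi := hpos i
      refine WP.of_vc_le (by decide) ?_
      simp only [Cmd.vc, NExp.ok, NExp.val, hx, hy, e18, State.putN_na, if_true]
      refine ⟨by omega, by omega, fun l hl => ?_⟩
      split_ifs with h1
      · rw [hinj (Nat.add_left_cancel h1)]
      · refine h l (Nat.lt_of_le_of_ne (by omega) fun e => h1 ?_)
        rw [Fin.ext e])
  refine (WP.seq (T₁ := n * (60 + 9) + 8) (T₂ := 50 + ((n - 1) * (80 + 9) + 8))
    (hleaf.mono (by omega) ?_)).mono (by omega) fun _ h => h
  rintro s₁ ⟨hl, hf₁⟩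
  have hP₁ := hP.of_frame hf₁ rfl
  have e3 : s₁.nv 3 = root := (hf₁.nv 3 rfl).trans h3
  have hvc : (Cmd.putR 12 (.var 1) .zero ;; .putN 16 (.var 1) (.var 3) ;;
      .putN 17 (.var 1) (.var 3) ;; .putR 13 (.var 1) .zero ;; .setN 4 (.var 1) ;;
      .setN 6 (.sub (.var 1) (.lit 1))).vc W (fun s => s.nv 4 = n ∧ s.nv 6 = n - 1 ∧
        s.na 15 = s₁.na 15 ∧ s.na 18 = s₁.na 18 ∧
        (∀ j, s.ra 12 j = if j = n then 0 else s₁.ra 12 j) ∧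
        (∀ j, s.na 16 j = if j = n then root else s₁.na 16 j) ∧
        (∀ j, s.na 17 j = if j = n then root else s₁.na 17 j) ∧
        ∀ j, s.ra 13 j = if j = n then 0 else s₁.ra 13 j) s₁ := by
    simp [hP₁.nv1, e3]
    refine ⟨by omega, hr, by omega, hr, by omega, by omega, ?_, ?_⟩ <;>
      (funext j; simp)
  refine WP.seq ((WP.of_vc_le (by decide) hvc).mono le_rfl ?_)
  rintro s₂ ⟨h4, h6, h15, h18', h12', h16, h17, h13⟩
  -- The counter value `k` stands for the node `k + 1`, so the exceptions before a round are the
  -- nodes up to `k + 1` and after it those up to `k`; the number `0` is no node.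
  refine (WP.forDown (W := W) (x := 20) (y := 6) (n := n - 1) (T := 80) (fun k s =>
    TreeInv pos key ∅ {y | y ≤ k} (s.na 15)) rfl h6 (by omega) (fun _ _ _ h => h) ?_ ?_).mono
    le_rfl ?_
  · refine ⟨fun i => ⟨fun h => h.elim, fun _ => ?_⟩, fun x hx hxn hxE => ?_,
      fun x hx hxn hxE => ?_⟩
    · rw [h15]; exact hl i i.isLt
    · simp only [Set.mem_ofPred_eq] at hxE; omega
    · simp only [Set.mem_ofPred_eq] at hxE
      obtain ⟨i, hi⟩ := hsurj (x - n) (by omega)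
      obtain rfl : x = n + pos i := by omega
      rw [h15, hl i i.isLt]
      exact i.isLt.le
  · intro k hk s hf hx H
    have key12 : ∀ j ≤ n, s.ra 12 j = key j := fun j hj => by
      rw [hf.ra 12 rfl, h12']
      split_ifs with h
      · rw [h, hkey]
      · rw [hf₁.ra 12 rfl]
        exact h12 ⟨j, by omega⟩
    have hvc : (Cmd.setN 21 (.add (.var 20) (.lit 1))).vc W (fun s' => s'.nv 21 = k + 1 ∧
        s'.na = s.na ∧ s'.ra = s.ra) s := by
      simp [hx]; omega
    refine WP.seq (T₁ := 20) (T₂ := 60) ((WP.of_vc_le (by decide) hvc).mono le_rfl ?_)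
    rintro s' ⟨h21, ena, era⟩
    refine pull_spec (key := key) hW h21 (by omega) (by rw [era]; exact key12) ?_ ?_ ?_
    · rw [ena]; exact H.le _ (by omega) (by omega) (by simp only [Set.mem_ofPred_eq]; omega)
    · rw [ena]; exact H.le _ (by omega) (by omega) (by simp only [Set.mem_ofPred_eq]; omega)
    · intro s'' _ hT
      rw [ena] at hT
      refine H.pull (by omega) (by omega) (by simp only [Set.mem_ofPred_eq]; omega)
        (by simp only [Set.mem_ofPred_eq]; omega) hT ?_
      intro y hy hyE
      simp only [Set.mem_ofPred_eq] at hyE ⊢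
      omega
  · rintro s ⟨H, hf⟩
    refine ⟨⟨(hf.nv 4 rfl).trans h4, fun i => ?_, fun j hj => ?_, ?_⟩, ?_, ?_, ?_, fun i hi => ?_⟩
    · rw [hf.na 18 rfl, h18', hf₁.na 18 rfl]; exact h18 i
    · rw [hf.ra 12 rfl, h12']
      split_ifs with h
      · rw [h, hkey]
      · rw [hf₁.ra 12 rfl]
        exact h12 ⟨j, by omega⟩
    · refine ⟨H.leaf, fun x hx hxn _ => H.node x hx hxn ?_, fun x hx hxn _ => H.le x hx hxn ?_⟩
      · simp; omega
      · simp; omega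
    · rw [hf.na 16 rfl, h16, if_pos rfl]
    · rw [hf.na 17 rfl, h17, if_pos rfl]
    · rw [hf.ra 13 rfl, h13, if_pos rfl]
    · rw [hf.na 16 rfl, h16, hf.na 17 rfl, h17, hf.ra 13 rfl, h13, hf₁.na 16 rfl, hf₁.na 17 rfl,
        hf₁.ra 13 rfl]
      simp [hi.ne]

end UncertainTree

/-! ## Distances in a rooted tree -/

namespace UncertainTree

open SimpleGraph Finset

namespace Instance

variable {N n M : ℕ} (I : Instance N n M)

theorem path_isPath (a b : Fin N) : (I.path a b).IsPath :=
  (I.isTree.existsUnique_path a b).choose_spec.1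

theorem path_eq {a b : Fin N} {p : I.graph.Walk a b} (hp : p.IsPath) : I.path a b = p :=
  ((I.isTree.existsUnique_path a b).choose_spec.2 p hp).symm

theorem path_self (a : Fin N) : I.path a a = .nil := I.path_eq .nil

theorem path_reverse (a b : Fin N) : I.path b a = (I.path a b).reverse :=
  I.path_eq (I.path_isPath a b).reverse

theorem path_append {a b c : Fin N} (hb : b ∈ (I.path a c).support) :
    I.path a c = (I.path a b).append (I.path b c) := by
  rw [I.path_eq ((I.path_isPath a c).takeUntil hb), I.path_eq ((I.path_isPath a c).dropUntil hb)]
  exact ((I.path a c).take_spec hb).symm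

theorem path_cons {a b c : Fin N} (h : I.graph.Adj a b) (hb : a ∉ (I.path b c).support) :
    I.path a c = .cons h (I.path b c) :=
  I.path_eq ((Walk.cons_isPath_iff _ _).2 ⟨I.path_isPath b c, hb⟩)

theorem support_path_subset (a b c : Fin N) {x : Fin N} (hx : x ∈ (I.path a c).support) :
    x ∈ (I.path a b).support ∨ x ∈ (I.path b c).support := by
  rw [I.path_eq (((I.path a b).append (I.path b c)).bypass_isPath)] at hx
  exact (Walk.mem_support_append_iff _ _).1 (Walk.support_bypass_subset_support _ hx)

theorem path_cons_snd {a b : Fin N} (h : a ≠ b) :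
    ∃ hadj : I.graph.Adj a (I.path a b).snd, I.path a b = .cons hadj (I.path (I.path a b).snd b) ∧
      a ∉ (I.path (I.path a b).snd b).support := by
  have hn : ¬ (I.path a b).Nil := Walk.not_nil_of_ne h
  have hp := I.path_isPath a b
  have e := (I.path a b).cons_tail_eq hn
  rw [← e, Walk.cons_isPath_iff] at hp
  have e2 : I.path (I.path a b).snd b = (I.path a b).tail := I.path_eq hp.1
  exact ⟨Walk.adj_snd hn, by rw [e2]; exact e.symm, by rw [e2]; exact hp.2⟩

theorem vdist_comm (a b : Fin N) : I.vdist a b = I.vdist b a := by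
  rw [vdist, vdist, I.path_reverse a b, Walk.edges_reverse, List.map_reverse, List.sum_reverse]

theorem vdist_add {a b c : Fin N} (hb : b ∈ (I.path a c).support) :
    I.vdist a c = I.vdist a b + I.vdist b c := by
  rw [vdist, I.path_append hb, Walk.edges_append, List.map_append, List.sum_append, vdist, vdist]

theorem vdist_adj {a b : Fin N} (h : I.graph.Adj a b) : I.vdist a b = I.len s(a, b) := by
  rw [vdist, I.path_cons h (by rw [path_self]; simpa using h.ne), path_self]
  simp

theorem vdist_nonneg (a b : Fin N) : 0 ≤ I.vdist a b := by
  refine List.sum_nonneg ?_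
  simp only [List.mem_map]
  rintro _ ⟨e, he, rfl⟩
  exact (I.len_pos e (Walk.edges_subset_edgeSet _ he)).le

theorem vdist_pos {a b : Fin N} (h : I.graph.Adj a b) : 0 < I.vdist a b := by
  rw [I.vdist_adj h]; exact I.len_pos _ h

/-- The triangle inequality for the ends of an edge. -/
theorem vdist_le_of_adj {a b : Fin N} (h : I.graph.Adj a b) (c : Fin N) :
    I.vdist a c ≤ I.vdist a b + I.vdist b c := by
  by_cases ha : a ∈ (I.path b c).support
  · rw [I.vdist_add ha]
    linarith [I.vdist_nonneg a b, I.vdist_nonneg b a]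
  · rw [vdist, I.path_cons h ha, Walk.edges_cons, List.map_cons, List.sum_cons, I.vdist_adj h]
    rfl

/-- The tree with the root `r`. -/
noncomputable def rooting (r : Fin N) : Rooting N where
  par v := (I.path v r).snd
  root := r
  lev v := (I.path v r).length
  par_root := by rw [path_self]; rfl
  lev_par v hv := by
    obtain ⟨h, e, -⟩ := I.path_cons_snd hv
    conv_rhs => rw [e]
    simp
  lev_lt v := by simpa using (I.path_isPath v r).length_lt

variable {I} {r : Fin N}

theorem adj_par {v : Fin N} (hv : v ≠ r) : I.graph.Adj v ((I.rooting r).par v) :=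
  (I.path_cons_snd hv).1

/-- If `b` is on the path from `a` to the root, this path begins with the edge to `b`. Otherwise
that path prolonged by the edge is the path from `b`, so `a` is the parent of `b`. -/
theorem par_of_adj {a b : Fin N} (h : I.graph.Adj a b) :
    (a ≠ r ∧ b = (I.rooting r).par a) ∨ (b ≠ r ∧ a = (I.rooting r).par b) := by
  by_cases hb : b ∈ (I.path a r).support
  · left
    have e := I.path_append hb
    rw [I.path_cons (c := b) h (by rw [path_self]; simpa using h.ne)] at e
    refine ⟨?_, ?_⟩
    · rintro rfl
      rw [path_self] at hb
      simp only [Walk.support_nil, List.mem_singleton] at hb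
      exact h.ne hb.symm
    · change b = (I.path a r).snd
      rw [e]; simp
  · right
    refine ⟨?_, ?_⟩
    · rintro rfl
      exact hb (Walk.end_mem_support _)
    · change a = (I.path b r).snd
      by_cases ha : b ∈ (I.path a r).support
      · exact absurd ha hb
      · rw [I.path_cons h.symm ha]; simp

theorem anc_iff {u v : Fin N} : (I.rooting r).Anc u v ↔ u ∈ (I.path v r).support := by
  induction hl : (I.rooting r).lev v using Nat.strong_induction_on generalizing v with
  | _ l ih =>
    by_cases hv : v = r
    · subst hv
      rw [path_self, Walk.support_nil, List.mem_singleton]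
      refine ⟨?_, fun h => h ▸ Rooting.Anc.refl _⟩
      rintro ⟨m, rfl⟩
      exact Function.iterate_fixed (I.rooting v).par_root m
    · obtain ⟨h, e, -⟩ := I.path_cons_snd hv
      have ih' := ih _ (hl ▸ (I.rooting r).lev_par v hv) (v := (I.rooting r).par v) rfl
      rw [e, Walk.support_cons, List.mem_cons]
      refine Iff.trans ?_ (or_congr_right ih')
      refine ⟨fun h => h.eq_or, ?_⟩
      rintro (rfl | h)
      · exact Rooting.Anc.refl _
      · exact h.trans (Rooting.Anc.par v)

theorem anc_antisymm {u v : Fin N} (h : (I.rooting r).Anc u v) (h' : (I.rooting r).Anc v u) :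
    u = v := by
  have key : ∀ {u v : Fin N}, (I.rooting r).Anc u v →
      (I.path v r).length = (I.path v u).length + (I.path u r).length := fun h => by
    rw [I.path_append (anc_iff.1 h), Walk.length_append]
  have h1 := key h
  have h2 := key h'
  exact (Walk.eq_of_length_eq_zero (show (I.path v u).length = 0 by omega)).symm

theorem vdist_root_of_anc {u v : Fin N} (h : (I.rooting r).Anc u v) :
    I.vdist v r = I.vdist v u + I.vdist u r := I.vdist_add (anc_iff.1 h)

theorem vdist_root (v : Fin N) : I.vdist v r =
    I.vdist ((I.rooting r).par v) r + I.vdist v ((I.rooting r).par v) := by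
  rw [vdist_root_of_anc (Rooting.Anc.par v), add_comm]

/-- The path from `u` to `p` starts with the edge to the parent of `u`. Otherwise `u` would be on
the path from the parent to `p`, hence on the path from the parent to the root, which avoids `u`, or
on the path between the root and `p`, which contains only ancestors of `p`. -/
theorem vdist_of_not_anc {u p : Fin N} (h : ¬ (I.rooting r).Anc u p) :
    I.vdist u p = I.vdist u ((I.rooting r).par u) + I.vdist ((I.rooting r).par u) p := by
  have hu : u ≠ r := by rintro rfl; exact h (Rooting.Anc.root p)
  obtain ⟨hadj, -, hn⟩ := I.path_cons_snd hu
  have hns : u ∉ (I.path ((I.rooting r).par u) p).support := by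
    intro hs
    rcases I.support_path_subset _ r _ hs with h1 | h1
    · exact hn h1
    · rw [path_reverse, Walk.support_reverse, List.mem_reverse] at h1
      exact h (anc_iff.2 h1)
  rw [I.vdist_adj (adj_par hu), vdist, I.path_cons (adj_par hu) hns]
  simp [vdist]

/-- Induction along the way from `u` up to `z`: a vertex that is not an ancestor of `p` is left
through its parent edge, and the first ancestor of `p` is `z`. -/
theorem vdist_of_isLca {u p z : Fin N} (h : Points.IsLca (I.rooting r) z u p) :
    I.vdist u p = I.vdist u r + I.vdist p r - (I.vdist z r + I.vdist z r) := by
  induction hl : (I.rooting r).lev u using Nat.strong_induction_on generalizing u with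
  | _ l ih =>
    obtain ⟨h1, h2, h3⟩ := h
    by_cases hp : (I.rooting r).Anc u p
    · obtain rfl := anc_antisymm h1 (h3 u (Rooting.Anc.refl u) hp)
      rw [vdist_root_of_anc h2, I.vdist_comm p]
      ring
    · have hu : u ≠ r := by rintro rfl; exact hp (Rooting.Anc.root p)
      have hz : (I.rooting r).Anc z ((I.rooting r).par u) := by
        rcases h1.eq_or with rfl | h
        · exact absurd h2 hp
        · exact h
      rw [vdist_of_not_anc hp, ih _ (hl ▸ (I.rooting r).lev_par u hu)
        ⟨hz, h2, fun y hy => h3 y (hy.trans (Rooting.Anc.par u))⟩ rfl, I.vdist_root (r := r) u]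
      ring

/-- The distance from the point at height `t` above the vertex `x` to the vertex `y`. -/
noncomputable def upDist (I : Instance N n M) (r x : Fin N) (t : ℝ) (y : Fin N) : ℝ :=
  min (t + I.vdist x y) (I.vdist x ((I.rooting r).par x) - t + I.vdist ((I.rooting r).par x) y)

theorem vdist_par_nonneg (x : Fin N) : 0 ≤ I.vdist x ((I.rooting r).par x) := I.vdist_nonneg _ _

/-- If `x` is an ancestor of `p`, then `z` is at or below `x`, and one goes down through `x`.
Otherwise `z` is at or above the parent of `x`, and one goes up. In both cases the turning depth is
the minimum of the two depths, so `x` and `t` enter only through the depth of the point. -/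
theorem upDist_eq {m x p z : Fin N} {t : ℝ} (hx : (I.rooting r).Anc x m)
    (hz : Points.IsLca (I.rooting r) z m p) (h0 : 0 ≤ t)
    (ht : t ≤ I.vdist x ((I.rooting r).par x)) :
    I.upDist r x t p = (I.vdist x r - t) + I.vdist p r -
      (min (I.vdist x r - t) (I.vdist z r) + min (I.vdist x r - t) (I.vdist z r)) := by
  obtain ⟨h1, h2, h3⟩ := hz
  have hr := I.vdist_root (r := r) x
  by_cases hp : (I.rooting r).Anc x p
  · have hxz := vdist_root_of_anc (h3 x hx hp)
    have e1 := vdist_root_of_anc hp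
    have e2 := vdist_root_of_anc ((Rooting.Anc.par x).trans hp)
    rw [I.vdist_comm p x] at e1
    rw [I.vdist_comm p ((I.rooting r).par x)] at e2
    rw [min_eq_left (by linarith [I.vdist_nonneg z x]), upDist, min_eq_left (by linarith)]
    linarith
  · have hzx : (I.rooting r).Anc z x := by
      rcases Points.anc_total h1 hx with h | h
      · exact h
      · exact absurd (h.trans h2) hp
    have hzp : (I.rooting r).Anc z ((I.rooting r).par x) := by
      rcases hzx.eq_or with rfl | h
      · exact absurd h2 hp
      · exact h
    have e1 := vdist_of_not_anc hp
    have e2 := vdist_root_of_anc hzp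
    have e3 := vdist_of_isLca (u := (I.rooting r).par x) (p := p) ⟨hzp, h2, fun y hy =>
      h3 y ((hy.trans (Rooting.Anc.par x)).trans hx)⟩
    rw [min_eq_right (by linarith [I.vdist_nonneg ((I.rooting r).par x) z]), upDist,
      min_eq_right (by linarith)]
    linarith

theorem upDist_root {x : Fin N} {t : ℝ} (h0 : 0 ≤ t)
    (ht : t ≤ I.vdist x ((I.rooting r).par x)) : I.upDist r x t r = I.vdist x r - t := by
  rw [upDist_eq (Rooting.Anc.refl x) ⟨Rooting.Anc.root x, Rooting.Anc.refl r, fun y _ h => h⟩ h0 ht,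
    show I.vdist (I.rooting r).root r = 0 from I.vdist_self r,
    min_eq_right, show I.vdist r r = 0 from I.vdist_self r]
  · ring
  · have := I.vdist_root (r := r) x
    linarith [I.vdist_nonneg ((I.rooting r).par x) r]

theorem vdist_eq_upDist (x y : Fin N) : I.vdist x y = I.upDist r x 0 y := by
  rw [upDist, zero_add, sub_zero, min_eq_left]
  by_cases hx : x = r
  · subst hx
    rw [show (I.rooting x).par x = x from (I.rooting x).par_root, vdist_self, zero_add]
  · exact I.vdist_le_of_adj (adj_par hx) y

theorem vdist_le (p : I.Point) (y : Fin N) :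
    I.vdist p.u y ≤ I.vdist p.u p.w + I.vdist p.w y ∧
      I.vdist p.w y ≤ I.vdist p.u p.w + I.vdist p.u y := by
  rcases p.adj with h | h
  · rw [← h, vdist_self]; simp
  · exact ⟨I.vdist_le_of_adj h y, by
      rw [I.vdist_comm p.u p.w]; exact I.vdist_le_of_adj h.symm y⟩

/-- A normal form for points of the path to the root. It removes the ambiguity of `Point`, where an
edge may be given in either direction and a vertex may be an end of an edge. -/
theorem dist_eq_of_onPath {c : I.Point} {v : Fin N} (h : I.OnPath c v r) :
    ∃ x t, (I.rooting r).Anc x v ∧ 0 ≤ t ∧ t ≤ I.vdist x ((I.rooting r).par x) ∧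
      ∀ y, I.dist c y = I.upDist r x t y := by
  have h0 := c.t_nonneg
  have ht := c.t_le
  rcases h with ⟨h1, h2⟩ | ⟨h1, h2⟩ | ⟨h1, h2⟩
  · rw [← anc_iff] at h1 h2
    rcases c.adj with h | h
    · rw [← h, vdist_self] at ht
      refine ⟨c.u, 0, h1, le_rfl, vdist_par_nonneg _, fun y => ?_⟩
      rw [← vdist_eq_upDist, dist, ← h, vdist_self, le_antisymm ht h0]
      simp
    · rcases par_of_adj (r := r) h with ⟨-, e⟩ | ⟨-, e⟩
      · refine ⟨c.u, c.t, h1, h0, e ▸ ht, fun y => ?_⟩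
        rw [dist, upDist, ← e]
      · refine ⟨c.w, I.vdist c.u c.w - c.t, h2, by linarith, ?_, fun y => ?_⟩
        · rw [← e, I.vdist_comm c.w]; linarith
        · rw [dist, upDist, ← e, min_comm, I.vdist_comm c.w c.u, sub_sub_cancel]
  · refine ⟨c.u, 0, anc_iff.2 h1, le_rfl, vdist_par_nonneg _, fun y => ?_⟩
    rw [← vdist_eq_upDist, dist, h2, zero_add, sub_zero, min_eq_left (vdist_le c y).1]
  · refine ⟨c.w, 0, anc_iff.2 h1, le_rfl, vdist_par_nonneg _, fun y => ?_⟩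
    rw [← vdist_eq_upDist, dist, h2, sub_self, zero_add, min_eq_right (vdist_le c y).2]

end Instance

end UncertainTree

/-! ## Covering points on the way to the root -/

namespace UncertainTree

open SimpleGraph Finset

namespace Points

variable {N n M : ℕ} {P : Points N n M} {dep : Fin N → ℝ} {g : Fin M → ℝ} {i : Fin n}

/-- The expected distance is a convex function of the depth. -/
theorem ed_le_of_le (hw : 0 ≤ P.weight i) (hp : ∀ j, 0 ≤ P.prob j) {a b d c : ℝ} (hab : a ≤ b)
    (hbd : b ≤ d) (ha : P.ed dep g i a ≤ c) (hd : P.ed dep g i d ≤ c) : P.ed dep g i b ≤ c := by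
  rcases hab.eq_or_lt with rfl | hab'
  · exact ha
  have had : 0 < d - a := by linarith
  have key : (d - a) * P.ed dep g i b ≤ (d - b) * P.ed dep g i a + (b - a) * P.ed dep g i d := by
    have hsum : ∀ x y, x * P.ed dep g i y = P.weight i * ∑ j with P.owner j = i,
        P.prob j * (x * (y + dep (P.loc j) - (min y (g j) + min y (g j)))) := fun x y => by
      rw [ed, mul_left_comm, mul_sum]
      simp only [mul_left_comm]
    rw [hsum, hsum, hsum, ← mul_add, ← sum_add_distrib]
    refine mul_le_mul_of_nonneg_left (sum_le_sum fun j _ => ?_) hw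
    rw [← mul_add]
    refine mul_le_mul_of_nonneg_left ?_ (hp j)
    -- This is the concavity of `min · (g j)`, which enters `ed` with a negative sign.
    have hmin : (d - b) * min a (g j) + (b - a) * min d (g j) ≤ (d - a) * min b (g j) := by
      rw [mul_min_of_nonneg _ _ had.le]
      have h1 := mul_le_mul_of_nonneg_left (min_le_left a (g j)) (sub_nonneg.2 hbd)
      have h2 := mul_le_mul_of_nonneg_left (min_le_right a (g j)) (sub_nonneg.2 hbd)
      have h3 := mul_le_mul_of_nonneg_left (min_le_left d (g j)) (sub_nonneg.2 hab)
      have h4 := mul_le_mul_of_nonneg_left (min_le_right d (g j)) (sub_nonneg.2 hab)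
      refine le_min (by linarith) (by linarith)
    linarith
  refine le_of_mul_le_mul_left (key.trans ?_) had
  have h1 := mul_le_mul_of_nonneg_left ha (sub_nonneg.2 hbd)
  have h2 := mul_le_mul_of_nonneg_left hd (sub_nonneg.2 hab)
  linarith

/-- The expected distance is affine along an edge. -/
theorem ed_affine {a b d : ℝ} (hab : a ≤ b) (hbd : b ≤ d)
    (hg : ∀ j, P.owner j = i → g j ≤ a ∨ d ≤ g j) :
    (d - a) * P.ed dep g i b = (d - b) * P.ed dep g i a + (b - a) * P.ed dep g i d := by
  have hsum : ∀ x y, x * P.ed dep g i y = P.weight i * ∑ j with P.owner j = i,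
      P.prob j * (x * (y + dep (P.loc j) - (min y (g j) + min y (g j)))) := fun x y => by
    rw [ed, mul_left_comm, mul_sum]
    simp only [mul_left_comm]
  rw [hsum, hsum, hsum, ← mul_add, ← sum_add_distrib]
  congr 1
  refine sum_congr rfl fun j hj => ?_
  rcases hg j (by simpa using hj) with h | h
  · rw [min_eq_right h, min_eq_right (h.trans hab), min_eq_right (h.trans (hab.trans hbd))]
    ring
  · rw [min_eq_left h, min_eq_left (hbd.trans h), min_eq_left (hab.trans (hbd.trans h))]
    ring

end Points

namespace Instance

variable {N n M : ℕ} {I : Instance N n M} {med : Fin n → Fin N} {r : Fin N} {g : Fin M → ℝ}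

/-- The input data about the uncertain points. -/
def points (I : Instance N n M) (med : Fin n → Fin N) : Points N n M where
  med := med
  owner := I.owner
  loc := I.loc
  prob := I.prob
  weight := I.weight
  range := I.range

/-- The values `g j` are the depths of the lowest common ancestors of the locations and the
medians. -/
def IsLcaDepth (I : Instance N n M) (med : Fin n → Fin N) (r : Fin N) (g : Fin M → ℝ) : Prop :=
  ∀ j, ∃ z, Points.IsLca (I.rooting r) z (med (I.owner j)) (I.loc j) ∧ g j = I.vdist z r

/-- The expected distance from the point at depth `δ` above the median. -/
noncomputable abbrev edAt (I : Instance N n M) (med : Fin n → Fin N) (r : Fin N) (g : Fin M → ℝ) :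
    Fin n → ℝ → ℝ := (I.points med).ed (fun v => I.vdist v r) g

/-- The length of the edge above a vertex. -/
noncomputable abbrev plen (I : Instance N n M) (r : Fin N) (v : Fin N) : ℝ :=
  I.vdist v ((I.rooting r).par v)

/-- Since `x` is above the median, `upDist_eq` applies to all locations with common ancestors that
do not depend on `x`. So the expected distance is a function of the depth on the whole path from the
median to the root. -/
theorem expDist_eq (hg : I.IsLcaDepth med r g) {c : I.Point} {x : Fin N} {t : ℝ} {i : Fin n}
    (hx : (I.rooting r).Anc x (med i)) (h0 : 0 ≤ t) (ht : t ≤ I.plen r x)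
    (hc : ∀ y, I.dist c y = I.upDist r x t y) :
    I.expDist c i = I.edAt med r g i (I.vdist x r - t) := by
  unfold expDist edAt Points.ed
  congr 1
  refine sum_congr rfl fun j hj => ?_
  obtain ⟨z, hz, e⟩ := hg j
  obtain rfl : I.owner j = i := (mem_filter.1 hj).2
  rw [hc, upDist_eq hx hz h0 ht, e]
  rfl

theorem dist_vertexPoint (v y : Fin N) : I.dist (I.vertexPoint v) y = I.upDist r v 0 y := by
  rw [← vdist_eq_upDist, dist, vertexPoint, vdist_self]
  simp

theorem edAt_med_le (hg : I.IsLcaDepth med r g) {i : Fin n}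
    (h : I.Covers (I.vertexPoint (med i)) i) :
    I.edAt med r g i (I.vdist (med i) r) ≤ I.range := by
  have := expDist_eq hg (Rooting.Anc.refl (med i)) le_rfl (vdist_par_nonneg _)
    (dist_vertexPoint (I := I) (r := r) (med i))
  rw [sub_zero] at this
  exact this ▸ h

theorem edAt_le_of_le {i : Fin n} {a b d c : ℝ} (hab : a ≤ b) (hbd : b ≤ d)
    (ha : I.edAt med r g i a ≤ c) (hd : I.edAt med r g i d ≤ c) : I.edAt med r g i b ≤ c :=
  Points.ed_le_of_le (I.weight_nonneg i) I.prob_nonneg hab hbd ha hd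

/-- The height above the vertex `x` at which the point `i` stops being covered. -/
noncomputable abbrev offset (I : Instance N n M) (med : Fin n → Fin N) (r : Fin N)
    (g : Fin M → ℝ) (i : Fin n) (x : Fin N) : ℝ :=
  (I.points med).offset (I.rooting r) (I.plen r) (fun v => I.vdist v r) g i x

/-- The vertex `x` is the highest vertex above the median that covers the uncertain point. -/
structure IsHighest (I : Instance N n M) (med : Fin n → Fin N) (r : Fin N) (g : Fin M → ℝ)
    (i : Fin n) (x : Fin N) : Prop where
  anc : (I.rooting r).Anc x (med i)
  le : I.edAt med r g i (I.vdist x r) ≤ I.range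
  top : x = r ∨ ¬ I.edAt med r g i (I.vdist ((I.rooting r).par x) r) ≤ I.range

theorem offset_eq_zero (i : Fin n) : I.offset med r g i r = 0 := if_pos rfl

theorem offset_eq {i : Fin n} {x : Fin N} (hx : x ≠ r) : I.offset med r g i x =
    (I.range - I.edAt med r g i (I.vdist x r)) * I.plen r x /
      (I.edAt med r g i (I.vdist ((I.rooting r).par x) r) - I.edAt med r g i (I.vdist x r)) :=
  if_neg hx

/-- The parent of `x` does not cover the point, hence the strict bound away from the root. It
ensures that the highest covering point is strictly below the parent. -/
theorem offset_bounds {i : Fin n} {x : Fin N} (hx : I.IsHighest med r g i x) :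
    0 ≤ I.offset med r g i x ∧ I.offset med r g i x ≤ I.plen r x ∧
      (x ≠ r → I.offset med r g i x < I.plen r x) := by
  by_cases hxr : x = r
  · subst hxr
    rw [offset_eq_zero]
    exact ⟨le_rfl, vdist_par_nonneg _, fun h => absurd rfl h⟩
  · have h1 := hx.le
    have h2 := hx.top.resolve_left hxr
    have hpos : 0 < I.plen r x := I.vdist_pos (adj_par hxr)
    have hlt : I.offset med r g i x < I.plen r x := by
      rw [offset_eq hxr, div_lt_iff₀ (by linarith), mul_comm]
      exact mul_lt_mul_of_pos_left (by linarith) hpos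
    refine ⟨?_, hlt.le, fun _ => hlt⟩
    rw [offset_eq hxr]
    exact div_nonneg (mul_nonneg (by linarith) hpos.le) (by linarith)

/-- Convexity makes the covered depths up to that of the median an interval, and affinity on the
edge above `x` places its lower end at the interpolated point. -/
theorem edAt_le_iff (hg : I.IsLcaDepth med r g) {i : Fin n} {x : Fin N}
    (hm : I.edAt med r g i (I.vdist (med i) r) ≤ I.range) (hx : I.IsHighest med r g i x) {δ : ℝ}
    (h0 : 0 ≤ δ) (hδ : δ ≤ I.vdist (med i) r) :
    I.edAt med r g i δ ≤ I.range ↔ I.vdist x r - I.offset med r g i x ≤ δ := by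
  by_cases hxr : x = r
  · subst hxr
    have hx1 := hx.le
    rw [vdist_self] at hx1
    rw [offset_eq_zero, vdist_self, sub_zero]
    exact ⟨fun _ => h0, fun _ => edAt_le_of_le h0 hδ hx1 hm⟩
  · obtain ⟨o1, o2, o3⟩ := offset_bounds hx
    have hr := I.vdist_root (r := r) x
    have h1 := hx.le
    have h2 := not_le.1 (hx.top.resolve_left hxr)
    have hpos : 0 < I.plen r x := I.vdist_pos (adj_par hxr)
    have haff : ∀ b, I.vdist ((I.rooting r).par x) r ≤ b → b ≤ I.vdist x r →
        I.plen r x * I.edAt med r g i b = I.plen r x * I.edAt med r g i (I.vdist x r) +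
        (I.vdist x r - b) * (I.edAt med r g i (I.vdist ((I.rooting r).par x) r) -
          I.edAt med r g i (I.vdist x r)) := by
      intro b hb1 hb2
      have := Points.ed_affine (P := I.points med) (dep := fun v => I.vdist v r) (g := g) (i := i)
        hb1 hb2 (fun j hj => ?_)
      · rw [show I.plen r x = I.vdist x r - I.vdist ((I.rooting r).par x) r by linarith]
        linarith
      -- The kinks belong to ancestors of the median, and no such vertex is strictly between `x` and
      -- its parent.
      · obtain ⟨z, ⟨hz, -, -⟩, e⟩ := hg j
        rw [show I.owner j = i from hj] at hz
        rw [e]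
        rcases Points.anc_total hz hx.anc with h | h
        · rcases h.eq_or with rfl | h
          · exact .inr le_rfl
          · left
            linarith [vdist_root_of_anc h, I.vdist_nonneg ((I.rooting r).par x) z]
        · right
          linarith [vdist_root_of_anc h, I.vdist_nonneg z x]
    have hoff : I.offset med r g i x * (I.edAt med r g i (I.vdist ((I.rooting r).par x) r) -
        I.edAt med r g i (I.vdist x r)) = I.plen r x * (I.range -
          I.edAt med r g i (I.vdist x r)) := by
      rw [offset_eq hxr, div_mul_cancel₀ _ (by linarith), mul_comm]
    constructor
    · intro h
      by_contra hlt
      rw [not_le] at hlt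
      rcases le_total δ (I.vdist ((I.rooting r).par x) r) with hle | hle
      -- A covering point at or above the parent of `x` would, together with `x`, force the parent
      -- to cover as well.
      · exact absurd (edAt_le_of_le hle (by linarith) h h1) (not_le.2 h2)
      · have h3 := haff δ hle (by linarith)
        have h4 := mul_lt_mul_of_pos_right (show I.offset med r g i x < I.vdist x r - δ by linarith)
          (show 0 < I.edAt med r g i (I.vdist ((I.rooting r).par x) r) -
            I.edAt med r g i (I.vdist x r) by linarith)
        have h5 := mul_le_mul_of_nonneg_left h hpos.le
        linarith
    · intro h
      refine edAt_le_of_le h hδ (le_of_mul_le_mul_left ?_ hpos) hm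
      rw [haff _ (by linarith) (by linarith)]
      linarith

theorem med_mem_subtree {i : Fin n} {v : Fin N} :
    med i ∈ I.subtree med r v ↔ (I.rooting r).Anc v (med i) := by
  rw [anc_iff]
  refine ⟨fun h => h.2, fun h => ⟨?_, h⟩⟩
  rintro S ⟨hS, -⟩
  exact hS ⟨i, rfl⟩

/-- Every point of the path from `v` to the root is also on the paths from the medians below `v`, so
each active point in question contributes one lower bound on the depth by `edAt_le_iff`. -/
theorem isFeasible_iff (hg : I.IsLcaDepth med r g) {x : Fin n → Fin N}
    (hm : ∀ i, I.edAt med r g i (I.vdist (med i) r) ≤ I.range)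
    (hx : ∀ i, I.IsHighest med r g i (x i)) {D : Set (Fin n)} {v : Fin N} {c : I.Point}
    (hc : I.OnPath c v r) : I.IsFeasible med r D v c ↔ ∀ i ∉ D, (I.rooting r).Anc v (med i) →
      I.vdist (x i) r - I.offset med r g i (x i) ≤ I.dist c r := by
  obtain ⟨y, t, hy, h0, ht, hd⟩ := dist_eq_of_onPath hc
  have hr := I.vdist_root (r := r) y
  refine ⟨fun h i hi hv => ?_, fun h => ⟨hc, fun i hi hv => ?_⟩⟩
  · have := h.2 i hi (med_mem_subtree.2 hv)
    rw [Covers, expDist_eq hg (hy.trans hv) h0 ht hd, edAt_le_iff hg (hm i) (hx i)] at this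
    · rwa [hd, upDist_root h0 ht]
    · linarith [I.vdist_nonneg ((I.rooting r).par y) r]
    · linarith [vdist_root_of_anc (hy.trans hv), I.vdist_nonneg (med i) y]
  · rw [med_mem_subtree] at hv
    rw [Covers, expDist_eq hg (hy.trans hv) h0 ht hd, edAt_le_iff hg (hm i) (hx i)]
    · rw [← upDist_root h0 ht, ← hd]; exact h i hi hv
    · linarith [I.vdist_nonneg ((I.rooting r).par y) r]
    · linarith [vdist_root_of_anc (hy.trans hv), I.vdist_nonneg (med i) y]

/-- The distance from the root along the path from `v`. -/
theorem dist_root_bounds {v : Fin N} {c : I.Point} (hc : I.OnPath c v r) :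
    0 ≤ I.dist c r ∧ I.dist c r ≤ I.vdist v r := by
  obtain ⟨y, t, hy, h0, ht, hd⟩ := dist_eq_of_onPath hc
  have hr := I.vdist_root (r := r) y
  rw [hd, upDist_root h0 ht]
  have := I.vdist_nonneg ((I.rooting r).par y) r
  exact ⟨by linarith, by linarith [vdist_root_of_anc hy, I.vdist_nonneg v y]⟩

/-- The point at height `t` above the vertex `x`. -/
noncomputable def upPoint (I : Instance N n M) (r x : Fin N) (t : ℝ) (h0 : 0 ≤ t)
    (ht : t ≤ I.plen r x) : I.Point where
  u := x
  w := (I.rooting r).par x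
  t := t
  adj := by
    by_cases hx : x = r
    · subst hx
      exact .inl (I.rooting x).par_root.symm
    · exact .inr (adj_par hx)
  t_nonneg := h0
  t_le := ht

theorem upPoint_onPath {x v : Fin N} {t : ℝ} (h0 : 0 ≤ t) (ht : t ≤ I.plen r x)
    (hx : (I.rooting r).Anc x v) : I.OnPath (I.upPoint r x t h0 ht) v r :=
  .inl ⟨anc_iff.1 hx, anc_iff.1 ((Rooting.Anc.par x).trans hx)⟩

theorem dist_upPoint {x : Fin N} {t : ℝ} (h0 : 0 ≤ t) (ht : t ≤ I.plen r x) :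
    I.dist (I.upPoint r x t h0 ht) r = I.vdist x r - t := upDist_root h0 ht

/-- By `isFeasible_iff` no feasible point has depth less than `k`, which is a key or `0`. The point
of depth `k` that the registers describe is feasible as soon as it is on the path from `v`, that is,
if `k` does not exceed the depth of `v`. -/
theorem isAnswer_of_best (hg : I.IsLcaDepth med r g) {x : Fin n → Fin N}
    (hm : ∀ i, I.edAt med r g i (I.vdist (med i) r) ≤ I.range)
    (hx : ∀ i, I.IsHighest med r g i (x i)) {D : Set (Fin n)} {v : Fin N} {s : RealRAM.State}
    {k : ℝ}
    (hbest : ∀ i ∉ D, (I.rooting r).Anc v (med i) →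
      I.vdist (x i) r - I.offset med r g i (x i) ≤ k)
    (hres : (k = 0 ∧ (k ≤ I.vdist v r → s.nv 0 = 1 ∧ s.nv 1 = r ∧ s.nv 2 = r ∧ s.rv 0 = 0)) ∨
      ∃ i ∉ D, (I.rooting r).Anc v (med i) ∧ k = I.vdist (x i) r - I.offset med r g i (x i) ∧
        (k ≤ I.vdist v r → s.nv 0 = 1 ∧ s.nv 1 = x i ∧ s.nv 2 = (I.rooting r).par (x i) ∧
          s.rv 0 = I.offset med r g i (x i)))
    (hnone : ¬ k ≤ I.vdist v r → s.nv 0 = 0) : I.IsAnswer med r D v s := by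
  have hv := I.vdist_nonneg v r
  by_cases hk : k ≤ I.vdist v r
  · left
    rcases hres with ⟨hk0, hs⟩ | ⟨i, hi, hvi, hki, hs⟩
    · obtain ⟨s0, s1, s2, s3⟩ := hs hk
      have hpar : (I.rooting r).par r = r := (I.rooting r).par_root
      have hc := upPoint_onPath (I := I) (r := r) le_rfl (vdist_par_nonneg r)
        (Rooting.Anc.root (R := I.rooting r) v)
      have hd : I.dist (I.upPoint r r 0 le_rfl (vdist_par_nonneg r)) r = k := by
        rw [dist_upPoint, vdist_self, hk0, sub_zero]
      refine ⟨s0, I.upPoint r r 0 le_rfl (vdist_par_nonneg _), ⟨?_, fun c' hc' => ?_⟩, s1, ?_, s3⟩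
      · rw [isFeasible_iff hg hm hx hc, hd]
        exact hbest
      · rw [hd, hk0]
        exact (dist_root_bounds hc'.1).1
      · exact s2.trans (congrArg Fin.val hpar.symm)
    · obtain ⟨s0, s1, s2, s3⟩ := hs hk
      obtain ⟨o1, o2, o3⟩ := offset_bounds (hx i)
      -- Both `x i` and `v` are ancestors of the median. If `v` were strictly above `x i`, it would
      -- be at or above the parent, and by the strict bound on the offset its depth would be less
      -- than `k`.
      have hxv : (I.rooting r).Anc (x i) v := by
        rcases Points.anc_total (hx i).anc hvi with h | h
        · exact h
        · rcases h.eq_or with rfl | h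
          · exact Rooting.Anc.refl _
          · by_cases hxr : x i = r
            · rw [hxr]; exact Rooting.Anc.root v
            · linarith [vdist_root_of_anc h, I.vdist_root (r := r) (x i), o3 hxr,
                I.vdist_nonneg ((I.rooting r).par (x i)) v]
      have hc := upPoint_onPath o1 o2 hxv
      have hd := dist_upPoint o1 o2
      rw [← hki] at hd
      refine ⟨s0, I.upPoint r (x i) _ o1 o2, ⟨?_, fun c' hc' => ?_⟩, s1, s2, s3⟩
      · rw [isFeasible_iff hg hm hx hc, hd]
        exact hbest
      · rw [hd, hki]
        exact (isFeasible_iff hg hm hx hc'.1).1 hc' i hi hvi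
  · right
    refine ⟨hnone hk, ?_⟩
    rintro ⟨c, hc⟩
    have hb := dist_root_bounds hc.1
    rcases hres with ⟨hk0, -⟩ | ⟨i, hi, hvi, hki, -⟩
    · exact hk (hk0 ▸ hv)
    · have := (isFeasible_iff hg hm hx hc.1).1 hc i hi hvi
      exact hk (by linarith)

end Instance

end UncertainTree

/-! ## The edge list of a rooted tree -/

namespace UncertainTree

open SimpleGraph Finset

namespace Instance

variable {N n M : ℕ} {I : Instance N n M} {r : Fin N}

/-- Two vertices with the same parent edge would be each other's parents, which the levels forbid.
An injective map between sets of `N - 1` elements is bijective. -/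
theorem exists_edge_equiv (I : Instance N n M) (r : Fin N) :
    ∃ e : {y : Fin N // y ≠ r} ≃ Fin (N - 1),
      ∀ y, s((I.edge (e y)).1, (I.edge (e y)).2) = s(y.1, (I.rooting r).par y.1) := by
  have h : ∀ y : {y : Fin N // y ≠ r}, ∃ k,
      s((I.edge k).1, (I.edge k).2) = s(y.1, (I.rooting r).par y.1) := fun y =>
    (I.adj_iff _ _).1 (adj_par y.2)
  choose e he using h
  have hinj : Function.Injective e := by
    intro y y' h
    have h1 := (he y).symm.trans (h ▸ he y')
    rw [Sym2.eq_iff] at h1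
    rcases h1 with ⟨h1, -⟩ | ⟨h1, h2⟩
    · exact Subtype.ext h1
    · have h3 := (I.rooting r).lev_par _ y.2
      have h4 := (I.rooting r).lev_par _ y'.2
      rw [h2] at h3
      rw [← h1] at h4
      exact absurd h3 h4.asymm
  refine ⟨Equiv.ofBijective e ((Fintype.bijective_iff_injective_and_card e).2 ⟨hinj, ?_⟩), he⟩
  rw [Fintype.card_subtype_compl]
  simp

/-- Indexing the edges by their lower ends, the edge of `y` contributes to `y` and to its parent.
The result is the condition of `StripInv` before any vertex has been removed. -/
theorem incidentSum_eq_childSum {α : Type} [AddCommMonoid α] {e₁ e₂ : ℕ → ℕ} {f : ℕ → ℕ → α}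
    {G : Fin N → Fin N → α} (h₁ : ∀ k : Fin (N - 1), e₁ k = (I.edge k).1)
    (h₂ : ∀ k : Fin (N - 1), e₂ k = (I.edge k).2)
    (hf₁ : ∀ k : Fin (N - 1), f k (e₂ k) = G (I.edge k).1 (I.edge k).2)
    (hf₂ : ∀ k : Fin (N - 1), f k (e₁ k) = G (I.edge k).2 (I.edge k).1) (v : Fin N) :
    incidentSum (N - 1) e₁ e₂ f v = (I.rooting r).childSum ∅ (fun y => G ((I.rooting r).par y) y) v +
      if v = (I.rooting r).root then 0 else G v ((I.rooting r).par v) := by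
  obtain ⟨e, he⟩ := I.exists_edge_equiv r
  set p := (I.rooting r).par with hp
  have hterm : ∀ y : {y : Fin N // y ≠ r},
      ((if v = (I.edge (e y)).1 then G (I.edge (e y)).1 (I.edge (e y)).2 else 0) +
        if v = (I.edge (e y)).2 then G (I.edge (e y)).2 (I.edge (e y)).1 else 0) =
      (if p y = v then G (p y) y else 0) + if v = y then G v (p v) else 0 := by
    intro y
    rcases Sym2.eq_iff.1 (he y) with ⟨h1, h2⟩ | ⟨h1, h2⟩
    · rw [h1, h2, add_comm]
      congr 1
      · simp only [eq_comm (a := v)]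
      · by_cases h : v = y
        · rw [if_pos h, if_pos h, h]
        · rw [if_neg h, if_neg h]
    · rw [h1, h2]
      congr 1
      · simp only [eq_comm (a := v)]
      · by_cases h : v = y
        · rw [if_pos h, if_pos h, h]
        · rw [if_neg h, if_neg h]
  unfold incidentSum
  rw [← Fin.sum_univ_eq_sum_range
    (fun k => (if (v : ℕ) = e₁ k then f k (e₂ k) else 0) + if (v : ℕ) = e₂ k then f k (e₁ k) else 0)]
  simp only [h₁, h₂, Fin.val_inj]
  simp only [← h₁, ← h₂, hf₁, hf₂]
  rw [← Equiv.sum_comp e, sum_congr rfl fun y _ => hterm y, sum_add_distrib]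
  congr 1
  · rw [← sum_subtype (univ.filter fun y => y ≠ r) (by simp)
      (fun y => if p y = v then G (p y) y else 0), ← sum_filter, filter_filter, Rooting.childSum]
    refine sum_congr (filter_congr fun y _ => ?_) fun _ _ => rfl
    simp only [notMem_empty, not_false_iff, true_and]
    rfl
  · rw [← sum_subtype (univ.filter fun y => y ≠ r) (by simp)
      (fun y => if v = y then G v (p v) else 0), sum_ite_eq]
    by_cases h : v = r
    · rw [if_neg (by simpa using h), if_pos (by exact h)]
    · rw [if_pos (by simpa using h), if_neg (by exact h)]

end Instance

end UncertainTree

/-! ## Preprocessing -/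

namespace UncertainTree

open RealRAM Finset

/-- Root the tree and compute the depths of its vertices. -/
def rootTree : Cmd := .setN 5 (.sub (.var 0) (.lit 1)) ;; degrees ;; strip ;; depths

/-- Compute the lowest common ancestors of the locations and the medians. -/
def commonAncestors : Cmd :=
  .forUp 20 0 (.putN 8 (.var 20) (.lit 1)) ;; sizes ;; starts ;; liftTable ;; lcaDepths

/-- Compute the highest covering points. -/
def highest : Cmd := search ;; interpolate

/-- Build the segment tree over the uncertain points, ordered by their medians. -/
def segments : Cmd := countMedians ;; sizes ;; starts ;; positions ;; buildTree

/-- The preprocessing program. -/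
def buildCmd : Cmd := rootTree ;; commonAncestors ;; highest ;; segments

namespace Instance

variable {N n M : ℕ} {I : Instance N n M} {med : Fin n → Fin N} {r : Fin N} {W : ℕ}

theorem toArray_apply {α : Type} [Zero α] {m : ℕ} (f : Fin m → α) (k : Fin m) :
    toArray f k = f k := dif_pos k.isLt

/-- The state holds the input and the rooted tree. -/
structure Rooted (I : Instance N n M) (med : Fin n → Fin N) (r : Fin N) (q : ℕ → Fin N)
    (s : State) : Prop where
  order : (I.rooting r).IsOrder q
  stored : (I.rooting r).Stored q s
  held : (I.points med).Held s
  ra5 : ∀ v : Fin N, s.ra 5 v = I.plen r v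
  ra6 : ∀ v : Fin N, s.ra 6 v = I.vdist v r

theorem Rooted.of_frame {q : ℕ → Fin N} {c : Cmd} {s s' : State} (h : I.Rooted med r q s)
    (hf : Frame c s s') (h1 : (c.writesNv 0 || c.writesNv 3 || c.writesNv 5 || c.writesNa 6 ||
      c.writesNa 7) = false)
    (h2 : (c.writesNv 1 || c.writesNv 2 || c.writesRv 0 || c.writesNa 2 || c.writesNa 3 ||
      c.writesNa 4 || c.writesRa 1 || c.writesRa 2) = false)
    (h3 : (c.writesRa 5 || c.writesRa 6) = false) : I.Rooted med r q s' := by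
  rw [Bool.or_eq_false_iff] at h3
  exact ⟨h.order, h.stored.of_frame hf h1, h.held.of_frame hf h2,
    by rw [hf.ra 5 h3.1]; exact h.ra5, by rw [hf.ra 6 h3.2]; exact h.ra6⟩

theorem held_initState : (I.points med).Held (I.initState med r) where
  nv1 := rfl
  nv2 := rfl
  rv0 := rfl
  na2 j := toArray_apply (fun k => (I.loc k : ℕ)) j
  na3 j := toArray_apply (fun k => (I.owner k : ℕ)) j
  na4 i := toArray_apply (fun i => (med i : ℕ)) i
  ra1 j := toArray_apply _ j
  ra2 i := toArray_apply _ i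

theorem rootTree_spec (hW : 4 * ((N + 1) * (N + 1)) < W) :
    WP W rootTree (1000 * (N + 1)) (I.initState med r) fun s => ∃ q, I.Rooted med r q s := by
  have hNN : N ≤ N * N := Nat.le_mul_self N
  have hW' : 4 * (N * N) + 8 * N + 4 < W := by nlinarith
  have hlt := r.isLt
  set s₀ := I.initState med r with hs₀
  have hP₀ : (I.points med).Held s₀ := held_initState
  have hvc : (Cmd.setN 5 (.sub (.var 0) (.lit 1))).vc W (fun s => s.nv 0 = N ∧ s.nv 5 = N - 1 ∧
      s.nv 3 = r ∧ s.na = s₀.na ∧ s.ra = s₀.ra) s₀ := by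
    have h0 : s₀.nv 0 = N := rfl
    have h3 : s₀.nv 3 = r := rfl
    simp [h0, h3]
    omega
  have e0 : ∀ k : Fin (N - 1), s₀.na 0 k = (I.edge k).1 := fun k =>
    toArray_apply (fun k => ((I.edge k).1 : ℕ)) k
  have e1 : ∀ k : Fin (N - 1), s₀.na 1 k = (I.edge k).2 := fun k =>
    toArray_apply (fun k => ((I.edge k).2 : ℕ)) k
  have e2 : ∀ k : Fin (N - 1), s₀.ra 0 k = I.len s((I.edge k).1, (I.edge k).2) := fun k =>
    toArray_apply (fun k => I.len s((I.edge k).1, (I.edge k).2)) k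
  refine (WP.seq ((WP.of_vc_le (T := 10) (by decide) hvc).frame.mono le_rfl ?_)).mono
    (T := 10 + (120 * ((N - 1) + 1) + (400 * (N + 1) + 120 * (N + 1)))) (by omega) fun _ h => h
  rintro s₁ ⟨⟨h0, h5, h3, ena, era⟩, hf₁⟩
  refine WP.seq ((degrees_spec h5 (by omega) ?_ ?_ ?_ ?_ ?_ hW).frame.mono le_rfl ?_)
  · intro k hk
    rw [ena]
    exact (e0 ⟨k, hk⟩).trans_lt (Fin.isLt _)
  · intro k hk
    rw [ena]
    exact (e1 ⟨k, hk⟩).trans_lt (Fin.isLt _)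
  · intro v; rw [ena]; rfl
  · intro v; rw [ena]; rfl
  · intro v; rw [era]; rfl
  rintro s₂ ⟨⟨d5, d6, dr⟩, hf₂⟩
  rw [ena] at d5 d6 dr
  rw [era] at dr
  have hlen : ∀ v, v ≠ r → I.len s(v, (I.rooting r).par v) = I.plen r v := fun v hv =>
    (I.vdist_adj (adj_par hv)).symm
  refine WP.seq ((Rooting.strip_spec (R := I.rooting r) (plen := I.plen r)
    ((hf₂.nv 0 rfl).trans h0) ((hf₂.nv 5 rfl).trans h5) ((hf₂.nv 3 rfl).trans h3) hW
    (fun v => ?_) (fun v => ?_) (fun v => ?_) ?_).frame.mono le_rfl ?_)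
  · rw [d5]
    exact incidentSum_eq_childSum (G := fun _ _ => 1) e0 e1 (fun _ => rfl) (fun _ => rfl) v
  · rw [d6]
    exact incidentSum_eq_childSum (G := fun _ w => (w : ℕ)) e0 e1 e1 e0 v
  · rw [dr, incidentSum_eq_childSum (r := r) (G := fun u w => I.len s(u, w)) e0 e1 e2
      (fun k => by rw [e2, Sym2.eq_swap]) v]
    congr 1
    · refine sum_congr rfl fun y hy => ?_
      dsimp only
      rw [← hlen y (mem_filter.1 hy).2.2.1, Sym2.eq_swap]
    · split_ifs with h
      · rfl
      · exact hlen v h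
  · change I.vdist r ((I.rooting r).par r) = 0
    rw [show (I.rooting r).par r = r from (I.rooting r).par_root, vdist_self]
  rintro s₃ ⟨⟨q, hq, h7, h6, h5'⟩, hf₃⟩
  have hs₃ : (I.rooting r).Stored q s₃ := ⟨(hf₃.nv 0 rfl).trans ((hf₂.nv 0 rfl).trans h0),
    (hf₃.nv 3 rfl).trans ((hf₂.nv 3 rfl).trans h3), (hf₃.nv 5 rfl).trans ((hf₂.nv 5 rfl).trans h5),
    h6, h7⟩
  refine (Rooting.depths_spec (plen := I.plen r) (dep := fun v => I.vdist v r) hq hs₃ (by omega)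
    h5' ?_ (I.vdist_self r) fun v _ => I.vdist_root v).frame.mono le_rfl ?_
  · rw [hf₃.ra 6 rfl, hf₂.ra 6 rfl, era]; rfl
  · rintro s₄ ⟨h, hf₄⟩
    exact ⟨q, hq, hs₃.of_frame hf₄ rfl, (((hP₀.of_frame hf₁ rfl).of_frame hf₂ rfl).of_frame hf₃
      rfl).of_frame hf₄ rfl, by rw [hf₄.ra 5 rfl]; exact h5', h⟩

theorem commonAncestors_spec {q : ℕ → Fin N} {s₀ : State} (h : I.Rooted med r q s₀)
    (hW : 4 * ((N + 1) * (N + 1)) < W) (hMW : M + 1 < W) (hnW : n < W) (hNM : N ≤ M) :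
    WP W commonAncestors (2000 * ((M + 1) * (Nat.log 2 M + 2))) s₀ fun s =>
      (∃ L, (I.rooting r).Lifted L s) ∧ ∃ g, I.IsLcaDepth med r g ∧ ∀ j : Fin M, s.ra 7 j = g j := by
  have hNN : N ≤ N * N := Nat.le_mul_self N
  have hW' : 4 * (N * N) + 8 * N + 4 < W := by nlinarith
  have hlog : Nat.log 2 N ≤ Nat.log 2 M := Nat.log_mono_right hNM
  have hMM : (M + 1) * 2 ≤ (M + 1) * (Nat.log 2 M + 2) := Nat.mul_le_mul_left _ (by omega)
  have hmul : (N + 1) * (Nat.log 2 N + 2) ≤ (M + 1) * (Nat.log 2 M + 2) :=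
    Nat.mul_le_mul (by omega) (by omega)
  have hsum : ∑ _v : Fin N, 1 < W := by simp; omega
  have hfill := WP.forUp (W := W) (x := 20) (y := 0) (n := N) (T := 60) (s₀ := s₀)
    (c := .putN 8 (.var 20) (.lit 1)) (fun k s => ∀ v : Fin N, v < k → s.na 8 v = 1)
    rfl rfl (by decide) h.stored.nv0 (by omega) (fun _ _ _ h => h) (by simp) (by
      intro k hk s hf hx hy h
      refine WP.of_vc_le (by decide) ?_
      simp only [Cmd.vc, NExp.ok, NExp.val, hx, State.putN_na, if_true]
      refine ⟨by omega, by omega, fun v hv => ?_⟩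
      split_ifs with h1
      · rfl
      · exact h v (by omega))
  refine (WP.seq (hfill.mono le_rfl ?_)).mono (T := (N * (60 + 9) + 8) + (240 * (N + 1) +
    (120 * (N + 1) + (300 * ((N + 1) * (Nat.log 2 N + 2)) +
      300 * ((M + 1) * (Nat.log 2 M + 2)))))) (by omega) fun _ h => h
  rintro s₁ ⟨h8, hf₁⟩
  have h₁ := h.of_frame hf₁ rfl rfl rfl
  have c8 : ∀ v : Fin N, s₁.na 8 v = 1 := fun v => h8 v v.isLt
  refine WP.seq ((Rooting.sizes_spec (c := fun _ => 1) h₁.order h₁.stored (by omega) c8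
    hsum).frame.mono le_rfl ?_)
  rintro s₂ ⟨hsz, hf₂⟩
  have h₂ := h₁.of_frame hf₂ rfl rfl rfl
  refine WP.seq ((Rooting.starts_spec (c := fun _ => 1) h₂.order h₂.stored (by omega)
    (by rw [hf₂.na 8 rfl]; exact c8) (fun _ => rfl) hsum hsz).frame.mono le_rfl ?_)
  rintro s₃ ⟨hI, hf₃⟩
  have h₃ := h₂.of_frame hf₃ rfl rfl rfl
  refine WP.seq ((Rooting.liftTable_spec h₃.stored hW).frame.mono le_rfl ?_)
  rintro s₄ ⟨⟨L, hL⟩, hf₄⟩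
  have h₄ := h₃.of_frame hf₄ rfl rfl rfl
  refine (Points.lcaDepths_spec h₄.held h₄.stored hL hW hMW hnW hI
    (by rw [hf₄.na 10 rfl]; exact fun _ => rfl)
    (by rw [hf₄.na 9 rfl, hf₃.na 9 rfl]; exact fun _ => rfl) h₄.ra6).frame.mono ?_ ?_
  · have := hL.le_log
    exact Nat.mul_le_mul_left _ (Nat.mul_le_mul_left _ (by omega))
  · rintro s₅ ⟨h, hf₅⟩
    choose z hz h7 using h
    exact ⟨⟨L, hL.of_frame hf₅ rfl⟩, fun j => I.vdist (z j) r, fun j => ⟨z j, hz j, rfl⟩, h7⟩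

theorem highest_spec {q : ℕ → Fin N} {L : ℕ} {g : Fin M → ℝ} {s₀ : State}
    (h : I.Rooted med r q s₀) (hL : (I.rooting r).Lifted L s₀)
    (h7 : ∀ j : Fin M, s₀.ra 7 j = g j)
    (hm : ∀ i, I.edAt med r g i (I.vdist (med i) r) ≤ I.range)
    (hW : 4 * ((N + 1) * (N + 1)) < W) (hMW : M + 1 < W) (hnW : n + 1 < W) (hNM : N ≤ M)
    (hnM : n ≤ M) :
    WP W highest (4000 * ((M + 1) * (Nat.log 2 M + 2))) s₀ fun s => ∃ x : Fin n → Fin N,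
      (∀ i, I.IsHighest med r g i (x i)) ∧ ∀ i : Fin n, s.na 16 i = x i ∧
        s.na 17 i = (I.rooting r).par (x i) ∧ s.ra 13 i = I.offset med r g i (x i) ∧
        s.ra 12 i = I.vdist (x i) r - I.offset med r g i (x i) := by
  have hlog : Nat.log 2 N ≤ Nat.log 2 M := Nat.log_mono_right hNM
  have hLl := hL.le_log
  have hMM : (M + 1) * 2 ≤ (M + 1) * (Nat.log 2 M + 2) := Nat.mul_le_mul_left _ (by omega)
  have hmul : (n + M + 1) * (L + 1) ≤ 2 * ((M + 1) * (Nat.log 2 M + 2)) := by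
    rw [← mul_assoc]
    exact Nat.mul_le_mul (by omega) (by omega)
  refine (WP.seq ((Points.search_spec h.held h.stored hL hW hMW hnW h.ra6 h7 hm
    fun i y hy hle => ?_).frame.mono le_rfl ?_)).mono
    (T := 800 * ((n + M + 1) * (L + 1)) + 1000 * (n + M + 1)) (by omega) fun _ h => h
  -- The depth of `y` is between the depths of its parent and of the median, where the point is
  -- covered.
  · exact edAt_le_of_le (by linarith [I.vdist_root (r := r) y, vdist_par_nonneg (I := I) (r := r) y])
      (by linarith [vdist_root_of_anc (show (I.rooting r).Anc y (med i) from hy), I.vdist_nonneg (med i) y]) hle (hm i)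
  rintro s₁ ⟨⟨x, h13, hx⟩, hf₁⟩
  have h₁ := h.of_frame hf₁ rfl rfl rfl
  have hNN : N ≤ N * N := Nat.le_mul_self N
  have hW' : 4 * (N * N) + 8 * N + 4 < W := by nlinarith
  refine (Points.interpolate_spec h₁.held h₁.stored (by omega) hMW hnW h₁.ra5 h₁.ra6
    (by rw [hf₁.ra 7 rfl]; exact h7) h13 (fun i => (hx i).2.1) (fun i => (hx i).2.2)).mono le_rfl ?_
  intro s hs
  exact ⟨x, fun i => ⟨(hx i).1, (hx i).2.1, (hx i).2.2⟩, hs⟩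

/-- The depths of the highest covering points, with the root as a sentinel. -/
noncomputable def key (I : Instance N n M) (med : Fin n → Fin N) (r : Fin N) (g : Fin M → ℝ)
    (x : Fin n → Fin N) (j : ℕ) : ℝ :=
  if h : j < n then I.vdist (x ⟨j, h⟩) r - I.offset med r g ⟨j, h⟩ (x ⟨j, h⟩) else 0

theorem key_apply {g : Fin M → ℝ} {x : Fin n → Fin N} (i : Fin n) :
    I.key med r g x i = I.vdist (x i) r - I.offset med r g i (x i) := dif_pos i.isLt

theorem key_sentinel {g : Fin M → ℝ} {x : Fin n → Fin N} : I.key med r g x n = 0 :=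
  dif_neg (lt_irrefl n)

/-- The state holds the data structure, where the points in `D` have been deactivated. -/
structure Serves (I : Instance N n M) (med : Fin n → Fin N) (r : Fin N) (g : Fin M → ℝ)
    (x : Fin n → Fin N) (lo sz : Fin N → ℕ) (D : Set (Fin n)) (s : State) : Prop where
  ready : Ready ((I.points med).pos lo) (I.key med r g x) D s
  na9 : ∀ v : Fin N, s.na 9 v = sz v
  na10 : ∀ v : Fin N, s.na 10 v = lo v
  ra6 : ∀ v : Fin N, s.ra 6 v = I.vdist v r
  center : ∀ i : Fin n, s.na 16 i = x i ∧ s.na 17 i = (I.rooting r).par (x i) ∧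
    s.ra 13 i = I.offset med r g i (x i)
  sentinel : s.na 16 n = r ∧ s.na 17 n = r ∧ s.ra 13 n = 0

/-- The intervals are computed a second time, now counting each vertex with the number of its
medians. This overwrites the first intervals, which served only to find the lowest common ancestors.
-/
theorem segments_spec {q : ℕ → Fin N} {g : Fin M → ℝ} {x : Fin n → Fin N} {s₀ : State}
    (h : I.Rooted med r q s₀) (hx : ∀ i : Fin n, s₀.na 16 i = x i ∧
        s₀.na 17 i = (I.rooting r).par (x i) ∧ s₀.ra 13 i = I.offset med r g i (x i) ∧
        s₀.ra 12 i = I.vdist (x i) r - I.offset med r g i (x i))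
    (hNW : N + 1 < W) (hnW : 3 * n + 3 < W) (hn : 1 ≤ n) :
    WP W segments (1000 * (N + n + 1)) s₀ fun s => ∃ lo sz,
      (I.rooting r).Intervals (I.points med).medCount lo sz ∧ I.Serves med r g x lo sz ∅ s := by
  have hr := r.isLt
  have hsum := (I.points med).sum_medCount.trans_lt (show n < W by omega)
  refine (WP.seq ((Points.countMedians_spec h.held h.stored hNW (by omega)).frame.mono le_rfl
    ?_)).mono (T := 200 * (N + n + 1) + (240 * (N + 1) + (120 * (N + 1) + (100 * (n + 1) +
      300 * (n + 1))))) (by omega) fun _ h => h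
  rintro s₁ ⟨c8, hf₁⟩
  have h₁ := h.of_frame hf₁ rfl rfl rfl
  refine WP.seq ((Rooting.sizes_spec h₁.order h₁.stored hNW c8 hsum).frame.mono le_rfl ?_)
  rintro s₂ ⟨hsz, hf₂⟩
  have h₂ := h₁.of_frame hf₂ rfl rfl rfl
  have c8₂ : ∀ v : Fin N, s₂.na 8 v = (I.points med).medCount v := by rw [hf₂.na 8 rfl]; exact c8
  refine WP.seq ((Rooting.starts_spec h₂.order h₂.stored hNW c8₂ (fun _ => rfl) hsum
    hsz).frame.mono le_rfl ?_)
  rintro s₃ ⟨hI, hf₃⟩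
  have h₃ := h₂.of_frame hf₃ rfl rfl rfl
  refine WP.seq ((Points.positions_spec h₃.held hNW (by omega) hI
    (by rw [hf₃.na 8 rfl]; exact c8₂) (fun _ => rfl)).frame.mono le_rfl ?_)
  rintro s₄ ⟨h18, hf₄⟩
  have h₄ := h₃.of_frame hf₄ rfl rfl rfl
  refine (buildTree_spec (key := I.key med r g x) h₄.held h₄.stored.nv3 (show (r : ℕ) < W by omega)
    (Points.pos_lt_n hI) (Points.pos_injective hI) (fun _ => Points.exists_pos_eq hI) hn hnW h18
    (fun i => ?_) key_sentinel).frame.mono le_rfl ?_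
  · rw [hf₄.ra 12 rfl, hf₃.ra 12 rfl, hf₂.ra 12 rfl, hf₁.ra 12 rfl, key_apply]
    exact (hx i).2.2.2
  · rintro s₅ ⟨⟨hR, h16, h17, h13, hold⟩, hf₅⟩
    refine ⟨_, _, hI, hR, ?_, ?_, by rw [hf₅.ra 6 rfl]; exact h₄.ra6, fun i => ?_, h16, h17, h13⟩
    · rw [hf₅.na 9 rfl, hf₄.na 9 rfl, hf₃.na 9 rfl]; exact fun _ => rfl
    · rw [hf₅.na 10 rfl, hf₄.na 10 rfl]; exact fun _ => rfl
    · obtain ⟨e16, e17, e13⟩ := hold i i.isLt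
      rw [e16, e17, e13, hf₄.na 16 rfl, hf₄.na 17 rfl, hf₄.ra 13 rfl, hf₃.na 16 rfl, hf₃.na 17 rfl,
        hf₃.ra 13 rfl, hf₂.na 16 rfl, hf₂.na 17 rfl, hf₂.ra 13 rfl, hf₁.na 16 rfl, hf₁.na 17 rfl,
        hf₁.ra 13 rfl]
      exact ⟨(hx i).1, (hx i).2.1, (hx i).2.2.1⟩

end Instance

end UncertainTree

/-! ## Correctness of the data structure -/

namespace UncertainTree

open RealRAM Finset

namespace Instance

variable {N n M : ℕ} {I : Instance N n M} {med : Fin n → Fin N} {r : Fin N} {W : ℕ}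
  {g : Fin M → ℝ} {x : Fin n → Fin N} {lo sz : Fin N → ℕ}

theorem Serves.of_frame {D D' : Set (Fin n)} {c : Cmd} {s s' : State}
    (h : I.Serves med r g x lo sz D s) (hf : Frame c s s')
    (hR : Ready ((I.points med).pos lo) (I.key med r g x) D' s')
    (hc : (c.writesNa 9 || c.writesNa 10 || c.writesNa 16 || c.writesNa 17 || c.writesRa 6 ||
      c.writesRa 13) = false) : I.Serves med r g x lo sz D' s' := by
  simp only [Bool.or_eq_false_iff] at hc
  obtain ⟨⟨⟨⟨⟨c1, c2⟩, c3⟩, c4⟩, c5⟩, c6⟩ := hc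
  refine ⟨hR, ?_, ?_, ?_, ?_, ?_⟩
  · rw [hf.na 9 c1]; exact h.na9
  · rw [hf.na 10 c2]; exact h.na10
  · rw [hf.ra 6 c5]; exact h.ra6
  · rw [hf.na 16 c3, hf.na 17 c4, hf.ra 13 c6]; exact h.center
  · rw [hf.na 16 c3, hf.na 17 c4, hf.ra 13 c6]; exact h.sentinel

theorem Serves.setN_zero {D : Set (Fin n)} {s : State} (h : I.Serves med r g x lo sz D s) (k : ℕ) :
    I.Serves med r g x lo sz D (s.setN 0 k) :=
  ⟨⟨by simpa using h.ready.nv4, h.ready.na18, h.ready.ra12, h.ready.tree⟩, h.na9, h.na10, h.ra6,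
    h.center, h.sentinel⟩

theorem Serves.query (hI : (I.rooting r).Intervals (I.points med).medCount lo sz)
    (hg : I.IsLcaDepth med r g) (hm : ∀ i, I.edAt med r g i (I.vdist (med i) r) ≤ I.range)
    (hx : ∀ i, I.IsHighest med r g i (x i)) (hNW : N < W) (hnW : 3 * n + 3 < W) (hn : 1 ≤ n)
    {D : Set (Fin n)} {s : State} (h : I.Serves med r g x lo sz D s) (v : Fin N) :
    WP W queryCmd (400 * (Nat.log 2 n + 1)) (s.setN 0 v) fun s' =>
      I.IsAnswer med r D v s' ∧ I.Serves med r g x lo sz D s' := by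
  have h' := h.setN_zero v
  have hr := r.isLt
  have hle := hI.hi_le v
  rw [(I.points med).sum_medCount] at hle
  have harr : ∀ j ≤ n, (s.setN 0 v).na 16 j < W ∧ (s.setN 0 v).na 17 j < W := by
    intro j hj
    rcases hj.eq_or_lt with rfl | hj
    · rw [h'.sentinel.1, h'.sentinel.2.1]; omega
    · have := h'.center ⟨j, hj⟩
      simp only at this
      rw [this.1, this.2.1]; omega
  refine (query_spec (fun _ => Points.exists_pos_eq hI) hn hnW h'.ready (v := v) (by simp)
    (by omega) (h'.na10 v) (h'.na9 v) hle (fun j hj => (harr j hj).1)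
    (fun j hj => (harr j hj).2)).frame.mono le_rfl ?_
  rintro s' ⟨⟨res, hres, hmem, hbest, hsome, hnone⟩, hf⟩
  refine ⟨?_, h'.of_frame hf (h'.ready.of_frame hf rfl) rfl⟩
  rw [h'.ra6] at hsome hnone
  refine isAnswer_of_best hg hm hx (k := I.key med r g x res) (fun i hi hv => ?_) ?_ hnone
  · rw [← key_apply]
    obtain ⟨h1, h2⟩ := (Points.anc_iff_pos hI v i).1 hv
    exact hbest i hi h1 h2
  · rcases hmem with rfl | ⟨i, hi, rfl, h1, h2⟩
    · rw [h'.sentinel.1, h'.sentinel.2.1, h'.sentinel.2.2] at hsome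
      exact .inl ⟨key_sentinel, hsome⟩
    · obtain ⟨e1, e2, e3⟩ := h'.center i
      rw [e1, e2, e3] at hsome
      exact .inr ⟨i, hi, (Points.anc_iff_pos hI v i).2 ⟨h1, h2⟩, key_apply i, hsome⟩

theorem Serves.delete (hI : (I.rooting r).Intervals (I.points med).medCount lo sz)
    (hnW : 3 * n + 3 < W) {D : Set (Fin n)} {s : State} (h : I.Serves med r g x lo sz D s)
    (i : Fin n) :
    WP W deleteCmd (200 * (Nat.log 2 n + 1)) (s.setN 0 i)
      (I.Serves med r g x lo sz (insert i D)) := by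
  have h' := h.setN_zero i
  refine (delete_spec (Points.pos_lt_n hI) (Points.pos_injective hI) hnW h'.ready
    (i := i) (by simp)).frame.mono le_rfl ?_
  rintro s' ⟨hR, hf⟩
  exact h'.of_frame hf hR rfl

/-- Queries leave the data structure intact and deletions update it. The runs in `Reachable` are the
ones specified above, by `Runs.deterministic`. -/
theorem Serves.of_reachable (hI : (I.rooting r).Intervals (I.points med).medCount lo sz)
    (hg : I.IsLcaDepth med r g) (hm : ∀ i, I.edAt med r g i (I.vdist (med i) r) ≤ I.range)
    (hx : ∀ i, I.IsHighest med r g i (x i)) (hNW : N < W) (hnW : 3 * n + 3 < W) (hn : 1 ≤ n)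
    {s₀ : State} (h : I.Serves med r g x lo sz ∅ s₀) {D : Set (Fin n)} {s : State}
    (hr : I.Reachable W queryCmd deleteCmd med s₀ D s) : I.Serves med r g x lo sz D s := by
  induction hr with
  | start => exact h
  | query _ _ hrun ih =>
    obtain ⟨s', t, hr', -, -, hs⟩ := ih.query hI hg hm hx hNW hnW hn _
    rwa [hrun.deterministic hr']
  | delete _ _ hrun ih =>
    obtain ⟨s', t, hr', -, hs⟩ := ih.delete hI hnW _
    rwa [hrun.deterministic hr']

theorem build_spec (hm : ∀ i, I.Covers (I.vertexPoint (med i)) i)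
    (hW : 4 * ((N + 1) * (N + 1)) < W) (hMW : M + 1 < W) (hnW : 3 * n + 3 < W) (hNM : N ≤ M)
    (hnM : n ≤ M) (hn : 1 ≤ n) :
    WP W buildCmd (8000 * ((M + 1) * (Nat.log 2 M + 2))) (I.initState med r) fun s =>
      ∃ g x lo sz, I.IsLcaDepth med r g ∧
        (∀ i, I.edAt med r g i (I.vdist (med i) r) ≤ I.range) ∧
        (∀ i, I.IsHighest med r g i (x i)) ∧
        (I.rooting r).Intervals (I.points med).medCount lo sz ∧ I.Serves med r g x lo sz ∅ s := by
  have hNN : N ≤ N * N := Nat.le_mul_self N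
  have hW' : 4 * (N * N) + 8 * N + 4 < W := by nlinarith
  have hMM : (M + 1) * 2 ≤ (M + 1) * (Nat.log 2 M + 2) := Nat.mul_le_mul_left _ (by omega)
  refine (WP.seq ((rootTree_spec hW).mono le_rfl ?_)).mono (T := 1000 * (N + 1) +
    (2000 * ((M + 1) * (Nat.log 2 M + 2)) + (4000 * ((M + 1) * (Nat.log 2 M + 2)) +
      1000 * (N + n + 1)))) (by omega) fun _ h => h
  rintro s₁ ⟨q, h₁⟩
  refine WP.seq ((commonAncestors_spec h₁ hW hMW (by omega) hNM).frame.mono le_rfl ?_)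
  rintro s₂ ⟨⟨⟨L, hL⟩, g, hg, h7⟩, hf₂⟩
  have h₂ := h₁.of_frame hf₂ rfl rfl rfl
  have hm' := fun i => edAt_med_le hg (hm i)
  refine WP.seq ((highest_spec h₂ hL h7 hm' hW hMW (by omega) hNM hnM).frame.mono le_rfl ?_)
  rintro s₃ ⟨⟨x, hx, hs⟩, hf₃⟩
  refine (segments_spec (h₂.of_frame hf₃ rfl rfl rfl) hs (by omega) hnW hn).mono le_rfl ?_
  rintro s₄ ⟨lo, sz, hI, hS⟩
  exact ⟨g, x, lo, sz, hg, hm', hx, hI, hS⟩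

theorem card_vertices_le (I : Instance N n M) : N ≤ M := by
  simpa using Fintype.card_le_of_surjective I.loc I.loc_surjective

/-- An uncertain point without locations would have total probability `0` instead of `1`. -/
theorem card_points_le (I : Instance N n M) : n ≤ M := by
  have : Function.Surjective I.owner := by
    intro i
    by_contra hne
    have h := I.prob_sum i
    rw [filter_false_of_mem fun k _ hk => hne ⟨k, hk⟩, sum_empty] at h
    exact zero_ne_one h
  simpa using Fintype.card_le_of_surjective I.owner this

end Instance

end UncertainTree

/-! ### The main theorem -/

/-- One fixed triple of programs (preprocessing, query, deletion) of a real RAM whose integer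
words have `κ * log₂ (M + 1)` bits. -/
theorem mainTheorem9 :
    ∃ (build query delete : RealRAM.Cmd) (κ C : ℕ),
      ∀ (N n M : ℕ) (I : UncertainTree.Instance N n M) (med : Fin n → Fin N) (r : Fin N),
        (∀ i, I.IsMedian (med i) i) →
        (∀ i, I.Covers (I.vertexPoint (med i)) i) →
        r ∈ Set.range med →
        ∃ (s₀ : RealRAM.State) (t₀ : ℕ),
          RealRAM.Runs ((M + 1) ^ κ) build (I.initState med r) s₀ t₀ ∧
          t₀ ≤ C * (M * Nat.log 2 M + n * Nat.log 2 M ^ 2 + 1) ∧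
          ∀ (D : Set (Fin n)) (s : RealRAM.State),
            I.Reachable ((M + 1) ^ κ) query delete med s₀ D s →
              (∀ v ∈ I.medianTree med, ∃ (s' : RealRAM.State) (t : ℕ),
                RealRAM.Runs ((M + 1) ^ κ) query (s.setN 0 v) s' t ∧
                t ≤ C * (Nat.log 2 n + 1) ∧ I.IsAnswer med r D v s') ∧
              (∀ i ∉ D, ∃ (s' : RealRAM.State) (t : ℕ),
                RealRAM.Runs ((M + 1) ^ κ) delete (s.setN 0 i) s' t ∧
                t ≤ C * (Nat.log 2 n + 1)) := by
  -- For `M ≥ 1` the sixth power of `M + 1` is at least `16 * (M + 1) ^ 2`, which exceeds all word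
  -- bounds required. The constant is `48000 = 6 * 8000`, from the factor 6 below and the bound of
  -- `build_spec`.
  refine ⟨UncertainTree.buildCmd, UncertainTree.queryCmd, UncertainTree.deleteCmd, 6, 48000,
    fun N n M I med r _ hcov hr => ?_⟩
  obtain ⟨i₀, -⟩ := hr
  have hn : 1 ≤ n := i₀.pos
  have hNM := I.card_vertices_le
  have hnM := I.card_points_le
  have hM : 1 ≤ M := hn.trans hnM
  have hpow : 16 * ((M + 1) * (M + 1)) ≤ (M + 1) ^ 6 := by
    have h4 : 2 ^ 4 ≤ (M + 1) ^ 4 := Nat.pow_le_pow_left (by omega) 4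
    calc 16 * ((M + 1) * (M + 1)) ≤ (M + 1) ^ 4 * ((M + 1) * (M + 1)) :=
          Nat.mul_le_mul_right _ (by simpa using h4)
      _ = (M + 1) ^ 6 := by ring
  have hMM : (M + 1) * 2 ≤ (M + 1) * (M + 1) := Nat.mul_le_mul_left _ (by omega)
  have hNN : (N + 1) * (N + 1) ≤ (M + 1) * (M + 1) := Nat.mul_le_mul (by omega) (by omega)
  obtain ⟨s₀, t₀, hrun, ht₀, g, x, lo, sz, hg, hm, hx, hI, hS⟩ :=
    UncertainTree.Instance.build_spec (W := (M + 1) ^ 6) (r := r) hcov (by omega) (by omega)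
      (by omega) hNM hnM hn
  refine ⟨s₀, t₀, hrun, ht₀.trans ?_, fun D s hreach => ?_⟩
  · have key : (M + 1) * (Nat.log 2 M + 2) ≤ 6 * (M * Nat.log 2 M + 1) := by
      -- For `M = 1` the logarithm vanishes and only the summand `1` is left to bound the time; from
      -- `M = 2` on the logarithm absorbs the constants.
      rcases hM.eq_or_lt with rfl | hM2
      · simp
      · have hlog : 1 ≤ Nat.log 2 M := Nat.log_pos (by decide) hM2
        calc (M + 1) * (Nat.log 2 M + 2) ≤ (2 * M) * (3 * Nat.log 2 M) :=
              Nat.mul_le_mul (by omega) (by omega)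
          _ ≤ 6 * (M * Nat.log 2 M + 1) := by
              rw [mul_mul_mul_comm]; omega
    have h2 : 0 ≤ n * Nat.log 2 M ^ 2 := Nat.zero_le _
    omega
  · have hs := hS.of_reachable hI hg hm hx (W := (M + 1) ^ 6) (by omega) (by omega) hn hreach
    refine ⟨fun v _ => ?_, fun i _ => ?_⟩
    · obtain ⟨s', t, hr', ht, hans, -⟩ :=
        hs.query hI hg hm hx (W := (M + 1) ^ 6) (by omega) (by omega) hn v
      exact ⟨s', t, hr', ht.trans (Nat.mul_le_mul_right _ (by decide)), hans⟩
    · obtain ⟨s', t, hr', ht, -⟩ := hs.delete hI (W := (M + 1) ^ 6) (by omega) i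
      exact ⟨s', t, hr', ht.trans (Nat.mul_le_mul_right _ (by decide))⟩
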